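/- Let $g,r,d$ be nonnegative integers with $g-d+r\ge 0$, and let $\alpha=(\alpha_0\ge\cdots\ge\alpha_r\ge 0)$ and $\beta=(\beta_0\ge\cdots\ge\beta_r\ge 0)$ be nonincreasing sequences of integers. Write $|\alpha|=\sum_i\alpha_i$, $|\beta|=\sum_i\beta_i$. Let $\sigma=\sigma(g,r,d,\alpha,\beta)$ be the skew Young diagram with $r+1$ rows, numbered $0,\dots,r$ from top to bottom, whose row $i$ consists of the boxes in the columns $c\in\mathbb{Z}$ with $-\alpha_{r-i}\le c< (g-d+r)+\beta_i$ (that is, an $(r+1)\times(g-d+r)$ rectangle with $\alpha$ placed from bottom to top on its left and $\beta$ from top to bottom on its right). A standard Young tableau of $\sigma$ is a bijective filling of its boxes by $1,\dots,g$ that increases along rows from left to right and down columns; let $N$ be the number of these tableaux. The distance of two boxes is the sum of their horizontal and vertical distances. For integers $1\le t<g$ and $a>0$, let $\pi_{t,a}$ be the permutation of the set of standard Young tableaux of $\sigma$ that exchanges the entries $t$ and $t+1$ in every tableau in which they are in different rows and different columns and at distance $a$, and fixes every other tableau. The EH group is the permutation group of the set of standard Young tableaux of $\sigma$ generated by all $\pi_{t,a}$.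 **Theorem.** Suppose that $$\rho(g,r,d,\alpha,\beta)=g-(r+1)(g-d+r)-|\alpha|-|\beta|=0,$$ that $r\ge 2$ and $\alpha_r+\beta_r+g-d+r>r+1$, and that the following conditions hold: 1. $\max\{\alpha_0-\alpha_r,1\}<\min_{0\le j<r}\{\alpha_{r-j-1}+\beta_j\}+g-d$; 2. $\sum_{i=0}^r(\alpha_i-\alpha_r)<\alpha_r+g-d+r+\beta_r$; 3. for every $0\le i<r$, $\alpha_{r-i}+\beta_i-1<\min_{i\le j<r}\{\alpha_{r-j-1}+\beta_j\}$; 4. for every $0<i<r$, $\alpha_{r-i}+\beta_i=\alpha_{r-1}+\beta_1\ge\alpha_r+\beta_0$. Then the EH group is either the alternating group $A_N$ or the symmetric group $S_N$ on the set of the $N$ standard Young tableaux of $\sigma$. -/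

import Mathlib

/-- The adjusted Brill–Noether number
`ρ(g,r,d,α,β) = g - (r+1)(g-d+r) - |α| - |β|`, as an integer. -/
def adjustedBrillNoether (g r d : ℕ) (α β : Fin (r + 1) → ℕ) : ℤ :=
  (g : ℤ) - ((r : ℤ) + 1) * ((g : ℤ) - d + r) - (∑ i, (α i : ℤ)) - (∑ i, (β i : ℤ))

/-- The skew Young diagram `σ(g,r,d,α,β)`. A box is a pair (row, column); the rows `0, …, r` are
numbered from top to bottom and the columns `0, …, g-d+r-1` are those of the central rectangle.
`α` is put from bottom to top on the left of the rectangle and `β` from top to bottom on its right,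
so row `i` has `α_{r-i}` extra boxes on the left and `β_i` extra boxes on the right. -/
noncomputable def skewShape (g r d : ℕ) (α β : Fin (r + 1) → ℕ) : Finset (Fin (r + 1) × ℤ) :=
  Finset.univ.biUnion fun i : Fin (r + 1) =>
    (Finset.Ico (-(α i.rev : ℤ)) ((g : ℤ) - d + r + β i)).image fun c => (i, c)

theorem mem_skewShape {g r d : ℕ} {α β : Fin (r + 1) → ℕ} {b : Fin (r + 1) × ℤ} :
    b ∈ skewShape g r d α β ↔
      -(α b.1.rev : ℤ) ≤ b.2 ∧ b.2 < (g : ℤ) - d + r + β b.1 := by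
  obtain ⟨i, c⟩ := b
  simp [skewShape]

/-- A filling of the boxes of `s` by `1, …, g`, each used once, is standard if it increases along
each row from left to right and down each column. -/
def IsStandardFilling {n g : ℕ} {s : Finset (Fin n × ℤ)}
    (T : {b // b ∈ s} ≃ {k // k ∈ Finset.Icc 1 g}) : Prop :=
  ∀ x y : {b // b ∈ s},
    (x.1.1 = y.1.1 ∧ x.1.2 < y.1.2) ∨ (x.1.2 = y.1.2 ∧ x.1.1 < y.1.1) → (T x).1 < (T y).1

/-- Standard Young tableaux of shape `s` with entries `1, …, g`. -/
abbrev StandardTableau {n : ℕ} (s : Finset (Fin n × ℤ)) (g : ℕ) : Type :=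
  {T : {b // b ∈ s} ≃ {k // k ∈ Finset.Icc 1 g} // IsStandardFilling T}

noncomputable instance StandardTableau.instFintype {n : ℕ} (s : Finset (Fin n × ℤ)) (g : ℕ) :
    Fintype (StandardTableau s g) :=
  Fintype.ofFinite _

/-- The distance of two boxes: horizontal plus vertical distance. -/
def boxDist {n : ℕ} (x y : Fin n × ℤ) : ℕ :=
  ((x.1 : ℤ) - (y.1 : ℤ)).natAbs + (x.2 - y.2).natAbs

/-- The two boxes lie in different rows, in different columns, and at distance `a`. -/
def Exchangeable {n : ℕ} (a : ℕ) (x y : Fin n × ℤ) : Prop :=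
  x.1 ≠ y.1 ∧ x.2 ≠ y.2 ∧ boxDist x y = a

theorem Exchangeable.swap {n a : ℕ} {x y : Fin n × ℤ} (h : Exchangeable a x y) :
    Exchangeable a y x := by
  obtain ⟨h1, h2, h3⟩ := h
  refine ⟨h1.symm, h2.symm, ?_⟩
  unfold boxDist at *
  omega

/-- The entry `t`, for `1 ≤ t ≤ g`. -/
def entry {g : ℕ} (t : ℕ) (h1 : 1 ≤ t) (h2 : t ≤ g) : {k // k ∈ Finset.Icc 1 g} :=
  ⟨t, Finset.mem_Icc.2 ⟨h1, h2⟩⟩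

/-- The filling in which the entries `t` and `t+1` of `T` are exchanged. -/
def exchange {n g : ℕ} {s : Finset (Fin n × ℤ)} (t : ℕ) (h1 : 1 ≤ t) (h2 : t < g)
    (T : {b // b ∈ s} ≃ {k // k ∈ Finset.Icc 1 g}) :
    {b // b ∈ s} ≃ {k // k ∈ Finset.Icc 1 g} :=
  T.trans (Equiv.swap (entry t h1 h2.le) (entry (t + 1) (by omega) h2))

/-- In the filling `T`, the boxes that contain `t` and `t+1` are in different rows and columns and
at distance `a`. -/
def CanExchange {n g : ℕ} {s : Finset (Fin n × ℤ)} (t a : ℕ) (h1 : 1 ≤ t) (h2 : t < g)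
    (T : {b // b ∈ s} ≃ {k // k ∈ Finset.Icc 1 g}) : Prop :=
  Exchangeable a (T.symm (entry t h1 h2.le)).1 (T.symm (entry (t + 1) (by omega) h2)).1

theorem isStandardFilling_exchange {n g : ℕ} {s : Finset (Fin n × ℤ)} {t a : ℕ} {h1 : 1 ≤ t}
    {h2 : t < g} {T : {b // b ∈ s} ≃ {k // k ∈ Finset.Icc 1 g}} (hT : IsStandardFilling T)
    (h : CanExchange t a h1 h2 T) : IsStandardFilling (exchange t h1 h2 T) := by
  intro x y hxy
  have hlt := hT x y hxy
  have hne : ¬ ((T x).1 = t ∧ (T y).1 = t + 1) := by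
    rintro ⟨ex, ey⟩
    have ex' : T.symm (entry t h1 h2.le) = x := by
      rw [Equiv.symm_apply_eq]; exact Subtype.ext ex.symm
    have ey' : T.symm (entry (t + 1) (by omega) h2) = y := by
      rw [Equiv.symm_apply_eq]; exact Subtype.ext ey.symm
    unfold CanExchange at h
    rw [ex', ey'] at h
    rcases hxy with hr | hc
    · exact h.1 hr.1
    · exact h.2.1 hc.1
  simp only [exchange, Equiv.trans_apply, Equiv.swap_apply_def, entry, Subtype.ext_iff]
  split_ifs <;> simp_all <;> omega

theorem canExchange_exchange {n g : ℕ} {s : Finset (Fin n × ℤ)} {t a : ℕ} {h1 : 1 ≤ t}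
    {h2 : t < g} {T : {b // b ∈ s} ≃ {k // k ∈ Finset.Icc 1 g}}
    (h : CanExchange t a h1 h2 T) : CanExchange t a h1 h2 (exchange t h1 h2 T) := by
  unfold CanExchange exchange at *
  simpa using h.swap

theorem exchange_exchange {n g : ℕ} {s : Finset (Fin n × ℤ)} {t : ℕ} {h1 : 1 ≤ t}
    {h2 : t < g} (T : {b // b ∈ s} ≃ {k // k ∈ Finset.Icc 1 g}) :
    exchange t h1 h2 (exchange t h1 h2 T) = T := by
  ext x
  simp [exchange]

open Classical in
/-- The map `π_{t,a}` on standard tableaux: it exchanges `t` with `t+1` in every tableau in which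
they are in different rows and columns and at distance `a`, and fixes every other tableau. -/
noncomputable def piMap {n g : ℕ} (s : Finset (Fin n × ℤ)) (t a : ℕ) (h1 : 1 ≤ t) (h2 : t < g)
    (T : StandardTableau s g) : StandardTableau s g :=
  if h : CanExchange t a h1 h2 T.1 then
    ⟨exchange t h1 h2 T.1, isStandardFilling_exchange T.2 h⟩
  else T

theorem piMap_involutive {n g : ℕ} (s : Finset (Fin n × ℤ)) (t a : ℕ) (h1 : 1 ≤ t) (h2 : t < g) :
    Function.Involutive (piMap s t a h1 h2) := by
  intro T
  by_cases h : CanExchange t a h1 h2 T.1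
  · have h' := canExchange_exchange h
    simp [piMap, h, h', exchange_exchange]
  · simp [piMap, h]

/-- `π_{t,a}` as a permutation of the set of standard tableaux. -/
noncomputable def piPerm {n g : ℕ} (s : Finset (Fin n × ℤ)) (t a : ℕ) (h1 : 1 ≤ t) (h2 : t < g) :
    Equiv.Perm (StandardTableau s g) :=
  (piMap_involutive s t a h1 h2).toPerm

/-- The EH group: the permutation group on the standard Young tableaux of `σ(g,r,d,α,β)` generated
by the `π_{t,a}` with `1 ≤ t < g` and `a > 0`. -/
noncomputable def EHGroup (g r d : ℕ) (α β : Fin (r + 1) → ℕ) :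
    Subgroup (Equiv.Perm (StandardTableau (skewShape g r d α β) g)) :=
  Subgroup.closure
    {p | ∃ (t a : ℕ) (h1 : 1 ≤ t) (h2 : t < g), 0 < a ∧ p = piPerm (skewShape g r d α β) t a h1 h2}

/-- The four numerical conditions on the ramification sequences. A strict inequality
`x < min_j y_j` over a finite index set is written `∀ j, x < y_j`. -/
structure RamificationConditions (g r d : ℕ) (α β : Fin (r + 1) → ℕ) : Prop where
  cond1 : ∀ (j : ℕ) (hj : j < r),
    max ((α 0 : ℤ) - α (Fin.last r)) 1
      < (α ⟨r - j - 1, by omega⟩ : ℤ) + β ⟨j, by omega⟩ + ((g : ℤ) - d)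
  cond2 : ∑ i, ((α i : ℤ) - α (Fin.last r))
      < (α (Fin.last r) : ℤ) + ((g : ℤ) - d + r) + β (Fin.last r)
  cond3 : ∀ (i : ℕ) (hi : i < r), ∀ (j : ℕ) (hj : j < r), i ≤ j →
    (α ⟨r - i, by omega⟩ : ℤ) + β ⟨i, by omega⟩ - 1
      < (α ⟨r - j - 1, by omega⟩ : ℤ) + β ⟨j, by omega⟩
  cond4 : ∀ (i : ℕ) (h0 : 0 < i) (hi : i < r),
    α ⟨r - i, by omega⟩ + β ⟨i, by omega⟩ = α ⟨r - 1, by omega⟩ + β ⟨1, by omega⟩ ∧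
    α ⟨r - 1, by omega⟩ + β ⟨1, by omega⟩ ≥ α (Fin.last r) + β 0

/-! Encode a tableau as the word of the contents (column minus row) of the boxes of 1, …, g. If t
and t+1 lie in different rows and columns, their boxes are incomparable and their distance is the
difference of their contents. So for a ≥ 2 the permutation π_{t,a} exchanges two adjacent letters in
exactly the words where they differ by a. The tableaux on a fixed lower set of boxes form one
commutation class of words (`Valid.comm`, `Valid.ext`).

It suffices to produce all three-cycles. The lower set grows box by box. At each stage the group
induced on prefixes of length k, by elements that leave the later letters alone (`prefixGroup`), is
shown to contain all three-cycles of the class. The difficulty is that an element lifted from length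
k to k+1 acts in the same way in front of every possible next letter, not only in front of the
content c of the new box. `separate` repairs this: if some removable letter e has a distance from c
that no other possible next letter shares, then commutators with the exchange at that distance
isolate c. Afterwards `expand` passes from the words that end in c to all words of the larger class,
by gluing sets that overlap. The separating letter is the content of the bottom left box F = (r, lft
r), the smallest of all contents; in row r the next box is unique and nothing needs separating.

The induction starts with row 0 and column lft r, whose words are shuffles of an increasing and a
decreasing word. The exchange at the largest possible distance affects only these shuffles, so the
symmetric group on positions acts on them and fixes all other words (`shuffleHom_mem`). With k
column letters this is only the action on k-subsets. For k ≥ 2 the first box of row 1 is added: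
exchanging F with its content c moves away exactly the subsets that contain one given position.
Commutators turn this into permutations controlled by that position, and iterated commutators into
permutations that act only on the subsets containing a given (k-1)-set, which are genuine
three-cycles (`SubsetControl.altOn`). For k = 1 the action is the natural one and `separate` applies
directly. -/

namespace EHMonodromy

open Equiv

/-! ### Three-cycles and the gluing of sets on which all of them are available -/

section ThreeCycles

variable {Ω : Type*} {Y Z : Set Ω}

/-- `Y` has at least three points. -/
def HasThree (Y : Set Ω) : Prop := ∃ a ∈ Y, ∃ b ∈ Y, ∃ c ∈ Y, a ≠ b ∧ b ≠ c ∧ a ≠ c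

theorem HasThree.mono (h : HasThree Y) (hZ : Y ⊆ Z) : HasThree Z := by
  obtain ⟨a, ha, b, hb, c, hc, hh⟩ := h
  exact ⟨a, hZ ha, b, hZ hb, c, hZ hc, hh⟩

theorem HasThree.image (h : HasThree Y) (f : Perm Ω) : HasThree (f '' Y) := by
  obtain ⟨a, ha, b, hb, c, hc, h1, h2, h3⟩ := h
  exact ⟨f a, ⟨a, ha, rfl⟩, f b, ⟨b, hb, rfl⟩, f c, ⟨c, hc, rfl⟩, f.injective.ne h1,
    f.injective.ne h2, f.injective.ne h3⟩

theorem HasThree.exists_two_ne (h : HasThree Y) (z : Ω) :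
    ∃ a ∈ Y, ∃ b ∈ Y, a ≠ b ∧ a ≠ z ∧ b ≠ z := by
  obtain ⟨a, ha, b, hb, c, hc, h1, h2, h3⟩ := h
  by_cases haz : a = z
  · subst haz; exact ⟨b, hb, c, hc, h2, h1.symm, h3.symm⟩
  by_cases hbz : b = z
  · subst hbz; exact ⟨a, ha, c, hc, h3, h1, h2.symm⟩
  exact ⟨a, ha, b, hb, h1, haz, hbz⟩

variable [DecidableEq Ω]

/-- The permutation `a ↦ b ↦ c ↦ a`, a three-cycle when `a`, `b`, `c` are distinct. -/
def cyc (a b c : Ω) : Perm Ω := swap a b * swap b c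

theorem cyc_apply_fst {a b c : Ω} (hab : a ≠ b) (hac : a ≠ c) : cyc a b c a = b := by
  simp [cyc, swap_apply_of_ne_of_ne hab hac]

theorem cyc_apply_snd {a b c : Ω} (hac : a ≠ c) (hbc : b ≠ c) : cyc a b c b = c := by
  simp [cyc, swap_apply_of_ne_of_ne hac.symm hbc.symm]

theorem cyc_apply_thd {a b c : Ω} : cyc a b c c = a := by
  simp [cyc]

theorem cyc_apply_of_ne {a b c x : Ω} (ha : x ≠ a) (hb : x ≠ b) (hc : x ≠ c) :
    cyc a b c x = x := by
  simp [cyc, swap_apply_of_ne_of_ne hb hc, swap_apply_of_ne_of_ne ha hb]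

theorem cyc_conj (f : Perm Ω) (a b c : Ω) : f * cyc a b c * f⁻¹ = cyc (f a) (f b) (f c) := by
  simp [cyc, swap_apply_apply, mul_assoc]

theorem cyc_inv (a b c : Ω) : (cyc a b c)⁻¹ = cyc c b a := by
  simp [cyc, swap_comm]

theorem cyc_rotate {a b c : Ω} (hab : a ≠ b) (hac : a ≠ c) : cyc a b c = cyc b c a := by
  have h := swap_apply_apply (swap b c) a b
  rw [swap_apply_of_ne_of_ne hab hac, swap_apply_left, swap_inv] at h
  rw [cyc, cyc, swap_comm c a, h]
  simp [mul_assoc]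

/-- All three-cycles on points of `Y` belong to `K`. -/
def AltOn (K : Subgroup (Perm Ω)) (Y : Set Ω) : Prop :=
  ∀ a ∈ Y, ∀ b ∈ Y, ∀ c ∈ Y, a ≠ b → b ≠ c → a ≠ c → cyc a b c ∈ K

variable {K : Subgroup (Perm Ω)}

theorem AltOn.mono (h : AltOn K Y) (hZ : Z ⊆ Y) : AltOn K Z :=
  fun a ha b hb c hc => h a (hZ ha) b (hZ hb) c (hZ hc)

theorem cyc_conj_mem {f : Perm Ω} (hf : f ∈ K) {a b c : Ω} (h : cyc a b c ∈ K) :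
    cyc (f a) (f b) (f c) ∈ K := by
  rw [← cyc_conj]
  exact K.mul_mem (K.mul_mem hf h) (K.inv_mem hf)

theorem AltOn.image (h : AltOn K Y) {f : Perm Ω} (hf : f ∈ K) : AltOn K (f '' Y) := by
  rintro _ ⟨a, ha, rfl⟩ _ ⟨b, hb, rfl⟩ _ ⟨c, hc, rfl⟩ hab hbc hac
  exact cyc_conj_mem hf (h a ha b hb c hc (fun e => hab (e ▸ rfl)) (fun e => hbc (e ▸ rfl))
    (fun e => hac (e ▸ rfl)))

theorem cyc_mem_rotate {a b c : Ω} (hab : a ≠ b) (hac : a ≠ c) (h : cyc a b c ∈ K) :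
    cyc b c a ∈ K := cyc_rotate hab hac ▸ h

theorem cyc_mem_reverse {a b c : Ω} (h : cyc a b c ∈ K) : cyc c b a ∈ K := by
  rw [← cyc_inv]; exact K.inv_mem h

/-- The three-cycles through two fixed points `p`, `q` generate all three-cycles. -/
theorem altOn_of_pair {p q : Ω} (hpq : p ≠ q)
    (h : ∀ x ∈ Y, x ≠ p → x ≠ q → cyc p q x ∈ K) : AltOn K Y := by
  have h1 : ∀ a ∈ Y, ∀ b ∈ Y, a ≠ p → a ≠ q → b ≠ p → b ≠ q → a ≠ b → cyc q a b ∈ K := by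
    intro a ha b hb hap haq hbp hbq hab
    have := cyc_conj_mem (h a ha hap haq) (h b hb hbp hbq)
    rwa [cyc_apply_fst hpq hap.symm, cyc_apply_snd hap.symm haq.symm,
      cyc_apply_of_ne hbp hbq hab.symm] at this
  have h2 : ∀ a ∈ Y, ∀ b ∈ Y, a ≠ p → a ≠ q → b ≠ p → b ≠ q → a ≠ b → cyc a p b ∈ K := by
    intro a ha b hb hap haq hbp hbq hab
    have := cyc_conj_mem (cyc_mem_reverse (h a ha hap haq)) (h b hb hbp hbq)
    rwa [cyc_apply_thd, cyc_apply_snd hap hpq.symm,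
      cyc_apply_of_ne hab.symm hbq hbp] at this
  have h3 : ∀ a ∈ Y, ∀ b ∈ Y, ∀ c ∈ Y, a ≠ p → a ≠ q → b ≠ p → b ≠ q → c ≠ p → c ≠ q →
      a ≠ b → b ≠ c → a ≠ c → cyc c a b ∈ K := by
    intro a ha b hb c hc hap haq hbp hbq hcp hcq hab hbc hac
    have := cyc_conj_mem (h c hc hcp hcq) (h1 a ha b hb hap haq hbp hbq hab)
    rwa [cyc_apply_snd hcp.symm hcq.symm, cyc_apply_of_ne hap haq hac,
      cyc_apply_of_ne hbp hbq hbc] at this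
  intro a ha b hb c hc hab hbc hac
  by_cases hap : a = p
  · subst hap
    by_cases hbq : b = q
    · subst hbq
      exact h c hc hac.symm hbc.symm
    by_cases hcq : c = q
    · subst hcq
      exact cyc_mem_rotate hac.symm hbc.symm (cyc_mem_rotate hbc hab.symm
        (cyc_mem_reverse (h b hb hab.symm hbq)))
    exact cyc_mem_rotate hac.symm hbc.symm
      (h2 c hc b hb hac.symm hcq hab.symm hbq hbc.symm)
  by_cases haq : a = q
  · subst haq
    by_cases hbp : b = p
    · subst hbp
      exact cyc_mem_rotate hac.symm hbc.symm (cyc_mem_reverse (h c hc hbc.symm hac.symm))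
    by_cases hcp : c = p
    · subst hcp
      exact cyc_mem_rotate hac.symm hbc.symm (h b hb hbc hab.symm)
    exact h1 b hb c hc hbp hab.symm hcp hac.symm hbc
  by_cases hbp : b = p
  · subst hbp
    by_cases hcq : c = q
    · subst hcq
      exact cyc_mem_rotate hac.symm hbc.symm (cyc_mem_rotate hbc hab.symm (h a ha hap hac))
    exact h2 a ha c hc hap haq hbc.symm hcq hac
  by_cases hbq : b = q
  · subst hbq
    by_cases hcp : c = p
    · subst hcp
      exact cyc_mem_reverse (h a ha hap haq)
    exact cyc_mem_rotate hac.symm hbc.symm (cyc_mem_rotate hbc hab.symm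
      (h1 c hc a ha hcp hbc.symm hap haq hac.symm))
  by_cases hcp : c = p
  · subst hcp
    exact cyc_mem_rotate hac.symm hbc.symm (cyc_mem_rotate hbc hab.symm
      (cyc_mem_rotate hab hac (cyc_mem_rotate hac.symm hbc.symm
        (cyc_mem_rotate hbc hab.symm (h2 b hb a ha hbp hbq hap haq hab.symm)))))
  by_cases hcq : c = q
  · subst hcq
    exact cyc_mem_rotate hac.symm hbc.symm (h1 a ha b hb hap haq hbp hbq hab)
  exact h3 b hb c hc a ha hbp hbq hcp hcq hap haq hbc hac.symm hab.symm

theorem AltOn.union_of_two (hY : AltOn K Y) (hZ : AltOn K Z) {p q : Ω} (hpq : p ≠ q)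
    (hpY : p ∈ Y) (hqY : q ∈ Y) (hpZ : p ∈ Z) (hqZ : q ∈ Z) : AltOn K (Y ∪ Z) :=
  altOn_of_pair hpq fun x hx hxp hxq => hx.elim
    (fun hx => hY p hpY q hqY x hx hpq hxq.symm hxp.symm)
    (fun hx => hZ p hpZ q hqZ x hx hpq hxq.symm hxp.symm)

/-- Two sets that share a point can be glued. -/
theorem AltOn.union (hY : AltOn K Y) (hZ : AltOn K Z) (hY3 : HasThree Y) (hZ3 : HasThree Z)
    {z : Ω} (hzY : z ∈ Y) (hzZ : z ∈ Z) : AltOn K (Y ∪ Z) := by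
  by_cases h : ∃ p ∈ Y, p ∈ Z ∧ p ≠ z
  · obtain ⟨p, hpY, hpZ, hpz⟩ := h
    exact hY.union_of_two hZ hpz hpY hzY hpZ hzZ
  push Not at h
  obtain ⟨a, ha, a', ha', haa', haz, ha'z⟩ := hY3.exists_two_ne z
  obtain ⟨c, hc, d, hd, hcd, hcz, hdz⟩ := hZ3.exists_two_ne z
  have hne : ∀ x ∈ Y, x ≠ z → ∀ y ∈ Z, x ≠ y := by
    rintro x hx hxz _ hy rfl
    exact hxz (h x hx hy)
  -- Here `z` is the only common point. Conjugating the cycle (z c d) of `Z` by (z a a') of `Y`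
  -- replaces z by a, so a can be added to `Z`; then the two sets share a and z.
  have key : cyc a c d ∈ K := by
    have := cyc_conj_mem (hY z hzY a ha a' ha' haz.symm haa' ha'z.symm)
      (hZ z hzZ c hc d hd hcz.symm hcd hdz.symm)
    rwa [cyc_apply_fst haz.symm ha'z.symm,
      cyc_apply_of_ne hcz (hne a ha haz c hc).symm (hne a' ha' ha'z c hc).symm,
      cyc_apply_of_ne hdz (hne a ha haz d hd).symm (hne a' ha' ha'z d hd).symm] at this
  have hZ' : AltOn K (insert a Z) := altOn_of_pair hcd fun x hx hxc hxd => by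
    rcases hx with rfl | hx
    · exact cyc_mem_rotate (hne x ha haz c hc) (hne x ha haz d hd) key
    · exact hZ c hc d hd x hx hcd hxd.symm hxc.symm
  refine (hY.union_of_two hZ' haz ha hzY (Set.mem_insert _ _) (Set.mem_insert_of_mem _ hzZ)).mono ?_
  exact Set.union_subset_union_right _ (Set.subset_insert _ _)

/-- The points that can be added to `Y`. -/
def absorbed (K : Subgroup (Perm Ω)) (Y : Set Ω) : Set Ω := {y | AltOn K (insert y Y)}

theorem AltOn.subset_absorbed (h : AltOn K Y) : Y ⊆ absorbed K Y := fun y hy => by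
  rw [absorbed, Set.mem_ofPred_eq, Set.insert_eq_of_mem hy]; exact h

/-- Any three one-point extensions of `Y` overlap in `Y`, so they can be glued; hence points may be
absorbed independently of one another. -/
theorem altOn_absorbed (h3 : HasThree Y) : AltOn K (absorbed K Y) := by
  intro a ha b hb c hc
  obtain ⟨p, hp, -⟩ := id h3
  have h1 := AltOn.union (K := K) ha hb (h3.mono (Set.subset_insert _ _))
    (h3.mono (Set.subset_insert _ _)) (Set.mem_insert_of_mem _ hp) (Set.mem_insert_of_mem _ hp)
  have h2 := h1.union hc (h3.mono ((Set.subset_insert _ _).trans Set.subset_union_left))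
    (h3.mono (Set.subset_insert _ _)) (Or.inl (Set.mem_insert_of_mem _ hp))
    (Set.mem_insert_of_mem _ hp)
  exact h2 a (by simp) b (by simp) c (by simp)

/-- The image of `Y ∪ {y}` under `f` meets `Y` in `f z`, so it can be glued to `Y`. Thus a group
element preserves the absorbed set as soon as it keeps one point of `Y` in `Y`. -/
theorem AltOn.apply_mem_absorbed (h : AltOn K Y) (h3 : HasThree Y) {f : Perm Ω} (hf : f ∈ K)
    {z : Ω} (hz : z ∈ Y) (hfz : f z ∈ Y) {y : Ω} (hy : y ∈ absorbed K Y) :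
    f y ∈ absorbed K Y := by
  have h1 := AltOn.image (K := K) hy hf
  refine (h1.union h ((h3.mono (Set.subset_insert _ _)).image f) h3
    ⟨z, Set.mem_insert_of_mem _ hz, rfl⟩ hfz).mono ?_
  exact Set.insert_subset (Or.inl ⟨y, Set.mem_insert _ _, rfl⟩) Set.subset_union_right

end ThreeCycles

theorem eq_alternatingGroup_or_eq_top {Ω : Type*} [Fintype Ω] [DecidableEq Ω]
    {K : Subgroup (Perm Ω)} (h : AltOn K Set.univ) : K = alternatingGroup Ω ∨ K = ⊤ := by
  have hle : alternatingGroup Ω ≤ K := by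
    rw [← Equiv.Perm.closure_three_cycles_eq_alternating, Subgroup.closure_le]
    intro σ hσ
    obtain ⟨a, ha⟩ : ∃ a, σ a ≠ a := by
      by_contra! hcon
      have : σ = 1 := Equiv.ext hcon
      subst this
      simp [Perm.IsThreeCycle] at hσ
    have hs : Perm.IsThreeCycle σ := hσ
    have ha' : a ∈ σ.support := Perm.mem_support.2 ha
    have hn := hs.nodup_iff_mem_support.2 ha'
    rw [SetLike.mem_coe, hs.eq_swap_mul_swap_iff_mem_support.2 ha']
    exact h _ trivial _ trivial _ trivial (by grind) (by grind) (by grind)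
  by_cases hK : K ≤ alternatingGroup Ω
  · exact Or.inl (le_antisymm hK hle)
  right
  obtain ⟨f, hf, hfA⟩ := SetLike.not_le_iff_exists.1 hK
  rw [Perm.mem_alternatingGroup] at hfA
  have hf1 : Perm.sign f = -1 := (Int.units_eq_one_or _).resolve_left hfA
  refine eq_top_iff.2 fun x _ => ?_
  rcases Int.units_eq_one_or (Perm.sign x) with hx | hx
  · exact hle (Perm.mem_alternatingGroup.2 hx)
  · have : f * x ∈ K := hle (Perm.mem_alternatingGroup.2 (by simp [hx, hf1]))
    exact (Subgroup.mul_mem_cancel_left _ hf).1 this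

/-! ### Words, exchanges of letters and commutation classes -/

section Words

variable {α : Type*}

/-- The first `k` letters of a word, the last one of them first. -/
def prefixWord (f : ℕ → α) : ℕ → List α
  | 0 => []
  | k + 1 => f k :: prefixWord f k

@[simp] theorem length_prefixWord (f : ℕ → α) (k : ℕ) : (prefixWord f k).length = k := by
  induction k with
  | zero => rfl
  | succ k ih => simp [prefixWord, ih]

theorem prefixWord_congr {f f' : ℕ → α} {k : ℕ} (h : ∀ i < k, f i = f' i) :
    prefixWord f k = prefixWord f' k := by
  induction k with
  | zero => rfl
  | succ k ih =>
    rw [prefixWord, prefixWord, h k (by omega), ih fun i hi => h i (by omega)]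

/-- The permutation of words that keeps the last letter and acts by `φ` on the earlier ones. -/
def consPerm (φ : Perm (List ℤ)) : Perm (List ℤ) where
  toFun
    | [] => []
    | d :: m => d :: φ m
  invFun
    | [] => []
    | d :: m => d :: φ⁻¹ m
  left_inv := by rintro (_ | ⟨d, m⟩) <;> simp
  right_inv := by rintro (_ | ⟨d, m⟩) <;> simp

@[simp] theorem consPerm_cons (φ : Perm (List ℤ)) (d : ℤ) (m : List ℤ) :
    consPerm φ (d :: m) = d :: φ m := rfl

/-- Exchange the last two letters if their distance is `a`. -/
def topSwapFun (a : ℕ) : List ℤ → List ℤ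
  | y :: x :: v => if (x - y).natAbs = a then x :: y :: v else y :: x :: v
  | l => l

theorem topSwapFun_involutive (a : ℕ) : Function.Involutive (topSwapFun a) := by
  rintro (_ | ⟨y, _ | ⟨x, v⟩⟩)
  · rfl
  · rfl
  · by_cases h : (x - y).natAbs = a
    · have h' : (y - x).natAbs = a := by omega
      simp [topSwapFun, h, h']
    · simp [topSwapFun, h]

def topSwap (a : ℕ) : Perm (List ℤ) := (topSwapFun_involutive a).toPerm

theorem topSwap_apply (a : ℕ) (l : List ℤ) : topSwap a l = topSwapFun a l := by
  rw [topSwap, Function.Involutive.coe_toPerm]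

theorem topSwap_of_eq {a : ℕ} {x y : ℤ} (v : List ℤ) (h : (x - y).natAbs = a) :
    topSwap a (y :: x :: v) = x :: y :: v := by
  simp [topSwap_apply, topSwapFun, h]

theorem topSwap_of_ne {a : ℕ} {x y : ℤ} (v : List ℤ) (h : (x - y).natAbs ≠ a) :
    topSwap a (y :: x :: v) = y :: x :: v := by
  simp [topSwap_apply, topSwapFun, h]

@[simp] theorem topSwap_topSwap (a : ℕ) (l : List ℤ) : topSwap a (topSwap a l) = l := by
  rw [topSwap_apply, topSwap_apply, topSwapFun_involutive a l]

/-- Two adjacent letters at distance at least two are exchanged. -/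
inductive Step : List ℤ → List ℤ → Prop
  | swap (x y : ℤ) (v : List ℤ) (h : 2 ≤ (x - y).natAbs) : Step (y :: x :: v) (x :: y :: v)
  | cons (x : ℤ) {m m' : List ℤ} (h : Step m m') : Step (x :: m) (x :: m')

/-- Two words differ by exchanges of adjacent letters at distance at least two. -/
def Comm : List ℤ → List ℤ → Prop := Relation.ReflTransGen Step

theorem Step.symm {l l' : List ℤ} (h : Step l l') : Step l' l := by
  induction h with
  | swap x y v h => exact .swap y x v (by omega)
  | cons x _ ih => exact .cons x ih

theorem Step.perm {l l' : List ℤ} (h : Step l l') : l.Perm l' := by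
  induction h with
  | swap x y v h => exact List.Perm.swap x y v
  | cons x _ ih => exact ih.cons x

theorem Comm.refl (l : List ℤ) : Comm l l := Relation.ReflTransGen.refl

theorem Step.comm {l l' : List ℤ} (h : Step l l') : Comm l l' := Relation.ReflTransGen.single h

theorem Comm.trans {l l' l'' : List ℤ} (h : Comm l l') (h' : Comm l' l'') : Comm l l'' :=
  Relation.ReflTransGen.trans h h'

theorem Comm.symm {l l' : List ℤ} (h : Comm l l') : Comm l' l := by
  induction h with
  | refl => exact .refl _
  | tail _ hs ih => exact hs.symm.comm.trans ih

theorem Comm.perm {l l' : List ℤ} (h : Comm l l') : l.Perm l' := by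
  induction h with
  | refl => exact .refl _
  | tail _ hs ih => exact ih.trans hs.perm

theorem Comm.cons {l l' : List ℤ} (x : ℤ) (h : Comm l l') : Comm (x :: l) (x :: l') := by
  induction h with
  | refl => exact .refl _
  | tail _ hs ih => exact ih.trans (Step.cons x hs).comm

theorem Comm.append_left {l l' : List ℤ} (m : List ℤ) (h : Comm l l') :
    Comm (m ++ l) (m ++ l') := by
  induction m with
  | nil => exact h
  | cons x m ih => exact ih.cons x

/-- A letter that commutes with all later ones can be moved to the end. -/
theorem comm_moveTop (x : ℤ) (A B : List ℤ) (h : ∀ y ∈ A, 2 ≤ (x - y).natAbs) :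
    Comm (A ++ x :: B) (x :: (A ++ B)) := by
  induction A with
  | nil => exact .refl _
  | cons y A ih =>
    refine (Comm.cons y (ih fun z hz => h z (List.mem_cons_of_mem _ hz))).trans ?_
    exact (Step.swap x y _ (h y List.mem_cons_self)).comm

end Words

/-! ### The groups induced on prefixes, and growth from words with a fixed last letter to a whole
class -/

section PrefixGroup

variable {X : Type*} (G : Subgroup (Perm X)) (L : X → ℕ → ℤ)

/-- The permutations of words that are induced, on prefixes of length `k`, by elements of `G` that
do not change the remaining letters. -/
def prefixGroup (k : ℕ) : Subgroup (Perm (List ℤ)) where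
  carrier := {φ | ∃ γ ∈ G, ∀ x, prefixWord (L (γ x)) k = φ (prefixWord (L x) k) ∧
    ∀ i ≥ k, L (γ x) i = L x i}
  one_mem' := ⟨1, G.one_mem, fun x => ⟨rfl, fun _ _ => rfl⟩⟩
  mul_mem' := by
    rintro φ ψ ⟨γ, hγ, h⟩ ⟨δ, hδ, h'⟩
    refine ⟨γ * δ, G.mul_mem hγ hδ, fun x => ⟨?_, fun i hi => ?_⟩⟩
    · rw [Perm.mul_apply, (h (δ x)).1, (h' x).1, Perm.mul_apply]
    · rw [Perm.mul_apply, (h (δ x)).2 i hi, (h' x).2 i hi]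
  inv_mem' := by
    rintro φ ⟨γ, hγ, h⟩
    refine ⟨γ⁻¹, G.inv_mem hγ, fun x => ?_⟩
    have e : γ (γ⁻¹ x) = x := γ.apply_symm_apply x
    refine ⟨?_, fun i hi => ?_⟩
    · have := (h (γ⁻¹ x)).1
      rw [e] at this
      rw [this]
      exact (φ.symm_apply_apply _).symm
    · have := (h (γ⁻¹ x)).2 i hi
      rw [e] at this
      exact this.symm

/-- `l` is the prefix of length `k` of some word. -/
def IsPrefix (k : ℕ) (l : List ℤ) : Prop := ∃ x, prefixWord (L x) k = l

variable {G L} {k : ℕ}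

theorem IsPrefix.length {l : List ℤ} (h : IsPrefix L k l) : l.length = k := by
  obtain ⟨x, rfl⟩ := h
  simp

theorem IsPrefix.tail {d : ℤ} {l : List ℤ} (h : IsPrefix L (k + 1) (d :: l)) : IsPrefix L k l := by
  obtain ⟨x, hx⟩ := h
  exact ⟨x, (List.cons.inj hx).2⟩

theorem IsPrefix.map {φ : Perm (List ℤ)} (hφ : φ ∈ prefixGroup G L k) {l : List ℤ}
    (h : IsPrefix L k l) : IsPrefix L k (φ l) := by
  obtain ⟨γ, -, hγ⟩ := hφ
  obtain ⟨x, rfl⟩ := h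
  exact ⟨γ x, (hγ x).1⟩

/-- Values on lists that are not prefixes carry no information, so they may be altered freely. -/
theorem mem_prefixGroup_of_eqOn {φ ψ : Perm (List ℤ)} (hφ : φ ∈ prefixGroup G L k)
    (h : ∀ l, IsPrefix L k l → ψ l = φ l) : ψ ∈ prefixGroup G L k := by
  obtain ⟨γ, hγ, hh⟩ := hφ
  exact ⟨γ, hγ, fun x => ⟨by rw [h _ ⟨x, rfl⟩, (hh x).1], (hh x).2⟩⟩

theorem consPerm_mem {φ : Perm (List ℤ)} (hφ : φ ∈ prefixGroup G L k) :
    consPerm φ ∈ prefixGroup G L (k + 1) := by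
  obtain ⟨γ, hγ, h⟩ := hφ
  refine ⟨γ, hγ, fun x => ⟨?_, fun i hi => (h x).2 i (by omega)⟩⟩
  rw [prefixWord, prefixWord, consPerm_cons, (h x).1, (h x).2 k le_rfl]

/-- `G` contains the exchanges of adjacent letters at a given distance at least two. -/
def HasExchanges (G : Subgroup (Perm X)) (L : X → ℕ → ℤ) (g : ℕ) : Prop :=
  ∀ k, k + 2 ≤ g → ∀ a, 2 ≤ a → ∃ γ ∈ G, ∀ x, L (γ x) =
    if (L x k - L x (k + 1)).natAbs = a then L x ∘ swap k (k + 1) else L x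

variable {g : ℕ}

theorem topSwap_mem (hG : HasExchanges G L g) {a : ℕ} (hk : k + 2 ≤ g) (ha : 2 ≤ a) :
    topSwap a ∈ prefixGroup G L (k + 2) := by
  obtain ⟨γ, hγ, h⟩ := hG k hk a ha
  refine ⟨γ, hγ, fun x => ?_⟩
  rw [h x]
  split_ifs with hx
  · refine ⟨?_, fun i hi => ?_⟩
    · simp only [prefixWord]
      rw [topSwap_of_eq _ hx]
      simp only [Function.comp, swap_apply_left, swap_apply_right]
      congr 2
      refine prefixWord_congr fun i hi => ?_
      rw [Function.comp, swap_apply_of_ne_of_ne (by omega) (by omega)]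
    · rw [Function.comp, swap_apply_of_ne_of_ne (by omega) (by omega)]
  · refine ⟨?_, fun i hi => rfl⟩
    simp only [prefixWord]
    rw [topSwap_of_ne _ hx]

/-- The exchange of two letters is an induced permutation that moves every word within its own
commutation class. The last clause is what lets it preserve a whole class in `expand`. -/
theorem Step.exists_perm (hG : HasExchanges G L g) {l l' : List ℤ} (h : Step l l')
    (hl : l.length ≤ g) :
    ∃ φ ∈ prefixGroup G L l.length, φ l = l' ∧ ∀ m, Comm (φ m) m := by
  induction h with
  | swap x y v h =>
    refine ⟨topSwap (x - y).natAbs, topSwap_mem hG hl h, topSwap_of_eq _ rfl, ?_⟩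
    rintro (_ | ⟨z, _ | ⟨w, m⟩⟩)
    · exact .refl _
    · exact .refl _
    · by_cases hwz : (w - z).natAbs = (x - y).natAbs
      · rw [topSwap_of_eq _ hwz]
        exact (Step.swap z w m (by omega)).comm
      · rw [topSwap_of_ne _ hwz]
        exact .refl _
  | cons x h ih =>
    obtain ⟨φ, hφ, h1, h2⟩ := ih (by simp at hl; omega)
    refine ⟨consPerm φ, consPerm_mem hφ, by rw [consPerm_cons, h1], ?_⟩
    rintro (_ | ⟨z, m⟩)
    · exact .refl _
    · exact (h2 m).cons z

theorem Comm.exists_perm (hG : HasExchanges G L g) {l l' : List ℤ} (h : Comm l l')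
    (hl : l.length ≤ g) :
    ∃ φ ∈ prefixGroup G L l.length, φ l = l' := by
  induction h with
  | refl => exact ⟨1, one_mem _, rfl⟩
  | @tail b c h hs ih =>
    obtain ⟨φ, hφ, h1⟩ := ih
    have hb : l.length = b.length := (Comm.perm h).length_eq
    obtain ⟨ψ, hψ, h2, -⟩ := hs.exists_perm hG (by omega)
    exact ⟨ψ * φ, mul_mem (hb ▸ hψ) hφ, by rw [Perm.mul_apply, h1, h2]⟩

/-- Which letters can come next depends only on the commutation class of the word before them. -/
theorem IsPrefix.comm_tail (hG : HasExchanges G L g) {d : ℤ} {l l' : List ℤ} (h : Comm l l')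
    (hk : k ≤ g) (hd : IsPrefix L (k + 1) (d :: l)) : IsPrefix L (k + 1) (d :: l') := by
  have hl : l.length = k := hd.tail.length
  obtain ⟨φ, hφ, h1⟩ := h.exists_perm hG (hl.trans_le hk)
  rw [hl] at hφ
  simpa [h1] using hd.map (consPerm_mem hφ)

/-- The words `u` followed by `c`, for `u` in the commutation class of `u₀`. -/
def snocClass (c : ℤ) (u : List ℤ) : Set (List ℤ) := {l | ∃ m, Comm u m ∧ l = c :: m}

/-- Starting from the words that end in `c`, each exchange leads from absorbed words to absorbed
words. An exchange below the last letter preserves the starting set. An exchange of the last two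
letters at distance `a` fixes a starting word whose penultimate letter is not at distance `a` from
`c`; `htop` provides one. -/
theorem expand (hG : HasExchanges G L g) {u : List ℤ} {c : ℤ} (hu : u.length + 1 ≤ g)
    (halt : AltOn (prefixGroup G L (u.length + 1)) (snocClass c u)) (h3 : HasThree (snocClass c u))
    (htop : ∀ a, 2 ≤ a → ∃ e v, Comm u (e :: v) ∧ (e - c).natAbs ≠ a) :
    AltOn (prefixGroup G L (u.length + 1)) {l | Comm (c :: u) l} := by
  refine (altOn_absorbed h3).mono fun l hl => ?_
  change Comm (c :: u) l at hl
  induction hl with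
  | refl => exact halt.subset_absorbed ⟨u, .refl u, rfl⟩
  | @tail b b' hb hs ih =>
    have hlen : b.length = u.length + 1 := by simpa using (Comm.perm hb).length_eq.symm
    cases hs with
    | swap x y v h =>
      have hm := topSwap_mem (a := (x - y).natAbs) (k := v.length) hG
        (by simp at hlen; omega) h
      have hv : v.length + 2 = u.length + 1 := by simpa using hlen
      rw [hv] at hm
      obtain ⟨e, w, he, hne⟩ := htop _ h
      have := halt.apply_mem_absorbed h3 hm (z := c :: e :: w) ⟨_, he, rfl⟩
        (by rw [topSwap_of_ne _ hne]; exact ⟨_, he, rfl⟩) ih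
      rwa [topSwap_of_eq _ rfl] at this
    | @cons x m m' h =>
      have hml : m.length = u.length := by simpa using hlen
      obtain ⟨φ, hφ, h1, h2⟩ := h.exists_perm hG (by omega)
      rw [hml] at hφ
      have := halt.apply_mem_absorbed h3 (consPerm_mem hφ) (z := c :: u) ⟨u, .refl u, rfl⟩
        ⟨φ u, (h2 u).symm, rfl⟩ ih
      rwa [consPerm_cons, h1] at this

end PrefixGroup

/-! ### Isolating one of the possible next letters -/

theorem cyc_inv_mul_cyc {Ω : Type*} [DecidableEq Ω] {a b c d : Ω} (hab : a ≠ b) (hac : a ≠ c)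
    (hbd : b ≠ d) (hcd : c ≠ d) : (cyc a b c)⁻¹ * cyc d b c = cyc a c d := by
  have h1 := swap_apply_apply (swap b c) a b
  have h2 := swap_apply_apply (swap b c) d b
  rw [swap_apply_of_ne_of_ne hab hac, swap_apply_left, swap_inv] at h1
  rw [swap_apply_of_ne_of_ne hbd.symm hcd.symm, swap_apply_left, swap_inv] at h2
  rw [cyc_inv, cyc, cyc, cyc, swap_comm c d, h1, h2, swap_comm c b, swap_comm b a]
  simp [mul_assoc]

section Separation

variable {X : Type*} {G : Subgroup (Perm X)} {L : X → ℕ → ℤ} {g k : ℕ}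

/-- A permutation is a commutator of two members if it is so on all prefixes. -/
theorem mem_prefixGroup_of_commutator {φ ψ q : Perm (List ℤ)} (hφ : φ ∈ prefixGroup G L k)
    (hψ : ψ ∈ prefixGroup G L k) (h : ∀ l, IsPrefix L k l → q (ψ (φ l)) = φ (ψ l)) :
    q ∈ prefixGroup G L k := by
  refine mem_prefixGroup_of_eqOn (φ := φ * ψ * φ⁻¹ * ψ⁻¹)
    (mul_mem (mul_mem (mul_mem hφ hψ) (inv_mem hφ)) (inv_mem hψ)) fun l hl => ?_
  have h' := h (φ⁻¹ (ψ⁻¹ l)) ((hl.map (inv_mem hψ)).map (inv_mem hφ))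
  have e1 : ∀ x, φ (φ⁻¹ x) = x := φ.apply_symm_apply
  have e2 : ∀ x, ψ (ψ⁻¹ x) = x := ψ.apply_symm_apply
  rw [e1, e2] at h'
  simpa using h'

/-- The product of two three-cycles that arises as the commutator of a three-cycle of words with
last letter `e` and the exchange of `e` with the next letter `c`. -/
theorem doubleCycle_mem (hG : HasExchanges G L g) {u : List ℤ} {c e : ℤ} (hu : u.length + 1 ≤ g)
    (halt : AltOn (prefixGroup G L u.length) {l | Comm u l}) {A B C : List ℤ}
    (hA : Comm u (e :: A)) (hB : Comm u (e :: B)) (hC : Comm u (e :: C))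
    (hAB : A ≠ B) (hBC : B ≠ C) (hAC : A ≠ C) (ha : 2 ≤ (e - c).natAbs)
    (hd : ∀ d m, Comm u m → IsPrefix L (u.length + 1) (d :: m) → d ≠ c →
      (e - d).natAbs ≠ (e - c).natAbs) :
    cyc (c :: e :: A) (c :: e :: B) (c :: e :: C) * cyc (e :: c :: A) (e :: c :: C) (e :: c :: B)
      ∈ prefixGroup G L (u.length + 1) := by
  have hce : e ≠ c := by rintro rfl; simp at ha
  set z := cyc (e :: A) (e :: B) (e :: C) with hz
  have hzm : z ∈ prefixGroup G L u.length := halt _ hA _ hB _ hC (by simpa) (by simpa) (by simpa)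
  have hlen : u.length = A.length + 1 := by simpa using hA.perm.length_eq
  set θ := topSwap (e - c).natAbs with hθ
  have hθm : θ ∈ prefixGroup G L (u.length + 1) := by
    rw [hlen]; exact topSwap_mem hG (by omega) ha
  have zA : z (e :: A) = e :: B := cyc_apply_fst (by simpa) (by simpa)
  have zB : z (e :: B) = e :: C := cyc_apply_snd (by simpa) (by simpa)
  have zC : z (e :: C) = e :: A := cyc_apply_thd
  have zne : ∀ m, m ≠ e :: A → m ≠ e :: B → m ≠ e :: C → z m = m :=
    fun m h1 h2 h3 => cyc_apply_of_ne h1 h2 h3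
  have θc : ∀ m, θ (c :: e :: m) = e :: c :: m := fun m => topSwap_of_eq m rfl
  have θe : ∀ m, θ (e :: c :: m) = c :: e :: m := fun m => topSwap_of_eq m (by omega)
  have θne : ∀ d m, Comm u (e :: m) → IsPrefix L (u.length + 1) (d :: e :: m) → d ≠ c →
      θ (d :: e :: m) = d :: e :: m :=
    fun d m h h1 h2 => topSwap_of_ne m (hd d _ h h1 h2)
  set q := cyc (c :: e :: A) (c :: e :: B) (c :: e :: C) *
    cyc (e :: c :: A) (e :: c :: C) (e :: c :: B) with hq
  have hw : ∀ m, cyc (e :: c :: A) (e :: c :: C) (e :: c :: B) (c :: m) = c :: m := fun m =>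
    cyc_apply_of_ne (by simp [hce.symm]) (by simp [hce.symm]) (by simp [hce.symm])
  have q1 : q (c :: e :: A) = c :: e :: B := by
    rw [hq, Perm.mul_apply, hw, cyc_apply_fst (by simpa) (by simpa)]
  have q2 : q (c :: e :: B) = c :: e :: C := by
    rw [hq, Perm.mul_apply, hw, cyc_apply_snd (by simpa) (by simpa)]
  have q3 : q (c :: e :: C) = c :: e :: A := by
    rw [hq, Perm.mul_apply, hw, cyc_apply_thd]
  have q4 : q (e :: c :: A) = e :: c :: C := by
    rw [hq, Perm.mul_apply, cyc_apply_fst (by simpa) (by simpa), cyc_apply_of_ne (by simp [hce])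
      (by simp [hce]) (by simp [hce])]
  have q5 : q (e :: c :: C) = e :: c :: B := by
    rw [hq, Perm.mul_apply, cyc_apply_snd (by simpa) (by simpa using hBC.symm),
      cyc_apply_of_ne (by simp [hce]) (by simp [hce]) (by simp [hce])]
  have q6 : q (e :: c :: B) = e :: c :: A := by
    rw [hq, Perm.mul_apply, cyc_apply_thd, cyc_apply_of_ne (by simp [hce])
      (by simp [hce]) (by simp [hce])]
  have q7 : ∀ l, l ≠ c :: e :: A → l ≠ c :: e :: B → l ≠ c :: e :: C → l ≠ e :: c :: A →
      l ≠ e :: c :: B → l ≠ e :: c :: C → q l = l := by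
    intro l h1 h2 h3 h4 h5 h6
    rw [hq, Perm.mul_apply, cyc_apply_of_ne h4 h6 h5, cyc_apply_of_ne h1 h2 h3]
  have qd : ∀ d m, d ≠ c → q (d :: e :: m) = d :: e :: m := by
    intro d m hdc
    refine q7 _ ?_ ?_ ?_ ?_ ?_ ?_ <;> simp [hdc, hce]
  have znc : ∀ m, z (c :: m) = c :: m := fun m =>
    zne _ (by simp [hce.symm]) (by simp [hce.symm]) (by simp [hce.symm])
  refine mem_prefixGroup_of_commutator (consPerm_mem hzm) hθm fun l hl => ?_
  -- Words whose tail is moved by `z`. For `d = c` the exchange takes them to words beginning `e ::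
  -- c`, which gives the inverse cycle there. For `d ≠ c` the exchange fixes them, so nothing
  -- remains in the commutator.
  have hcase : ∀ d M N, Comm u (e :: M) → Comm u (e :: N) → z (e :: M) = e :: N →
      q (e :: c :: N) = e :: c :: M → IsPrefix L (u.length + 1) (d :: e :: M) →
      q (θ (d :: e :: N)) = consPerm z (θ (d :: e :: M)) := by
    intro d M N hM hN hMN hq' hp
    by_cases hdc : d = c
    · subst hdc
      rw [θc, θc, hq', consPerm_cons, znc]
    · have hp' := hp.map (consPerm_mem hzm)
      rw [consPerm_cons, hMN] at hp'
      rw [θne d M hM hp hdc, θne d N hN hp' hdc, consPerm_cons, hMN, qd d N hdc]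
  rcases l with _ | ⟨d, m⟩
  · simpa using hl.length
  rw [consPerm_cons]
  by_cases hmA : m = e :: A
  · subst hmA; rw [zA]; exact hcase d A B hA hB zA q6 hl
  by_cases hmB : m = e :: B
  · subst hmB; rw [zB]; exact hcase d B C hB hC zB q5 hl
  by_cases hmC : m = e :: C
  · subst hmC; rw [zC]; exact hcase d C A hC hA zC q4 hl
  rw [zne m hmA hmB hmC]
  have hl' := hl.map hθm
  have hback : θ (θ (d :: m)) = d :: m := topSwap_topSwap _ _
  -- The tail becomes movable only after the exchange. Then the new last letter must be `c`, since
  -- the exchange fixes the words `d' :: e :: M` with `d' ≠ c`.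
  have hcase' : ∀ d' M N, Comm u (e :: M) → z (e :: M) = e :: N →
      q (c :: e :: M) = c :: e :: N → m ≠ e :: M → θ (d :: m) = d' :: e :: M →
      q (d' :: e :: M) = consPerm z (d' :: e :: M) := by
    intro d' M N hM hMN hq' hmM h
    rw [h] at hl' hback
    by_cases hdc : d' = c
    · subst hdc
      rw [consPerm_cons, hq', hMN]
    · rw [θne d' M hM hl' hdc] at hback
      exact absurd (List.cons.inj hback).2.symm hmM
  rcases h : θ (d :: m) with _ | ⟨d', m'⟩
  · rw [h] at hl'; simpa using hl'.length
  by_cases hmA' : m' = e :: A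
  · subst hmA'; exact hcase' d' A B hA zA q1 hmA h
  by_cases hmB' : m' = e :: B
  · subst hmB'; exact hcase' d' B C hB zB q2 hmB h
  by_cases hmC' : m' = e :: C
  · subst hmC'; exact hcase' d' C A hC zC q3 hmC h
  rw [consPerm_cons, zne m' hmA' hmB' hmC']
  rw [h] at hback
  have hno : ∀ M, m ≠ e :: M → d' :: m' ≠ e :: c :: M := by
    intro M hM hEq
    rw [hEq, θe] at hback
    exact hM (List.cons.inj hback).2.symm
  exact q7 _ (by simp [hmA']) (by simp [hmB']) (by simp [hmC']) (hno A hmA) (hno B hmB) (hno C hmC)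

/-- The three-cycles of the commutation class of `u` give three-cycles of the words `u`
followed by `c` if the letter `e` separates `c` from the other letters that can follow. -/
theorem separate (hG : HasExchanges G L g) {u : List ℤ} {c e : ℤ} (hu : u.length + 1 ≤ g)
    (halt : AltOn (prefixGroup G L u.length) {l | Comm u l}) {A B C D₁ D₂ : List ℤ}
    (hA : Comm u (e :: A)) (hB : Comm u (e :: B)) (hC : Comm u (e :: C))
    (hD₁ : Comm u D₁) (hD₂ : Comm u D₂)
    (hAB : A ≠ B) (hBC : B ≠ C) (hAC : A ≠ C) (hD : D₁ ≠ D₂)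
    (hD₁e : ∀ m ∈ [A, B, C], D₁ ≠ e :: m)
    (hD₂e : ∀ m ∈ [A, B, C], D₂ ≠ e :: m) (ha : 2 ≤ (e - c).natAbs)
    (hd : ∀ d m, Comm u m → IsPrefix L (u.length + 1) (d :: m) → d ≠ c →
      (e - d).natAbs ≠ (e - c).natAbs) :
    AltOn (prefixGroup G L (u.length + 1)) (snocClass c u) := by
  have mA : A ∈ [A, B, C] := by simp
  have mB : B ∈ [A, B, C] := by simp
  have mC : C ∈ [A, B, C] := by simp
  have hce : e ≠ c := by rintro rfl; simp at ha
  have hq := doubleCycle_mem hG hu halt hA hB hC hAB hBC hAC ha hd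
  have hz := consPerm_mem (halt _ hA _ hD₁ _ hD₂ (hD₁e _ mA).symm hD (hD₂e _ mA).symm)
  set z := cyc (e :: A) D₁ D₂ with hzdef
  -- Replacing the letter `e` by `c` changes the number of letters `c`, so the words `c :: m` are
  -- outside the class of `u` and lifts of its three-cycles fix the words `e :: c :: m`.
  have hclass : ∀ {l m}, Comm u l → Comm u (e :: m) → l ≠ c :: m := by
    rintro l m hl hm rfl
    have h1 := (hm.perm.symm.trans hl.perm).count_eq c
    simp [hce] at h1
  have hzfix : ∀ m, Comm u (e :: m) → consPerm z (e :: c :: m) = e :: c :: m := fun m hm => by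
    rw [consPerm_cons, hzdef, cyc_apply_of_ne (hclass hA hm).symm (hclass hD₁ hm).symm
      (hclass hD₂ hm).symm]
  have hzA : consPerm z (c :: e :: A) = c :: D₁ := by
    rw [consPerm_cons, hzdef, cyc_apply_fst (hD₁e _ mA).symm (hD₂e _ mA).symm]
  have hzB : consPerm z (c :: e :: B) = c :: e :: B := by
    rw [consPerm_cons, hzdef, cyc_apply_of_ne (by simpa using hAB.symm) (hD₁e _ mB).symm
      (hD₂e _ mB).symm]
  have hzC : consPerm z (c :: e :: C) = c :: e :: C := by
    rw [consPerm_cons, hzdef, cyc_apply_of_ne (by simpa using hAC.symm) (hD₁e _ mC).symm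
      (hD₂e _ mC).symm]
  set w := cyc (e :: c :: A) (e :: c :: C) (e :: c :: B) with hw
  -- The lifted cycle through `e :: A`, `D₁`, `D₂` changes one point of the first factor and leaves
  -- the second factor `w` alone.
  have hconj : consPerm z * (cyc (c :: e :: A) (c :: e :: B) (c :: e :: C) * w) * (consPerm z)⁻¹
      = cyc (c :: D₁) (c :: e :: B) (c :: e :: C) * w := by
    have h1 : consPerm z * (cyc (c :: e :: A) (c :: e :: B) (c :: e :: C) * w) * (consPerm z)⁻¹
      = (consPerm z * cyc (c :: e :: A) (c :: e :: B) (c :: e :: C) * (consPerm z)⁻¹) *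
        (consPerm z * w * (consPerm z)⁻¹) := by group
    rw [h1, hw, cyc_conj, cyc_conj, hzA, hzB, hzC, hzfix A hA, hzfix B hB, hzfix C hC]
  have hmem := mul_mem (inv_mem hq) (mul_mem (mul_mem hz hq) (inv_mem hz))
  rw [hconj] at hmem
  have hfix : ∀ m, w⁻¹ (c :: m) = c :: m := fun m => by
    rw [hw, cyc_inv, cyc_apply_of_ne] <;> simp [hce.symm]
  -- In the quotient of the two double cycles the factors on words beginning `e :: c` cancel, which
  -- leaves one three-cycle of words that end in `c`.
  have hpure : cyc (c :: e :: A) (c :: e :: C) (c :: D₁) ∈ prefixGroup G L (u.length + 1) := by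
    have h1 : (cyc (c :: e :: A) (c :: e :: B) (c :: e :: C) * w)⁻¹ *
        (cyc (c :: D₁) (c :: e :: B) (c :: e :: C) * w) =
        w⁻¹ * ((cyc (c :: e :: A) (c :: e :: B) (c :: e :: C))⁻¹ *
          cyc (c :: D₁) (c :: e :: B) (c :: e :: C)) * w⁻¹⁻¹ := by group
    rw [h1, cyc_inv_mul_cyc (by simpa) (by simpa) (by simpa using (hD₁e _ mB).symm)
      (by simpa using (hD₁e _ mC).symm), cyc_conj, hfix, hfix, hfix] at hmem
    exact hmem
  refine altOn_of_pair (p := c :: e :: A) (q := c :: e :: C) (by simpa) ?_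
  rintro _ ⟨m, hm, rfl⟩ hmA hmC
  have hmA' : m ≠ e :: A := fun h => hmA (by rw [h])
  have hmC' : m ≠ e :: C := fun h => hmC (by rw [h])
  by_cases hmD : m = D₁
  · rw [hmD]; exact hpure
  -- A third point completes `D₁ ↦ m` to a three-cycle that fixes `e :: A` and `e :: C`; conjugation
  -- by its lift carries the pure cycle to the one through `m`.
  obtain ⟨v, hv, hvm, hvD, hvA, hvC⟩ : ∃ v, Comm u v ∧ v ≠ m ∧ v ≠ D₁ ∧ v ≠ e :: A ∧ v ≠ e :: C := by
    by_cases hmB : m = e :: B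
    · exact ⟨D₂, hD₂, hmB ▸ hD₂e _ mB, hD.symm, hD₂e _ mA, hD₂e _ mC⟩
    · exact ⟨e :: B, hB, Ne.symm hmB, (hD₁e _ mB).symm, by simpa using hAB.symm, by simpa⟩
  have := cyc_conj_mem (consPerm_mem (halt _ hD₁ _ hm _ hv (Ne.symm hmD) hvm.symm hvD.symm)) hpure
  rwa [consPerm_cons, consPerm_cons, consPerm_cons,
    cyc_apply_of_ne (hD₁e _ mA).symm hmA'.symm hvA.symm,
    cyc_apply_of_ne (hD₁e _ mC).symm hmC'.symm hvC.symm,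
    cyc_apply_fst (Ne.symm hmD) hvD.symm] at this

/-- When no letter but `c` can follow, the lift of a three-cycle agrees on prefixes with the
three-cycle of the extended words. -/
theorem altOn_snocClass_of_unique {u : List ℤ} {c : ℤ}
    (halt : AltOn (prefixGroup G L u.length) {l | Comm u l})
    (hd : ∀ d m, Comm u m → IsPrefix L (u.length + 1) (d :: m) → d = c) :
    AltOn (prefixGroup G L (u.length + 1)) (snocClass c u) := by
  rintro _ ⟨A, hA, rfl⟩ _ ⟨B, hB, rfl⟩ _ ⟨C, hC, rfl⟩ hAB hBC hAC
  have hAB' : A ≠ B := fun h => hAB (h ▸ rfl)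
  have hBC' : B ≠ C := fun h => hBC (h ▸ rfl)
  have hAC' : A ≠ C := fun h => hAC (h ▸ rfl)
  refine mem_prefixGroup_of_eqOn (consPerm_mem (halt A hA B hB C hC hAB' hBC' hAC')) ?_
  rintro (_ | ⟨d, m⟩) hl
  · simpa using hl.length
  rw [consPerm_cons]
  by_cases hmA : m = A
  · subst hmA
    obtain rfl := hd d _ hA hl
    rw [cyc_apply_fst hAB hAC, cyc_apply_fst hAB' hAC']
  by_cases hmB : m = B
  · subst hmB
    obtain rfl := hd d _ hB hl
    rw [cyc_apply_snd hAC hBC, cyc_apply_snd hAC' hBC']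
  by_cases hmC : m = C
  · subst hmC
    obtain rfl := hd d _ hC hl
    rw [cyc_apply_thd, cyc_apply_thd]
  rw [cyc_apply_of_ne hmA hmB hmC, cyc_apply_of_ne (by simp [hmA]) (by simp [hmB]) (by simp [hmC])]

end Separation

/-! ### From the action on k-subsets to all three-cycles of k-subsets, by controlled permutations -/

theorem commutator_cyc_swap {Ω : Type*} [DecidableEq Ω] {a b d : Ω} (hab : a ≠ b) (had : a ≠ d)
    (hbd : b ≠ d) :
    cyc a d b * swap a b * (cyc a d b)⁻¹ * (swap a b)⁻¹ = cyc a b d := by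
  have h1 : swap a b * (cyc a d b)⁻¹ * (swap a b)⁻¹ = cyc a d b := by
    rw [cyc_inv, cyc_conj, swap_apply_right, swap_apply_left,
      swap_apply_of_ne_of_ne had.symm hbd.symm]
  have h2 := swap_apply_apply (swap a d) d b
  rw [swap_apply_right, swap_apply_of_ne_of_ne hab.symm hbd, swap_inv] at h2
  calc cyc a d b * swap a b * (cyc a d b)⁻¹ * (swap a b)⁻¹
      = cyc a d b * (swap a b * (cyc a d b)⁻¹ * (swap a b)⁻¹) := by group
    _ = (swap a d * swap d b * swap a d) * swap d b := by rw [h1, cyc]; group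
    _ = cyc a b d := by rw [← h2, swap_comm d b, cyc]

section Subsets

variable {n k : ℕ}

/-- The image of a set under a permutation. -/
def act (x : Perm (Fin n)) (S : Finset (Fin n)) : Finset (Fin n) := S.map x.toEmbedding

theorem mem_act {x : Perm (Fin n)} {S : Finset (Fin n)} {i : Fin n} :
    x i ∈ act x S ↔ i ∈ S := by
  simp [act]

theorem mem_act_of_fixed {x : Perm (Fin n)} {S : Finset (Fin n)} {i : Fin n} (h : x i = i) :
    i ∈ act x S ↔ i ∈ S := by
  conv_lhs => rw [← h]
  exact mem_act

theorem subset_act_of_fixed {x : Perm (Fin n)} {C S : Finset (Fin n)} (h : ∀ i ∈ C, x i = i) :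
    C ⊆ act x S ↔ C ⊆ S :=
  ⟨fun hC i hi => (mem_act_of_fixed (h i hi)).1 (hC hi),
    fun hC i hi => (mem_act_of_fixed (h i hi)).2 (hC hi)⟩

@[simp] theorem card_act (x : Perm (Fin n)) (S : Finset (Fin n)) : (act x S).card = S.card :=
  Finset.card_map _

theorem act_mul (x y : Perm (Fin n)) (S : Finset (Fin n)) : act (x * y) S = act x (act y S) := by
  ext i
  simp only [act, Finset.mem_map_equiv]
  rfl

@[simp] theorem act_one (S : Finset (Fin n)) : act 1 S = S := by
  ext i
  simp only [act, Finset.mem_map_equiv]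
  rfl

@[simp] theorem act_act_inv (x : Perm (Fin n)) (S : Finset (Fin n)) : act x (act x⁻¹ S) = S := by
  rw [← act_mul, mul_inv_cancel, act_one]

theorem act_insert {x : Perm (Fin n)} {C : Finset (Fin n)} (h : ∀ i ∈ C, x i = i) (e : Fin n) :
    act x (insert e C) = insert (x e) C := by
  have : act x C = C := by
    symm
    exact Finset.eq_of_subset_of_card_le ((subset_act_of_fixed h).2 subset_rfl) (by simp)
  conv_rhs => rw [← this]
  simp [act, Finset.map_insert]

theorem act_swap_of_mem {i j : Fin n} {S : Finset (Fin n)} (hi : i ∈ S) (hj : j ∈ S) :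
    act (swap i j) S = S := by
  refine (Finset.eq_of_subset_of_card_le (fun l hl => ?_) (by simp)).symm
  rcases eq_or_ne l i with rfl | hli
  · simpa using (mem_act (x := swap l j)).2 hj
  rcases eq_or_ne l j with rfl | hlj
  · simpa using (mem_act (x := swap i l)).2 hi
  exact (mem_act_of_fixed (swap_apply_of_ne_of_ne hli hlj)).2 hl

theorem exists_act_eq {S T : Finset (Fin n)} (h : S.card = T.card) : ∃ x, act x S = T := by
  let e : {i // i ∈ S} ≃ {i // i ∈ T} := Finset.equivOfCardEq h
  refine ⟨e.extendSubtype, Finset.eq_of_subset_of_card_le (fun i hi => ?_) (by simp [h])⟩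
  obtain ⟨j, hj, rfl⟩ := Finset.mem_map.1 hi
  exact e.extendSubtype_mem j hj

variable {Ω : Type*}

/-- A group of permutations of `Ω` that acts on the `k`-subsets of `Fin n`, embedded by `ι`, through
permutations `ρ x`, and contains an involution `θ` that moves exactly the subsets containing `z₀`
out of the image of `ι`. Membership in the group depends only on the action on `P`. -/
structure SubsetControl (Γ : Subgroup (Perm Ω)) (P : Set Ω) (k : ℕ) (ι : Finset (Fin n) → Ω)
    (ρ : Perm (Fin n) → Perm Ω) (θ : Perm Ω) (z₀ : Fin n) : Prop where
  map_mem : ∀ φ ∈ Γ, ∀ ω ∈ P, φ ω ∈ P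
  mem_of_eqOn : ∀ φ ∈ Γ, ∀ ψ : Perm Ω, (∀ ω ∈ P, ψ ω = φ ω) → ψ ∈ Γ
  inj : ∀ S T, S.card = k → T.card = k → ι S = ι T → S = T
  ρ_mem : ∀ x, ρ x ∈ Γ
  ρ_apply : ∀ x S, S.card = k → ρ x (ι S) = ι (act x S)
  θ_mem : θ ∈ Γ
  θ_invol : ∀ ω, θ (θ ω) = ω
  θ_apply : ∀ S, S.card = k → z₀ ∉ S → θ (ι S) = ι S
  ρ_θ : ∀ x S, S.card = k → z₀ ∈ S → ρ x (θ (ι S)) = θ (ι S)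
  comm : ∀ ω ∈ P, (∀ S, S.card = k → ω ≠ ι S) → (∀ S, S.card = k → z₀ ∈ S → ω ≠ θ (ι S)) →
    ∀ x, ρ x (θ ω) = θ (ρ x ω)

/-- Points outside of the image of the `k`-subsets. -/
def IsOff (k : ℕ) (ι : Finset (Fin n) → Ω) (ω : Ω) : Prop := ∀ S, S.card = k → ω ≠ ι S

/-- Apply `x` to the `k`-subsets that contain `C`, and fix all other points of `P`. -/
def IsPure (P : Set Ω) (k : ℕ) (ι : Finset (Fin n) → Ω) (C : Finset (Fin n)) (x : Perm (Fin n))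
    (φ : Perm Ω) : Prop :=
  (∀ S, S.card = k → φ (ι S) = ι (if C ⊆ S then act x S else S)) ∧
    ∀ ω ∈ P, IsOff k ι ω → φ ω = ω

theorem commutator_apply {φ ψ : Perm Ω} {ω : Ω} :
    (φ * ψ * φ⁻¹ * ψ⁻¹) (ψ (φ ω)) = φ (ψ ω) := by
  simp

/-- Commutators of conditional permutations. -/
theorem commutator_apply_ite {ι : Finset (Fin n) → Ω} {φ ψ : Perm Ω} {x y : Perm (Fin n)}
    {p q : Finset (Fin n) → Prop} [DecidablePred p] [DecidablePred q]
    (hpx : ∀ S, p (act x S) ↔ p S) (hpy : ∀ S, p (act y S) ↔ p S)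
    (hqx : ∀ S, q (act x S) ↔ q S) (hqy : ∀ S, q (act y S) ↔ q S)
    (hφ : ∀ S, S.card = k → φ (ι S) = ι (if p S then act x S else S))
    (hψ : ∀ S, S.card = k → ψ (ι S) = ι (if q S then act y S else S))
    (S : Finset (Fin n)) (hS : S.card = k) :
    (φ * ψ * φ⁻¹ * ψ⁻¹) (ι S) =
      ι (if p S ∧ q S then act (x * y * x⁻¹ * y⁻¹) S else S) := by
  have hpx' : ∀ S, p (act x⁻¹ S) ↔ p S := fun S => by rw [← hpx, act_act_inv]
  have hqx' : ∀ S, q (act x⁻¹ S) ↔ q S := fun S => by rw [← hqx, act_act_inv]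
  have hpy' : ∀ S, p (act y⁻¹ S) ↔ p S := fun S => by rw [← hpy, act_act_inv]
  have hqy' : ∀ S, q (act y⁻¹ S) ↔ q S := fun S => by rw [← hqy, act_act_inv]
  by_cases hp : p S <;> by_cases hq : q S
  · have := commutator_apply (φ := φ) (ψ := ψ) (ω := ι (act x⁻¹ (act y⁻¹ S)))
    rw [hφ _ (by simpa), if_pos (by simp [hpx', hpy', hp]), act_act_inv, hψ _ (by simpa),
      if_pos (by simp [hqy', hq]), act_act_inv, hψ _ (by simpa),
      if_pos (by simp [hqx', hqy', hq]), hφ _ (by simpa),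
      if_pos (by simp [hpx', hpy, hpy', hp])] at this
    rw [this, if_pos ⟨hp, hq⟩]
    simp [act_mul]
  · have := commutator_apply (φ := φ) (ψ := ψ) (ω := ι (act x⁻¹ S))
    rw [hφ _ (by simpa), if_pos (by simp [hpx', hp]), act_act_inv, hψ _ (by simpa),
      if_neg hq, hψ _ (by simpa), if_neg (by simp [hqx', hq]), hφ _ (by simpa),
      if_pos (by simp [hpx', hp]), act_act_inv] at this
    rw [this, if_neg (by simp [hq])]
  · have := commutator_apply (φ := φ) (ψ := ψ) (ω := ι (act y⁻¹ S))
    rw [hφ _ (by simpa), if_neg (by simp [hpy', hp]), hψ _ (by simpa),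
      if_pos (by simp [hqy', hq]), act_act_inv, hφ _ (by simpa), if_neg hp] at this
    rw [this, if_neg (by simp [hp])]
  · have := commutator_apply (φ := φ) (ψ := ψ) (ω := ι S)
    rw [hφ _ (by simpa), if_neg hp, hψ _ (by simpa), if_neg hq, hφ _ (by simpa), if_neg hp] at this
    rw [this, if_neg (by simp [hp])]

namespace SubsetControl

variable {Γ : Subgroup (Perm Ω)} {P : Set Ω} {ι : Finset (Fin n) → Ω}
  {ρ : Perm (Fin n) → Perm Ω} {θ : Perm Ω} {z₀ : Fin n}

/-- The points to which `θ` moves subsets that contain `z₀`. -/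
def junk (k : ℕ) (ι : Finset (Fin n) → Ω) (θ : Perm Ω) (z₀ : Fin n) : Set Ω :=
  {ω | ∃ S, S.card = k ∧ z₀ ∈ S ∧ ω = θ (ι S)}

/-- Apply `y` to the `k`-subsets that contain `i`, permute the junk, and fix all other points of
`P`. -/
def IsControlled (P : Set Ω) (k : ℕ) (ι : Finset (Fin n) → Ω) (θ : Perm Ω) (z₀ i : Fin n)
    (y : Perm (Fin n)) (φ : Perm Ω) : Prop :=
  (∀ S, S.card = k → φ (ι S) = ι (if i ∈ S then act y S else S)) ∧
    (∀ ω ∈ junk k ι θ z₀, ∃ ω' ∈ junk k ι θ z₀, φ ω' = ω) ∧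
    ∀ ω ∈ P, IsOff k ι ω → ω ∉ junk k ι θ z₀ → φ ω = ω

variable (h : SubsetControl Γ P k ι ρ θ z₀)

include h

theorem ρ_junk (x : Perm (Fin n)) {ω : Ω} (hω : ω ∈ junk k ι θ z₀) : ρ x ω = ω := by
  obtain ⟨S, hS, hz, rfl⟩ := hω
  exact h.ρ_θ x S hS hz

theorem isOff_ρ_inv (x : Perm (Fin n)) {ω : Ω} (hω : IsOff k ι ω) : IsOff k ι ((ρ x)⁻¹ ω) := by
  intro S hS hEq
  refine hω (act x S) (by simpa) ?_
  rw [← h.ρ_apply x S hS, ← hEq]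
  exact ((ρ x).apply_symm_apply ω).symm

theorem notMem_junk_ρ_inv (x : Perm (Fin n)) {ω : Ω} (hω : ω ∉ junk k ι θ z₀) :
    (ρ x)⁻¹ ω ∉ junk k ι θ z₀ := by
  intro hj
  have h1 := h.ρ_junk x hj
  rw [show ρ x ((ρ x)⁻¹ ω) = ω from (ρ x).apply_symm_apply ω] at h1
  exact hω (h1 ▸ hj)

/-- In the commutator of `ρ y` and `θ`, the subsets that contain `z₀` are parked by `θ` at points
where `ρ` is trivial, so a single `y` survives. On the other subsets `θ` is trivial, and away from
subsets and junk the two commute. -/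
theorem exists_isControlled_z₀ {y : Perm (Fin n)} (hy : y z₀ = z₀) :
    ∃ φ ∈ Γ, IsControlled P k ι θ z₀ z₀ y φ := by
  have hy' : ∀ S, z₀ ∈ act y⁻¹ S ↔ z₀ ∈ S := fun S => by
    rw [← mem_act_of_fixed hy (S := act y⁻¹ S), act_act_inv]
  refine ⟨ρ y * θ * (ρ y)⁻¹ * θ⁻¹, mul_mem (mul_mem (mul_mem (h.ρ_mem y) h.θ_mem)
    (inv_mem (h.ρ_mem y))) (inv_mem h.θ_mem), fun S hS => ?_, ?_, fun ω hω hoff hj => ?_⟩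
  · by_cases hz : z₀ ∈ S
    · have := commutator_apply (φ := ρ y) (ψ := θ) (ω := θ (ι S))
      rw [h.ρ_θ y S hS hz, h.θ_invol, h.ρ_apply y S hS] at this
      rw [this, if_pos hz]
    · have := commutator_apply (φ := ρ y) (ψ := θ) (ω := ι (act y⁻¹ S))
      rw [h.ρ_apply _ _ (by simpa), act_act_inv, h.θ_apply S hS hz,
        h.θ_apply _ (by simpa) (by rwa [hy']), h.ρ_apply _ _ (by simpa), act_act_inv] at this
      rw [this, if_neg hz]
  · rintro _ ⟨S, hS, hz, rfl⟩
    refine ⟨θ (ι (act y S)), ⟨act y S, by simpa, (mem_act_of_fixed hy).2 hz, rfl⟩, ?_⟩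
    have := commutator_apply (φ := ρ y) (ψ := θ) (ω := ι S)
    rwa [h.ρ_apply _ _ hS, h.ρ_θ y S hS hz] at this
  · have hθoff : IsOff k ι (θ ω) := by
      intro S hS hEq
      have hEq' : ω = θ (ι S) := by rw [← hEq, h.θ_invol]
      by_cases hz : z₀ ∈ S
      · exact hj ⟨S, hS, hz, hEq'⟩
      · rw [h.θ_apply S hS hz] at hEq'
        exact hoff S hS hEq'
    have hθj : θ ω ∉ junk k ι θ z₀ := by
      rintro ⟨S, hS, hz, hEq⟩
      exact hoff S hS (θ.injective hEq)
    have hP := h.map_mem _ (inv_mem (h.ρ_mem y)) _ (h.map_mem _ h.θ_mem ω hω)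
    have hc := h.comm _ hP (h.isOff_ρ_inv y hθoff)
      (fun S hS hz hEq => h.notMem_junk_ρ_inv y hθj ⟨S, hS, hz, hEq⟩) y
    have e : ρ y ((ρ y)⁻¹ (θ ω)) = θ ω := (ρ y).apply_symm_apply _
    have := commutator_apply (φ := ρ y) (ψ := θ) (ω := (ρ y)⁻¹ (θ ω))
    rw [hc, e, h.θ_invol] at this
    exact this

/-- Conjugation by the transposition of `z₀` and `i` moves the control to `i`. -/
theorem exists_isControlled (i : Fin n) {y : Perm (Fin n)} (hy : y i = i) :
    ∃ φ ∈ Γ, IsControlled P k ι θ z₀ i y φ := by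
  set s := swap z₀ i with hs
  have hss : s * s = 1 := swap_mul_self _ _
  have hyz : (s * y * s) z₀ = z₀ := by simp [hs, hy]
  obtain ⟨φ, hφ, h1, h2, h3⟩ := h.exists_isControlled_z₀ hyz
  have hinv : ∀ S, S.card = k → (ρ s)⁻¹ (ι S) = ι (act s S) := fun S hS => by
    rw [Perm.inv_eq_iff_eq, h.ρ_apply _ _ (by simpa), ← act_mul, hss, act_one]
  have hjinv : ∀ ω ∈ junk k ι θ z₀, (ρ s)⁻¹ ω = ω := fun ω hω => by
    rw [Perm.inv_eq_iff_eq, h.ρ_junk s hω]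
  refine ⟨ρ s * φ * (ρ s)⁻¹, mul_mem (mul_mem (h.ρ_mem s) hφ) (inv_mem (h.ρ_mem s)),
    fun S hS => ?_, fun ω hω => ?_, fun ω hω hoff hj => ?_⟩
  · rw [Perm.mul_apply, Perm.mul_apply, hinv S hS, h1 _ (by simpa)]
    have hiff : z₀ ∈ act s S ↔ i ∈ S := by
      conv_lhs => rw [show z₀ = s i by simp [hs]]
      exact mem_act
    by_cases hi : i ∈ S
    · rw [if_pos (hiff.2 hi), if_pos hi, h.ρ_apply _ _ (by simpa), ← act_mul, ← act_mul]
      congr 2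
      calc s * (s * y * s * s) = (s * s) * y * (s * s) := by group
        _ = y := by rw [hss]; simp
    · rw [if_neg (fun h => hi (hiff.1 h)), if_neg hi, h.ρ_apply _ _ (by simpa), ← act_mul, hss,
        act_one]
  · obtain ⟨ω', hω', hEq⟩ := h2 ω hω
    exact ⟨ω', hω', by rw [Perm.mul_apply, Perm.mul_apply, hjinv ω' hω', hEq, h.ρ_junk s hω]⟩
  · rw [Perm.mul_apply, Perm.mul_apply, h3 _ (h.map_mem _ (inv_mem (h.ρ_mem s)) _ hω)
      (h.isOff_ρ_inv s hoff) (h.notMem_junk_ρ_inv s hj)]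
    exact (ρ s).apply_symm_apply ω

/-- A commutator with the uncontrolled `ρ y`, which fixes the junk pointwise, cancels the unknown
permutation of the junk. -/
theorem exists_isPure_singleton (i : Fin n) {x y : Perm (Fin n)} (hx : x i = i) (hy : y i = i) :
    ∃ φ ∈ Γ, IsPure P k ι {i} (x * y * x⁻¹ * y⁻¹) φ := by
  obtain ⟨φ, hφ, h1, h2, h3⟩ := h.exists_isControlled i hx
  refine ⟨φ * ρ y * φ⁻¹ * (ρ y)⁻¹, mul_mem (mul_mem (mul_mem hφ (h.ρ_mem y))
    (inv_mem hφ)) (inv_mem (h.ρ_mem y)), fun S hS => ?_, fun ω hω hoff => ?_⟩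
  · rw [commutator_apply_ite (p := fun S => i ∈ S) (q := fun _ => True)
      (fun S => mem_act_of_fixed hx) (fun S => mem_act_of_fixed hy) (by simp) (by simp) h1
      (fun S hS => by rw [if_pos trivial, h.ρ_apply y S hS]) S hS]
    simp
  · by_cases hj : ω ∈ junk k ι θ z₀
    · obtain ⟨ω', hω', hEq⟩ := h2 ω hj
      have := commutator_apply (φ := φ) (ψ := ρ y) (ω := ω')
      rwa [h.ρ_junk y hω', hEq, h.ρ_junk y hj] at this
    · have := commutator_apply (φ := φ) (ψ := ρ y) (ω := (ρ y)⁻¹ ω)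
      rwa [h3 _ (h.map_mem _ (inv_mem (h.ρ_mem y)) _ hω) (h.isOff_ρ_inv y hoff)
        (h.notMem_junk_ρ_inv y hj), show ρ y ((ρ y)⁻¹ ω) = ω from (ρ y).apply_symm_apply ω,
        h3 ω hω hoff hj] at this

/-- A commutator of controlled permutations is nontrivial only where both controls hold. The first
factor fixes everything off the subsets, so the junk moved by the second one does not matter. -/
theorem exists_isPure_insert {C : Finset (Fin n)} {i : Fin n} {x y : Perm (Fin n)}
    (hxC : ∀ j ∈ C, x j = j) (hyC : ∀ j ∈ C, y j = j) (hx : x i = i) (hy : y i = i)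
    (hp : ∃ φ ∈ Γ, IsPure P k ι C x φ) :
    ∃ φ ∈ Γ, IsPure P k ι (insert i C) (x * y * x⁻¹ * y⁻¹) φ := by
  obtain ⟨φ, hφ, hp1, hp2⟩ := hp
  obtain ⟨f, hf, h1, h2, h3⟩ := h.exists_isControlled i hy
  refine ⟨φ * f * φ⁻¹ * f⁻¹, mul_mem (mul_mem (mul_mem hφ hf) (inv_mem hφ)) (inv_mem hf),
    fun S hS => ?_, fun ω hω hoff => ?_⟩
  · rw [commutator_apply_ite (p := fun S => C ⊆ S) (q := fun S => i ∈ S)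
      (fun S => subset_act_of_fixed hxC) (fun S => subset_act_of_fixed hyC)
      (fun S => mem_act_of_fixed hx) (fun S => mem_act_of_fixed hy) hp1 h1 S hS]
    simp only [Finset.insert_subset_iff, and_comm]
  · have e : f (f⁻¹ ω) = ω := f.apply_symm_apply ω
    have hoff' : IsOff k ι (f⁻¹ ω) := by
      intro S hS hEq
      rw [hEq, h1 S hS] at e
      refine hoff _ ?_ e.symm
      split_ifs <;> simpa
    have := commutator_apply (φ := φ) (ψ := f) (ω := f⁻¹ ω)
    rwa [hp2 _ (h.map_mem _ (inv_mem hf) _ hω) hoff', e, hp2 ω hω hoff] at this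

/-- A three-cycle is the commutator of a three-cycle and a transposition of the same points. Hence
the commutator spent on each new control again gives a three-cycle, and the induction over `C`
continues. -/
theorem exists_isPure_cyc {C : Finset (Fin n)} (hC : C.Nonempty) {a b d : Fin n}
    (ha : a ∉ C) (hb : b ∉ C) (hd : d ∉ C) (hab : a ≠ b) (had : a ≠ d) (hbd : b ≠ d) :
    ∃ φ ∈ Γ, IsPure P k ι C (cyc a b d) φ := by
  induction hC using Finset.Nonempty.cons_induction generalizing a b d with
  | singleton i =>
    simp only [Finset.mem_singleton] at ha hb hd
    rw [← commutator_cyc_swap hab had hbd]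
    exact h.exists_isPure_singleton i (cyc_apply_of_ne (Ne.symm ha) (Ne.symm hd) (Ne.symm hb))
      (swap_apply_of_ne_of_ne (Ne.symm ha) (Ne.symm hb))
  | cons i C hi hC ih =>
    simp only [Finset.mem_cons, not_or] at ha hb hd
    rw [← commutator_cyc_swap hab had hbd, Finset.cons_eq_insert]
    have hne : ∀ {j c : Fin n}, j ∈ C → c ∉ C → j ≠ c := by
      rintro j c hj hc rfl
      exact hc hj
    exact h.exists_isPure_insert
      (fun j hj => cyc_apply_of_ne (hne hj ha.2) (hne hj hd.2) (hne hj hb.2))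
      (fun j hj => swap_apply_of_ne_of_ne (hne hj ha.2) (hne hj hb.2))
      (cyc_apply_of_ne (Ne.symm ha.1) (Ne.symm hd.1) (Ne.symm hb.1))
      (swap_apply_of_ne_of_ne (Ne.symm ha.1) (Ne.symm hb.1))
      (ih ha.2 hd.2 hb.2 had hab hbd.symm)

/-- With k-1 controls `C`, the subsets that qualify are `C ∪ {a}`, and a three-cycle of points is a
three-cycle of these subsets. There are at least three of them because `k + 2 ≤ n`. All other
subsets are then absorbed by means of transpositions. -/
theorem altOn [DecidableEq Ω] (hk : 2 ≤ k) (hn : k + 2 ≤ n) :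
    AltOn Γ {ω | ∃ S, S.card = k ∧ ω = ι S} := by
  obtain ⟨C, -, hC⟩ := Finset.exists_subset_card_eq
    (s := (Finset.univ : Finset (Fin n))) (n := k - 1) (by simp; omega)
  have hCne : C.Nonempty := Finset.card_pos.1 (by omega)
  have hcard : ∀ {a}, a ∉ C → (insert a C).card = k := fun ha => by
    rw [Finset.card_insert_of_notMem ha]; omega
  have hins : ∀ {a b}, a ∉ C → insert a C = insert b C → a = b := by
    intro a b ha hEq
    have : a ∈ insert b C := hEq ▸ Finset.mem_insert_self a C
    exact (Finset.mem_insert.1 this).resolve_right ha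
  set Y : Set Ω := {ω | ∃ a, a ∉ C ∧ ω = ι (insert a C)} with hY
  have hYne : ∀ {a b}, a ∉ C → b ∉ C → a ≠ b → ι (insert a C) ≠ ι (insert b C) :=
    fun ha hb hab hEq => hab (hins ha (h.inj _ _ (hcard ha) (hcard hb) hEq))
  have hYalt : AltOn Γ Y := by
    rintro _ ⟨a, ha, rfl⟩ _ ⟨b, hb, rfl⟩ _ ⟨d, hd, rfl⟩ hab hbd had
    have hab' : a ≠ b := fun e => hab (e ▸ rfl)
    have hbd' : b ≠ d := fun e => hbd (e ▸ rfl)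
    have had' : a ≠ d := fun e => had (e ▸ rfl)
    obtain ⟨φ, hφ, h1, h2⟩ := h.exists_isPure_cyc hCne ha hb hd hab' had' hbd'
    have hfix : ∀ j ∈ C, cyc a b d j = j := fun j hj =>
      cyc_apply_of_ne (fun e => ha (e ▸ hj)) (fun e => hb (e ▸ hj)) (fun e => hd (e ▸ hj))
    refine h.mem_of_eqOn φ hφ _ fun ω hω => ?_
    by_cases hoff : IsOff k ι ω
    · rw [h2 ω hω hoff, cyc_apply_of_ne (hoff _ (hcard ha)) (hoff _ (hcard hb))
        (hoff _ (hcard hd))]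
    simp only [IsOff, not_forall, not_not] at hoff
    obtain ⟨S, hS, rfl⟩ := hoff
    rw [h1 S hS]
    by_cases hCS : C ⊆ S
    · rw [if_pos hCS]
      obtain ⟨e, he, rfl⟩ : ∃ e, e ∉ C ∧ S = insert e C := by
        obtain ⟨e, he, hSe⟩ := Finset.exists_eq_insert_iff.2 ⟨hCS, by omega⟩
        exact ⟨e, he, hSe.symm⟩
      rw [act_insert hfix]
      by_cases hea : e = a
      · subst hea; rw [cyc_apply_fst hab had, cyc_apply_fst hab' had']
      by_cases heb : e = b
      · subst heb; rw [cyc_apply_snd had hbd, cyc_apply_snd had' hbd']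
      by_cases hed : e = d
      · subst hed; rw [cyc_apply_thd, cyc_apply_thd]
      rw [cyc_apply_of_ne hea heb hed, cyc_apply_of_ne (hYne he ha hea) (hYne he hb heb)
        (hYne he hd hed)]
    · rw [if_neg hCS]
      have hSne : ∀ {e}, e ∉ C → ι S ≠ ι (insert e C) := fun he hEq =>
        hCS (h.inj _ _ hS (hcard he) hEq ▸ Finset.subset_insert _ _)
      rw [cyc_apply_of_ne (hSne ha) (hSne hb) (hSne hd)]
  have h3 : HasThree Y := by
    have hc : 2 < (Cᶜ).card := by rw [Finset.card_compl, hC, Fintype.card_fin]; omega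
    obtain ⟨a, b, d, ha, hb, hd, hab, had, hbd⟩ := Finset.two_lt_card_iff.1 hc
    rw [Finset.mem_compl] at ha hb hd
    exact ⟨_, ⟨a, ha, rfl⟩, _, ⟨b, hb, rfl⟩, _, ⟨d, hd, rfl⟩, hYne ha hb hab, hYne hb hd hbd,
      hYne ha hd had⟩
  refine (altOn_absorbed h3).mono ?_
  rintro _ ⟨S, hS, rfl⟩
  obtain ⟨a₀, ha₀⟩ : ∃ a, a ∉ C := by
    by_contra! hcon
    have : C = Finset.univ := Finset.eq_univ_iff_forall.2 hcon
    rw [this, Finset.card_univ, Fintype.card_fin] at hC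
    omega
  obtain ⟨x, rfl⟩ := exists_act_eq (hcard ha₀ |>.trans hS.symm)
  clear hS
  induction x using Perm.swap_induction_on with
  | one => rw [act_one]; exact hYalt.subset_absorbed ⟨a₀, ha₀, rfl⟩
  | swap_mul f i j hij ih =>
    rw [act_mul, ← h.ρ_apply _ _ (by simpa using hcard ha₀)]
    -- Every transposition keeps some `C ∪ {z}` among these subsets: take for `z` a transposed point
    -- outside `C`, or any point if both lie in `C`.
    obtain ⟨z, hz, hzC⟩ : ∃ z ∉ C, ρ (swap i j) (ι (insert z C)) ∈ Y := by
      have key : ∀ i j : Fin n, i ∈ C → j ∉ C →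
          ρ (swap i j) (ι (insert j C)) = ι (insert j C) := by
        intro i j hi hj
        rw [h.ρ_apply _ _ (hcard hj), act_swap_of_mem (by simp [hi]) (by simp)]
      by_cases hi : i ∈ C <;> by_cases hj : j ∈ C
      · refine ⟨a₀, ha₀, a₀, ha₀, ?_⟩
        rw [h.ρ_apply _ _ (hcard ha₀), act_swap_of_mem (by simp [hi]) (by simp [hj])]
      · exact ⟨j, hj, j, hj, key i j hi hj⟩
      · exact ⟨i, hi, i, hi, by rw [swap_comm]; exact key j i hj hi⟩
      · refine ⟨i, hi, j, hj, ?_⟩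
        rw [h.ρ_apply _ _ (hcard hi), act_insert, swap_apply_left]
        exact fun l hl => swap_apply_of_ne_of_ne (fun e => hi (e ▸ hl)) (fun e => hj (e ▸ hl))
    exact hYalt.apply_mem_absorbed h3 (h.ρ_mem _) ⟨z, hz, rfl⟩ hzC ih

end SubsetControl

end Subsets

/-! ### Shuffles of an increasing and a decreasing word, and the permutations of their positions -/

section Shuffles

/-- The shuffle, after the word `q`, of the increasing word `a, a+1, …` and the decreasing word
`b, b-1, …` in which `true` marks the letters of the latter. The last letter comes first. -/
def shuffle (q : List ℤ) (a b : ℤ) : List Bool → List ℤ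
  | [] => q
  | true :: l => (b - l.count true) :: shuffle q a b l
  | false :: l => (a + l.count false) :: shuffle q a b l

variable {q : List ℤ} {a b : ℤ}

@[simp] theorem length_shuffle (l : List Bool) :
    (shuffle q a b l).length = l.length + q.length := by
  induction l with
  | nil => simp [shuffle]
  | cons x l ih => cases x <;> simp [shuffle, ih] <;> omega

/-- Letters of the decreasing word are at most `b` and those of the increasing word at least `a`, so
each letter reveals its origin. -/
theorem shuffle_injective (hab : b < a) {l l' : List Bool} (hl : l.length = l'.length)
    (h : shuffle q a b l = shuffle q a b l') : l = l' := by
  induction l generalizing l' with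
  | nil => exact (List.length_eq_zero_iff.1 hl.symm).symm
  | cons x l ih =>
    rcases l' with _ | ⟨x', l'⟩
    · simp at hl
    cases x <;> cases x' <;> simp only [shuffle, List.cons.injEq] at h
    · rw [ih (by simpa using hl) h.2]
    · omega
    · omega
    · rw [ih (by simpa using hl) h.2]

/-- Exchanges of letters lead from shuffles to shuffles. -/
theorem Step.exists_shuffle (hq : q = [] ∨ q = [a - 1] ∧ b = a - 2)
    {l : List Bool} {w : List ℤ} (h : Step (shuffle q a b l) w) :
    ∃ l', l.Perm l' ∧ w = shuffle q a b l' := by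
  induction l generalizing w with
  | nil =>
    rcases hq with rfl | ⟨rfl, -⟩
    · cases h
    · rw [shuffle] at h
      cases h with | cons _ h => cases h
  | cons x l ih =>
    have hcons : ∀ z : ℤ, ∀ v, shuffle q a b (x :: l) = z :: v → v = shuffle q a b l := by
      intro z v hz
      cases x <;> exact (List.cons.inj hz).2.symm
    generalize hW : shuffle q a b (x :: l) = W at h
    cases h with
    | @cons z m m' h =>
      obtain rfl := hcons z m hW
      obtain ⟨l', hl, rfl⟩ := ih h
      refine ⟨x :: l', hl.cons x, ?_⟩
      cases x <;> simp only [shuffle, List.cons.injEq] at hW ⊢ <;> rw [← hl.count_eq] <;>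
        exact ⟨hW.1.symm, trivial⟩
    | swap y z v h =>
      have hv := hcons z _ hW
      rcases l with _ | ⟨x', l⟩
      · rcases hq with rfl | ⟨rfl, hb⟩
        · simp [shuffle] at hv
        -- The corner letter `a - 1` is at distance one from both `a` and `b = a - 2`, so it never
        -- moves.
        · exfalso
          cases x <;> simp only [shuffle, List.cons.injEq, List.count_nil] at hW <;> omega
      · refine ⟨x' :: x :: l, List.Perm.swap _ _ _, ?_⟩
        cases x <;> cases x' <;>
          simp [shuffle] at hW hv ⊢ <;> obtain ⟨h1, h2, h3⟩ := hW <;>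
          first
          | exact ⟨h2.symm, h1.symm, h3.symm⟩
          | (exfalso; omega)

theorem Comm.exists_shuffle (hq : q = [] ∨ q = [a - 1] ∧ b = a - 2)
    {l : List Bool} {w : List ℤ} (h : Comm (shuffle q a b l) w) :
    ∃ l', l.Perm l' ∧ w = shuffle q a b l' := by
  induction h with
  | refl => exact ⟨l, .refl _, rfl⟩
  | tail _ hs ih =>
    obtain ⟨l', hl, rfl⟩ := ih
    obtain ⟨l'', hl', rfl⟩ := hs.exists_shuffle hq
    exact ⟨l'', hl.trans hl', rfl⟩

/-- The characteristic function of a set, as a list. -/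
def boolList {n : ℕ} (S : Finset (Fin n)) : List Bool := List.ofFn fun i => decide (i ∈ S)

@[simp] theorem length_boolList {n : ℕ} (S : Finset (Fin n)) : (boolList S).length = n := by
  simp [boolList]

theorem boolList_injective {n : ℕ} {S T : Finset (Fin n)} (h : boolList S = boolList T) :
    S = T := by
  have := List.ofFn_injective h
  ext i
  simpa using congrFun this i

theorem count_ofFn {n : ℕ} (f : Fin n → Bool) (x : Bool) :
    (List.ofFn f).count x = (Finset.univ.filter fun i => f i = x).card := by
  induction n with
  | zero => simp
  | succ n ih =>
    rw [List.ofFn_succ, List.count_cons, ih, Fin.univ_succ, Finset.filter_cons]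
    simp only [Finset.filter_map, beq_iff_eq]
    split_ifs <;> simp

theorem count_boolList {n : ℕ} (S : Finset (Fin n)) : (boolList S).count true = S.card := by
  rw [boolList, count_ofFn]
  simp

theorem exists_boolList {n : ℕ} {l : List Bool} (h : l.length = n) :
    ∃ S : Finset (Fin n), boolList S = l := by
  subst h
  refine ⟨Finset.univ.filter fun i => l[i] = true, ?_⟩
  simp [boolList]

/-- The exchange of the letters at positions `i`, `i+1`, counted from the end. -/
theorem iterate_consPerm_topSwap (hab : b + 2 ≤ a) {n : ℕ} (i : Fin n) (f : Fin (n + 1) → Bool) :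
    (consPerm^[i] (topSwap (a - b + (n - 1 - i : ℕ)).natAbs)) (shuffle q a b (List.ofFn f)) =
      shuffle q a b (List.ofFn (f ∘ swap i.castSucc i.succ)) := by
  induction n with
  | zero => exact i.elim0
  | succ n ih =>
    induction i using Fin.cases with
    | zero =>
      simp only [Fin.val_zero, Function.iterate_zero, id, Fin.castSucc_zero, Fin.succ_zero_eq_one]
      have hl : (List.ofFn fun i : Fin n => f i.succ.succ).length = n := by simp
      have hc := List.count_false_add_count_true (List.ofFn fun i : Fin n => f i.succ.succ)
      rw [hl] at hc
      have hrest : (fun i : Fin n => (f ∘ swap 0 1) i.succ.succ) = fun i => f i.succ.succ := by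
        funext i
        rw [Function.comp, swap_apply_of_ne_of_ne (Fin.succ_ne_zero _)
          (by simp [Fin.ext_iff])]
      rw [List.ofFn_succ, List.ofFn_succ, List.ofFn_succ (f := f ∘ swap 0 1), List.ofFn_succ,
        hrest]
      simp only [Function.comp, swap_apply_left, Fin.succ_zero_eq_one, swap_apply_right]
      generalize f 0 = x
      generalize f 1 = y
      -- Adjacent letters of different origin differ by a - b plus the number of earlier shuffled
      -- letters. This depends only on the position, so one exchange distance serves for all
      -- shuffles; letters of the same origin differ by one and are left alone.
      cases x <;> cases y <;> simp only [shuffle]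
      · exact topSwap_of_ne _ (by simp; omega)
      · rw [topSwap_of_eq _ (by simp; omega)]
        simp
      · rw [topSwap_of_eq _ (by simp; omega)]
        simp
      · exact topSwap_of_ne _ (by simp; omega)
    | succ j =>
      have h := ih j (fun i => f i.succ)
      have h0 : (f ∘ swap j.succ.castSucc j.succ.succ) 0 = f 0 := by
        rw [Function.comp, swap_apply_of_ne_of_ne (by simp [Fin.ext_iff]) (Fin.succ_ne_zero _).symm]
      have hs : (fun i : Fin (n + 1) => (f ∘ swap j.succ.castSucc j.succ.succ) i.succ) =
          (fun i => f i.succ) ∘ swap j.castSucc j.succ := by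
        funext i
        simp only [Function.comp]
        congr 1
        rw [← Fin.succ_castSucc]
        exact ((Fin.succ_injective _).swap_apply _ _ _)
      rw [List.ofFn_succ, List.ofFn_succ (f := f ∘ _), h0, hs]
      have hcount : ∀ x, (List.ofFn ((fun i => f i.succ) ∘ swap j.castSucc j.succ)).count x =
          (List.ofFn fun i => f i.succ).count x := fun x =>
        (Perm.ofFn_comp_perm _ _).count_eq x
      have hexp : n + 1 - 1 - (j.succ : ℕ) = n - 1 - (j : ℕ) := by simp; omega
      rw [hexp, Fin.val_succ, Function.iterate_succ_apply']
      cases f 0 <;> simp only [shuffle, consPerm_cons, hcount, h]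

theorem decide_mem_act {n : ℕ} (x : Perm (Fin n)) (S : Finset (Fin n)) :
    (fun i => decide (i ∈ act x S)) = (fun i => decide (i ∈ S)) ∘ x.symm := by
  funext i
  simp [act]

theorem iterate_consPerm_topSwap_boolList (hab : b + 2 ≤ a) {n : ℕ} (i : Fin n)
    (S : Finset (Fin (n + 1))) :
    (consPerm^[i] (topSwap (a - b + (n - 1 - i : ℕ)).natAbs)) (shuffle q a b (boolList S)) =
      shuffle q a b (boolList (act (swap i.castSucc i.succ) S)) := by
  rw [boolList, boolList, iterate_consPerm_topSwap hab, decide_mem_act, symm_swap]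

/-- The shuffles, as a family indexed by the `k`-subsets. -/
def shuffleEmbedding (q : List ℤ) (hab : b + 2 ≤ a) (n k : ℕ) :
    {S : Finset (Fin n) // S.card = k} ↪ List ℤ where
  toFun S := shuffle q a b (boolList S.1)
  inj' := fun _ _ h => Subtype.ext (boolList_injective
    (shuffle_injective (by omega) (by simp) h))

/-- The action of the permutations of `Fin n` on the `k`-subsets. -/
def actHom (n k : ℕ) : Perm (Fin n) →* Perm {S : Finset (Fin n) // S.card = k} where
  toFun x :=
    { toFun := fun S => ⟨act x S.1, by rw [card_act]; exact S.2⟩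
      invFun := fun S => ⟨act x⁻¹ S.1, by rw [card_act]; exact S.2⟩
      left_inv := fun S => Subtype.ext (by simp only [← act_mul, inv_mul_cancel, act_one])
      right_inv := fun S => Subtype.ext (by simp only [← act_mul, mul_inv_cancel, act_one]) }
  map_one' := by ext1 S; exact Subtype.ext (act_one _)
  map_mul' x y := by ext1 S; exact Subtype.ext (act_mul _ _ _)

/-- The permutations of words that permute the positions of the letters of a shuffle and fix all
other words. -/
noncomputable def shuffleHom (q : List ℤ) (hab : b + 2 ≤ a) (n k : ℕ) :
    Perm (Fin n) →* Perm (List ℤ) :=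
  (Perm.viaEmbeddingHom (shuffleEmbedding q hab n k)).comp (actHom n k)

theorem shuffleHom_apply (hab : b + 2 ≤ a) {n k : ℕ} (x : Perm (Fin n)) {S : Finset (Fin n)}
    (hS : S.card = k) : shuffleHom q hab n k x (shuffle q a b (boolList S)) =
      shuffle q a b (boolList (act x S)) :=
  Perm.viaEmbedding_apply (actHom n k x) (shuffleEmbedding q hab n k) ⟨S, hS⟩

theorem shuffleHom_apply_of_ne (hab : b + 2 ≤ a) {n k : ℕ} (x : Perm (Fin n)) {l : List ℤ}
    (hl : ∀ S : Finset (Fin n), S.card = k → l ≠ shuffle q a b (boolList S)) :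
    shuffleHom q hab n k x l = l := by
  refine Perm.viaEmbedding_apply_of_notMem _ _ _ ?_
  rintro ⟨⟨S, hS⟩, rfl⟩
  exact hl S hS rfl

variable {X : Type*} {G : Subgroup (Perm X)} {L : X → ℕ → ℤ} {g : ℕ}

theorem iterate_consPerm_mem (hG : HasExchanges G L g) {m i c : ℕ} (hm : m + 2 + i ≤ g)
    (hc : 2 ≤ c) : consPerm^[i] (topSwap c) ∈ prefixGroup G L (m + 2 + i) := by
  induction i with
  | zero => exact topSwap_mem hG hm hc
  | succ i ih =>
    rw [Function.iterate_succ_apply']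
    exact consPerm_mem (ih (by omega))

/-- If the exchange of the extreme letters only affects shuffles, then all permutations of
the letters of shuffles are available. -/
theorem shuffleHom_mem (hG : HasExchanges G L g) (hab : b + 2 ≤ a) {n k : ℕ}
    (hg : n + 1 + q.length ≤ g)
    (hpure : ∀ l, IsPrefix L (n + 1 + q.length) l →
      topSwap (a - b + (n - 1 : ℕ)).natAbs l ≠ l →
      ∃ S : Finset (Fin (n + 1)), S.card = k ∧ l = shuffle q a b (boolList S))
    (x : Perm (Fin (n + 1))) :
    shuffleHom q hab (n + 1) k x ∈ prefixGroup G L (n + 1 + q.length) := by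
  set σ : Fin n → Perm (List ℤ) := fun i =>
    consPerm^[i] (topSwap (a - b + (n - 1 - i : ℕ)).natAbs) with hσ
  have hσm : ∀ i, σ i ∈ prefixGroup G L (n + 1 + q.length) := by
    intro i
    have hi := i.2
    have := iterate_consPerm_mem (m := n - 1 - i + q.length) (i := i)
      (c := (a - b + (n - 1 - i : ℕ)).natAbs) hG (by omega) (by omega)
    rwa [show n - 1 - i + q.length + 2 + i = n + 1 + q.length by omega] at this
  have hσapp : ∀ i S, σ i (shuffle q a b (boolList S)) =
      shuffle q a b (boolList (act (swap i.castSucc i.succ) S)) := fun i S =>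
    iterate_consPerm_topSwap_boolList hab i S
  set s : Fin n → Perm (Fin (n + 1)) := fun i => swap i.castSucc i.succ with hs
  have hss : ∀ i, s i * s i = 1 := fun i => swap_mul_self _ _
  -- `σ i` realizes the transposition on shuffles but may also move other words. Conjugation by it
  -- is harmless, since it preserves the set of shuffles and `shuffleHom` is trivial off that set.
  have hconj : ∀ i x, shuffleHom q hab (n + 1) k x ∈ prefixGroup G L (n + 1 + q.length) →
      shuffleHom q hab (n + 1) k (s i * x * s i) ∈ prefixGroup G L (n + 1 + q.length) := by
    intro i x hx
    have key : shuffleHom q hab (n + 1) k (s i * x * s i) =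
        σ i * shuffleHom q hab (n + 1) k x * (σ i)⁻¹ := by
      rw [eq_mul_inv_iff_mul_eq]
      ext1 l
      rw [Perm.mul_apply, Perm.mul_apply]
      by_cases hl : ∃ S : Finset (Fin (n + 1)), S.card = k ∧ l = shuffle q a b (boolList S)
      · obtain ⟨S, hS, rfl⟩ := hl
        rw [hσapp, shuffleHom_apply hab _ (by simpa), shuffleHom_apply hab _ hS, hσapp,
          ← act_mul, ← act_mul, mul_assoc, hss, mul_one]
      · rw [shuffleHom_apply_of_ne hab x fun S hS h => hl ⟨S, hS, h⟩]
        refine shuffleHom_apply_of_ne hab _ fun S hS h => hl ⟨act (s i) S, by simpa, ?_⟩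
        apply (σ i).injective
        rw [h, hσapp, ← act_mul, hss, act_one]
    rw [key]
    exact mul_mem (mul_mem (hσm i) hx) (inv_mem (hσm i))
  have hadj : ∀ i : Fin n, shuffleHom q hab (n + 1) k (s i) ∈ prefixGroup G L (n + 1 + q.length) := by
    rintro ⟨i, hi⟩
    induction i with
    | zero =>
      -- At the last two positions the exchange itself moves only shuffles, by `hpure`.
      refine mem_prefixGroup_of_eqOn (hσm ⟨0, hi⟩) fun l hl => ?_
      by_cases h : ∃ S : Finset (Fin (n + 1)), S.card = k ∧ l = shuffle q a b (boolList S)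
      · obtain ⟨S, hS, rfl⟩ := h
        rw [shuffleHom_apply hab _ hS, hσapp]
      · rw [shuffleHom_apply_of_ne hab _ fun S hS h' => h ⟨S, hS, h'⟩]
        by_contra hne
        exact h (hpure l hl (Ne.symm hne))
    | succ i ih =>
      -- The braid relation turns the transposition at `i` into the one at `i + 1` by two
      -- conjugations.
      have h1 := hconj ⟨i, by omega⟩ _ (hconj ⟨i + 1, hi⟩ _ (ih (by omega)))
      have h2 : s ⟨i, by omega⟩ * (s ⟨i + 1, hi⟩ * s ⟨i, by omega⟩ * s ⟨i + 1, hi⟩) *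
          s ⟨i, by omega⟩ = s ⟨i + 1, hi⟩ := by
        have e1 : s ⟨i + 1, hi⟩ * s ⟨i, by omega⟩ * s ⟨i + 1, hi⟩ =
            s ⟨i, by omega⟩ * s ⟨i + 1, hi⟩ * s ⟨i, by omega⟩ := by
          have e2 := swap_apply_apply (s ⟨i, by omega⟩) (⟨i + 1, by omega⟩ : Fin (n + 1))
            ⟨i + 2, by omega⟩
          have e3 := swap_apply_apply (s ⟨i + 1, hi⟩) (⟨i, by omega⟩ : Fin (n + 1))
            ⟨i + 1, by omega⟩
          simp only [hs, swap_inv, Fin.castSucc_mk, Fin.succ_mk] at e2 e3 ⊢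
          rw [swap_apply_right, swap_apply_of_ne_of_ne (by simp only [ne_eq, Fin.mk.injEq]; omega)
            (by simp only [ne_eq, Fin.mk.injEq]; omega)] at e2
          rw [swap_apply_left, swap_apply_of_ne_of_ne (by simp only [ne_eq, Fin.mk.injEq]; omega)
            (by simp only [ne_eq, Fin.mk.injEq]; omega)] at e3
          rw [← e2, ← e3]
        rw [e1]
        calc _ = (s ⟨i, by omega⟩ * s ⟨i, by omega⟩) * s ⟨i + 1, hi⟩ *
            (s ⟨i, by omega⟩ * s ⟨i, by omega⟩) := by group
          _ = _ := by rw [hss]; simp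
      rwa [h2] at h1
  have htop : x ∈ Submonoid.closure (Set.range s) := by
    rw [hs, Perm.mclosure_swap_castSucc_succ]; trivial
  induction htop using Submonoid.closure_induction with
  | mem x hx => obtain ⟨i, rfl⟩ := hx; exact hadj i
  | one => rw [map_one]; exact one_mem _
  | mul x y _ _ hx hy => rw [map_mul]; exact mul_mem hx hy

end Shuffles

/-! ### Three-cycles of shuffles followed by one more letter -/

section ShuffleClass

variable {q : List ℤ} {a b : ℤ} {X : Type*} {G : Subgroup (Perm X)} {L : X → ℕ → ℤ} {g n k : ℕ}

theorem exists_cons_eq_boolList (S : Finset (Fin (n + 1))) :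
    ∃ l : List Bool, boolList S = decide (0 ∈ S) :: l ∧ l.length = n :=
  ⟨_, List.ofFn_succ, List.length_ofFn⟩

theorem shuffle_boolList_of_mem {S : Finset (Fin (n + 1))} (hS : S.card = k) (h : 0 ∈ S) :
    ∃ l : List Bool, l.length = n ∧ l.count true + 1 = k ∧
      shuffle q a b (boolList S) = (b - k + 1) :: shuffle q a b l := by
  obtain ⟨l, hl, hn⟩ := exists_cons_eq_boolList S
  have hc := count_boolList S
  rw [hl, decide_eq_true h, List.count_cons_self, hS] at hc
  refine ⟨l, hn, hc, ?_⟩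
  rw [hl, decide_eq_true h, shuffle]
  congr 1
  omega

theorem shuffle_boolList_of_notMem {S : Finset (Fin (n + 1))} (hS : S.card = k) (h : 0 ∉ S) :
    ∃ l : List Bool, shuffle q a b (boolList S) = (a + n - k) :: shuffle q a b l := by
  obtain ⟨l, hl, hn⟩ := exists_cons_eq_boolList S
  have hc := count_boolList S
  rw [hl, decide_eq_false h, List.count_cons_of_ne (by simp), hS] at hc
  refine ⟨l, ?_⟩
  rw [hl, decide_eq_false h, shuffle]
  have := List.count_false_add_count_true l
  congr 1
  omega

theorem exists_boolList_of_comm (hq : q = [] ∨ q = [a - 1] ∧ b = a - 2)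
    {l : List Bool} (hl : l.length = n) (hlk : l.count true = k) {m : List ℤ}
    (hm : Comm (shuffle q a b l) m) :
    ∃ S : Finset (Fin n), S.card = k ∧ m = shuffle q a b (boolList S) := by
  obtain ⟨l', hp, rfl⟩ := hm.exists_shuffle hq
  obtain ⟨S, hS⟩ := exists_boolList (n := n) (hp.length_eq.symm.trans hl)
  exact ⟨S, by rw [← count_boolList, hS, ← hp.count_eq, hlk], by rw [hS]⟩

/-- The last letter of a shuffle is the final letter `b - k + 1` of the decreasing word if position
0 belongs to the subset, and `a + n - k` otherwise. The exchange at the distance of the former from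
`c` therefore moves exactly the subsets that contain 0, and `hd` prevents it from acting when
another letter follows the shuffle. -/
theorem subsetControl_shuffle (hG : HasExchanges G L g) (hab : b + 2 ≤ a)
    (hg : n + 2 + q.length ≤ g)
    (hpure : ∀ l, IsPrefix L (n + 1 + q.length) l →
      topSwap (a - b + (n - 1 : ℕ)).natAbs l ≠ l →
      ∃ S : Finset (Fin (n + 1)), S.card = k ∧ l = shuffle q a b (boolList S))
    {c : ℤ} (hc : 2 ≤ (b - k + 1 - c).natAbs) (hcc : (a + n - k - c).natAbs ≠ (b - k + 1 - c).natAbs)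
    (hd : ∀ d, ∀ S : Finset (Fin (n + 1)), S.card = k →
      IsPrefix L (n + 1 + q.length + 1) (d :: shuffle q a b (boolList S)) → d ≠ c →
      (a + n - k - d).natAbs ≠ (b - k + 1 - c).natAbs ∧
      (b - k + 1 - d).natAbs ≠ (b - k + 1 - c).natAbs) :
    SubsetControl (prefixGroup G L (n + 1 + q.length + 1))
      {l | IsPrefix L (n + 1 + q.length + 1) l} k
      (fun S : Finset (Fin (n + 1)) => c :: shuffle q a b (boolList S))
      (fun x => consPerm (shuffleHom q hab (n + 1) k x))
      (topSwap (b - k + 1 - c).natAbs) 0 := by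
  have hθ : topSwap (b - k + 1 - c).natAbs ∈ prefixGroup G L (n + 1 + q.length + 1) := by
    have := topSwap_mem (k := n + q.length) (a := (b - k + 1 - c).natAbs) hG (by omega) hc
    rwa [show n + q.length + 2 = n + 1 + q.length + 1 by omega] at this
  have hmove : ∀ S : Finset (Fin (n + 1)), S.card = k → 0 ∈ S →
      ∃ l, l.length = n ∧ l.count true + 1 = k ∧
      shuffle q a b (boolList S) = (b - k + 1) :: shuffle q a b l ∧
      topSwap (b - k + 1 - c).natAbs (c :: shuffle q a b (boolList S)) =
        (b - k + 1) :: c :: shuffle q a b l := by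
    intro S hS h
    obtain ⟨l, h1, h2, h3⟩ := shuffle_boolList_of_mem (q := q) (a := a) (b := b) hS h
    exact ⟨l, h1, h2, h3, by rw [h3, topSwap_of_eq _ rfl]⟩
  -- The tail of a junk word is `c` after a shuffle with only k-1 decreasing letters. This is not a
  -- shuffle with k of them, so position permutations fix it.
  have hfix : ∀ x, ∀ l : List Bool, l.length = n → l.count true + 1 = k →
      shuffleHom q hab (n + 1) k x (c :: shuffle q a b l) = c :: shuffle q a b l := by
    intro x l hln hlk
    refine shuffleHom_apply_of_ne hab _ fun S hS h => ?_
    by_cases h0 : 0 ∈ S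
    · obtain ⟨l', -, -, h3⟩ := shuffle_boolList_of_mem (q := q) (a := a) (b := b) hS h0
      rw [h3, List.cons.injEq] at h
      omega
    · obtain ⟨l', h1, h2⟩ := exists_cons_eq_boolList S
      have h3 := count_boolList S
      rw [h1, decide_eq_false h0] at h h3
      rw [shuffle, List.cons.injEq] at h
      have := shuffle_injective (by omega) (by omega) h.2
      rw [List.count_cons_of_ne (by simp), ← this] at h3
      omega
  refine ⟨fun φ hφ l hl => IsPrefix.map hφ hl, fun φ hφ ψ h => mem_prefixGroup_of_eqOn hφ h,
    fun S T hS hT h => ?_, fun x => consPerm_mem (shuffleHom_mem hG hab (by omega) hpure x),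
    fun x S hS => by rw [consPerm_cons, shuffleHom_apply hab _ hS], hθ, by simp, ?_, ?_, ?_⟩
  · exact boolList_injective (shuffle_injective (by omega) (by simp) (List.cons.inj h).2)
  · intro S hS h
    obtain ⟨l, hl⟩ := shuffle_boolList_of_notMem (q := q) (a := a) (b := b) hS h
    simp only [hl]
    exact topSwap_of_ne _ hcc
  · intro x S hS h
    obtain ⟨l, h1, h2, -, h4⟩ := hmove S hS h
    rw [h4, consPerm_cons, hfix x l h1 h2]
  · have hfixed : ∀ d, ∀ S : Finset (Fin (n + 1)), S.card = k →
        IsPrefix L (n + 1 + q.length + 1) (d :: shuffle q a b (boolList S)) → d ≠ c →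
        topSwap (b - k + 1 - c).natAbs (d :: shuffle q a b (boolList S)) =
          d :: shuffle q a b (boolList S) := by
      intro d S hS hp hdc
      have := hd d S hS hp hdc
      by_cases h0 : 0 ∈ S
      · obtain ⟨l, -, -, hl⟩ := shuffle_boolList_of_mem (q := q) (a := a) (b := b) hS h0
        rw [hl]
        exact topSwap_of_ne _ this.2
      · obtain ⟨l, hl⟩ := shuffle_boolList_of_notMem (q := q) (a := a) (b := b) hS h0
        rw [hl]
        exact topSwap_of_ne _ this.1
    rintro (_ | ⟨d, m⟩) hω hoff hjunk x
    · simpa using IsPrefix.length hω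
    by_cases hm : ∃ S : Finset (Fin (n + 1)), S.card = k ∧ m = shuffle q a b (boolList S)
    · obtain ⟨S, hS, rfl⟩ := hm
      have hdc : d ≠ c := fun h => hoff S hS (by rw [h])
      have hω' := IsPrefix.map (consPerm_mem (shuffleHom_mem hG hab (by omega) hpure x)) hω
      rw [hfixed d S hS hω hdc, consPerm_cons, shuffleHom_apply hab _ hS]
      rw [consPerm_cons, shuffleHom_apply hab _ hS] at hω'
      rw [hfixed d _ (by simpa) hω' hdc]
    · rw [consPerm_cons, shuffleHom_apply_of_ne hab x fun S hS h => hm ⟨S, hS, h⟩]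
      by_cases hstable : topSwap (b - k + 1 - c).natAbs (d :: m) = d :: m
      · rw [hstable, consPerm_cons, shuffleHom_apply_of_ne hab x fun S hS h => hm ⟨S, hS, h⟩]
      rcases m with _ | ⟨e, m⟩
      · exact absurd rfl hstable
      have hde : (e - d).natAbs = (b - k + 1 - c).natAbs := by
        by_contra h
        exact hstable (topSwap_of_ne _ h)
      have hω' := IsPrefix.map hθ hω
      rw [topSwap_of_eq _ hde] at hω' ⊢
      rw [consPerm_cons, shuffleHom_apply_of_ne hab x]
      intro S hS h
      rw [h] at hω'
      -- Suppose that the exchange yields `e` after a shuffle. If `e = c`, the word was junk or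
      -- violates `hcc`; if `e ≠ c`, the exchange would fix its own result.
      by_cases hec : e = c
      · subst hec
        by_cases h0 : 0 ∈ S
        · obtain ⟨l, -, -, h3, h4⟩ := hmove S hS h0
          refine hjunk S hS h0 ?_
          rw [h4]
          rw [h3, List.cons.injEq] at h
          rw [h.1, h.2]
        · obtain ⟨l, hl⟩ := shuffle_boolList_of_notMem (q := q) (a := a) (b := b) hS h0
          rw [hl, List.cons.injEq] at h
          omega
      · have h1 := hfixed e S hS hω' hec
        rw [← h, topSwap_of_eq _ (by omega), List.cons.injEq] at h1
        omega

theorem altOn_snocClass_shuffle (hG : HasExchanges G L g) (hab : b + 2 ≤ a)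
    (hq : q = [] ∨ q = [a - 1] ∧ b = a - 2) (hk : 2 ≤ k) (hn : k + 1 ≤ n)
    (hg : n + 2 + q.length ≤ g)
    (hpure : ∀ l, IsPrefix L (n + 1 + q.length) l →
      topSwap (a - b + (n - 1 : ℕ)).natAbs l ≠ l →
      ∃ S : Finset (Fin (n + 1)), S.card = k ∧ l = shuffle q a b (boolList S))
    {c : ℤ} (hc : 2 ≤ (b - k + 1 - c).natAbs) (hcc : (a + n - k - c).natAbs ≠ (b - k + 1 - c).natAbs)
    (hd : ∀ d, ∀ S : Finset (Fin (n + 1)), S.card = k →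
      IsPrefix L (n + 1 + q.length + 1) (d :: shuffle q a b (boolList S)) → d ≠ c →
      (a + n - k - d).natAbs ≠ (b - k + 1 - c).natAbs ∧
      (b - k + 1 - d).natAbs ≠ (b - k + 1 - c).natAbs)
    {l : List Bool} (hl : l.length = n + 1) (hlk : l.count true = k) :
    AltOn (prefixGroup G L (n + 1 + q.length + 1)) (snocClass c (shuffle q a b l)) := by
  refine ((subsetControl_shuffle hG hab hg hpure hc hcc hd).altOn hk (by omega)).mono ?_
  rintro _ ⟨m, hm, rfl⟩
  obtain ⟨S, hS, rfl⟩ := exists_boolList_of_comm hq hl hlk hm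
  exact ⟨S, hS, rfl⟩

theorem act_singleton (x : Perm (Fin n)) (i : Fin n) : act x {i} = {x i} := by
  simp [act]

theorem shuffleHom_cyc (hab : b + 2 ≤ a) {i j l : Fin n} (hij : i ≠ j) (hjl : j ≠ l) (hil : i ≠ l) :
    shuffleHom q hab n 1 (cyc i j l) = cyc (shuffle q a b (boolList {i}))
      (shuffle q a b (boolList {j})) (shuffle q a b (boolList {l})) := by
  have hinj : ∀ {i j : Fin n}, shuffle q a b (boolList {i}) = shuffle q a b (boolList {j}) ↔
      i = j := by
    intro i j
    refine ⟨fun h => ?_, fun h => h ▸ rfl⟩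
    simpa using boolList_injective (shuffle_injective (by omega) (by simp) h)
  ext1 w
  by_cases hw : ∃ S : Finset (Fin n), S.card = 1 ∧ w = shuffle q a b (boolList S)
  · obtain ⟨S, hS, rfl⟩ := hw
    rw [shuffleHom_apply hab _ hS]
    obtain ⟨z, rfl⟩ := Finset.card_eq_one.1 hS
    rw [act_singleton]
    by_cases hzi : z = i
    · rw [hzi, cyc_apply_fst hij hil, cyc_apply_fst (by simpa [hinj]) (by simpa [hinj])]
    by_cases hzj : z = j
    · rw [hzj, cyc_apply_snd hil hjl, cyc_apply_snd (by simpa [hinj]) (by simpa [hinj])]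
    by_cases hzl : z = l
    · rw [hzl, cyc_apply_thd, cyc_apply_thd]
    rw [cyc_apply_of_ne hzi hzj hzl, cyc_apply_of_ne] <;> simpa [hinj]
  · push Not at hw
    rw [shuffleHom_apply_of_ne hab _ hw, cyc_apply_of_ne] <;> exact hw _ (by simp)

theorem comm_shuffle (hab : b + 2 ≤ a) {l l' : List Bool} (h : l.Perm l') :
    Comm (shuffle q a b l) (shuffle q a b l') := by
  induction h with
  | nil => exact .refl _
  | @cons x l l' h ih =>
    cases x <;> rw [shuffle, shuffle, h.count_eq] <;> exact ih.cons _
  | swap x y l =>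
    cases x <;> cases y <;> simp only [shuffle]
    · exact .refl _
    · simp only [List.count_cons_of_ne (show true ≠ false by simp),
        List.count_cons_of_ne (show false ≠ true by simp)]
      exact (Step.swap _ _ _ (by omega)).comm
    · simp only [List.count_cons_of_ne (show true ≠ false by simp),
        List.count_cons_of_ne (show false ≠ true by simp)]
      exact (Step.swap _ _ _ (by omega)).comm
    · exact .refl _
  | trans _ _ h1 h2 => exact h1.trans h2

theorem comm_shuffle_boolList (hab : b + 2 ≤ a) {l : List Bool} (hl : l.length = n)
    {S : Finset (Fin n)} (hS : l.count true = S.card) :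
    Comm (shuffle q a b l) (shuffle q a b (boolList S)) := by
  refine comm_shuffle hab (List.perm_iff_count.2 fun x => ?_)
  have h1 := List.count_false_add_count_true l
  have h2 := List.count_false_add_count_true (boolList S)
  rw [length_boolList] at h2
  have h3 := count_boolList S
  cases x <;> omega

/-- With a single decreasing letter, permutations of positions are permutations of shuffles, so all
three-cycles are already there; the last letter of the increasing word separates `c`. -/
theorem altOn_snocClass_shuffle_one (hG : HasExchanges G L g) (hab : b + 2 ≤ a)
    (hq : q = [] ∨ q = [a - 1] ∧ b = a - 2) (hn : 4 ≤ n) (hg : n + 2 + q.length ≤ g)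
    (hpure : ∀ l, IsPrefix L (n + 1 + q.length) l →
      topSwap (a - b + (n - 1 : ℕ)).natAbs l ≠ l →
      ∃ S : Finset (Fin (n + 1)), S.card = 1 ∧ l = shuffle q a b (boolList S))
    {c : ℤ} (hc : 2 ≤ (a + n - 1 - c).natAbs)
    (hd : ∀ d, ∀ S : Finset (Fin (n + 1)), S.card = 1 →
      IsPrefix L (n + 1 + q.length + 1) (d :: shuffle q a b (boolList S)) → d ≠ c →
      (a + n - 1 - d).natAbs ≠ (a + n - 1 - c).natAbs)
    {l : List Bool} (hl : l.length = n + 1) (hlk : l.count true = 1) :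
    AltOn (prefixGroup G L (n + 1 + q.length + 1)) (snocClass c (shuffle q a b l)) := by
  have hlen : (shuffle q a b l).length = n + 1 + q.length := by rw [length_shuffle, hl]
  have hcomm : ∀ i : Fin (n + 1), Comm (shuffle q a b l) (shuffle q a b (boolList {i})) := by
    exact fun i => comm_shuffle_boolList hab hl (by rw [hlk, Finset.card_singleton])
  have halt : AltOn (prefixGroup G L (n + 1 + q.length)) {m | Comm (shuffle q a b l) m} := by
    rintro u hu v hv w hw huv hvw huw
    obtain ⟨S, hS, rfl⟩ := exists_boolList_of_comm hq hl hlk hu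
    obtain ⟨T, hT, rfl⟩ := exists_boolList_of_comm hq hl hlk hv
    obtain ⟨U, hU, rfl⟩ := exists_boolList_of_comm hq hl hlk hw
    obtain ⟨x, rfl⟩ := Finset.card_eq_one.1 hS
    obtain ⟨y, rfl⟩ := Finset.card_eq_one.1 hT
    obtain ⟨z, rfl⟩ := Finset.card_eq_one.1 hU
    rw [← shuffleHom_cyc hab (fun h => huv (by rw [h])) (fun h => hvw (by rw [h]))
      (fun h => huw (by rw [h]))]
    exact shuffleHom_mem hG hab (by omega) hpure _
  have hhead : ∀ i : Fin (n + 1), i ≠ 0 → ∃ w, shuffle q a b (boolList {i}) = (a + n - 1) :: w :=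
    fun i hi => by
      obtain ⟨w, hw⟩ := shuffle_boolList_of_notMem (q := q) (a := a) (b := b)
        (Finset.card_singleton i) (by simpa using Ne.symm hi)
      exact ⟨_, hw⟩
  have hne : ∀ {i j : Fin (n + 1)}, i ≠ j →
      shuffle q a b (boolList {i}) ≠ shuffle q a b (boolList {j}) := by
    intro i j hij h
    exact hij (by simpa using boolList_injective (shuffle_injective (by omega) (by simp) h))
  obtain ⟨A, hA⟩ := hhead ⟨1, by omega⟩ (by simp [Fin.ext_iff])
  obtain ⟨B, hB⟩ := hhead ⟨2, by omega⟩ (by simp [Fin.ext_iff])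
  obtain ⟨C, hC⟩ := hhead ⟨3, by omega⟩ (by simp [Fin.ext_iff])
  have h12 := hne (i := ⟨1, by omega⟩) (j := ⟨2, by omega⟩) (by simp)
  have h23 := hne (i := ⟨2, by omega⟩) (j := ⟨3, by omega⟩) (by simp)
  have h13 := hne (i := ⟨1, by omega⟩) (j := ⟨3, by omega⟩) (by simp)
  rw [hA, hB] at h12
  rw [hB, hC] at h23
  rw [hA, hC] at h13
  have hout : ∀ i : Fin (n + 1), i.val ≠ 1 → i.val ≠ 2 → i.val ≠ 3 →
      ∀ m ∈ [A, B, C], shuffle q a b (boolList {i}) ≠ (a + n - 1) :: m := by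
    intro i h1 h2 h3 m hm
    simp only [List.mem_cons, List.not_mem_nil, or_false] at hm
    rcases hm with rfl | rfl | rfl
    · rw [← hA]; exact hne (by simpa [Fin.ext_iff] using h1)
    · rw [← hB]; exact hne (by simpa [Fin.ext_iff] using h2)
    · rw [← hC]; exact hne (by simpa [Fin.ext_iff] using h3)
  -- Positions 1, 2, 3 of the decreasing letter give the words that end in the separating letter,
  -- and positions 0 and 4 the two further words. This is where five positions are needed.
  have := separate (c := c) hG (u := shuffle q a b l) (by omega) (hlen ▸ halt)
    (hA ▸ hcomm _) (hB ▸ hcomm _) (hC ▸ hcomm _) (hcomm 0) (hcomm ⟨4, by omega⟩)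
    (fun h => h12 (by rw [h])) (fun h => h23 (by rw [h])) (fun h => h13 (by rw [h]))
    (hne (by simp [Fin.ext_iff])) (hout _ (by simp) (by simp) (by simp))
    (hout _ (by simp) (by simp) (by simp)) hc (fun d m hm hp hdc => by
      obtain ⟨S, hS, rfl⟩ := exists_boolList_of_comm hq hl hlk hm
      exact hd d S hS (hlen ▸ hp) hdc)
  rwa [hlen] at this

end ShuffleClass

/-! ### Insertion orders of boxes and their content words -/

section ValidLists

/-- The content of a box. -/
def content (b : ℕ × ℤ) : ℤ := b.2 - b.1

variable {σ : Finset (ℕ × ℤ)}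

/-- Lists of boxes, in reversed order of insertion, in which every box comes after the boxes of `σ`
to its upper left. -/
def Valid (σ : Finset (ℕ × ℤ)) : List (ℕ × ℤ) → Prop
  | [] => True
  | b :: l => Valid σ l ∧ b ∈ σ ∧ b ∉ l ∧ ∀ b' ∈ σ, b' < b → b' ∈ l

namespace Valid

theorem mem_shape {l : List (ℕ × ℤ)} (h : Valid σ l) {b : ℕ × ℤ} (hb : b ∈ l) : b ∈ σ := by
  induction l with
  | nil => simp at hb
  | cons x l ih =>
    rcases List.mem_cons.1 hb with rfl | hb
    · exact h.2.1
    · exact ih h.1 hb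

theorem nodup {l : List (ℕ × ℤ)} (h : Valid σ l) : l.Nodup := by
  induction l with
  | nil => simp
  | cons x l ih => exact List.nodup_cons.2 ⟨h.2.2.1, ih h.1⟩

theorem mem_of_lt {l : List (ℕ × ℤ)} (h : Valid σ l) {b b' : ℕ × ℤ} (hb : b ∈ l) (hb' : b' ∈ σ)
    (hlt : b' < b) : b' ∈ l := by
  induction l with
  | nil => simp at hb
  | cons x l ih =>
    rcases List.mem_cons.1 hb with rfl | hb
    · exact List.mem_cons_of_mem _ (h.2.2.2 b' hb' hlt)
    · exact List.mem_cons_of_mem _ (ih h.1 hb)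

theorem of_append {A B : List (ℕ × ℤ)} (h : Valid σ (A ++ B)) : Valid σ B := by
  induction A with
  | nil => exact h
  | cons x A ih => exact ih h.1

theorem remove {A B : List (ℕ × ℤ)} {x : ℕ × ℤ} (h : Valid σ (A ++ x :: B))
    (hx : ∀ y ∈ A, ¬ x < y) : Valid σ (A ++ B) := by
  induction A with
  | nil => exact h.1
  | cons y A ih =>
    obtain ⟨h1, h2, h3, h4⟩ := h
    refine ⟨ih h1 fun z hz => hx z (List.mem_cons_of_mem _ hz), h2, ?_, fun b' hb' hlt => ?_⟩
    · change y ∉ A ++ x :: B at h3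
      change y ∉ A ++ B
      simp only [List.mem_append, List.mem_cons, not_or] at h3 ⊢
      exact ⟨h3.1, h3.2.2⟩
    · have : b' ∈ A ++ x :: B := h4 b' hb' hlt
      change b' ∈ A ++ B
      simp only [List.mem_append, List.mem_cons] at this ⊢
      rcases this with h | rfl | h
      · exact Or.inl h
      · exact absurd hlt (hx y List.mem_cons_self)
      · exact Or.inr h

/-- The union of two valid lists. -/
theorem union {l l₀ : List (ℕ × ℤ)} (h : Valid σ l) (h₀ : Valid σ l₀) :
    Valid σ (l.filter (· ∉ l₀) ++ l₀) := by
  induction l with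
  | nil => exact h₀
  | cons b l ih =>
    by_cases hb : b ∈ l₀
    · rw [List.filter_cons_of_neg (by simpa using hb)]
      exact ih h.1
    · rw [List.filter_cons_of_pos (by simpa using hb)]
      refine ⟨ih h.1, h.2.1, ?_, fun b' hb' hlt => ?_⟩
      · simp [hb, h.2.2.1]
      · have := h.2.2.2 b' hb' hlt
        by_cases h' : b' ∈ l₀ <;> simp [this, h']

end Valid

/-- Of two incomparable boxes one lies strictly above and strictly to the right of the other, so
both coordinates contribute to the difference of contents. -/
theorem two_le_natAbs_content {x y : ℕ × ℤ} (h : ¬ x < y) (h' : ¬ y < x) (hne : x ≠ y) :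
    2 ≤ (content x - content y).natAbs := by
  rw [Prod.lt_iff] at h h'
  have : ¬ (x.1 = y.1 ∧ x.2 = y.2) := fun h => hne (Prod.ext h.1 h.2)
  simp only [content]
  omega

theorem Valid.comm_moveTop {A B : List (ℕ × ℤ)} {x : ℕ × ℤ} (h : Valid σ (A ++ x :: B))
    (hx : ∀ y ∈ A, ¬ x < y) :
    Comm ((A ++ x :: B).map content) (content x :: (A ++ B).map content) := by
  simp only [List.map_append, List.map_cons]
  refine EHMonodromy.comm_moveTop _ _ _ fun c hc => ?_
  obtain ⟨y, hy, rfl⟩ := List.mem_map.1 hc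
  have hn := h.nodup
  rw [List.nodup_append] at hn
  obtain ⟨-, -, hn⟩ := hn
  refine two_le_natAbs_content (hx y hy) (fun hlt => ?_) (hn y hy x (by simp)).symm
  have hyσ : y ∈ σ := h.mem_shape (by simp [hy])
  exact hn y hy y (List.mem_cons_of_mem _ (h.of_append.2.2.2 y hyσ hlt)) rfl

/-- Two valid lists of the same boxes differ by exchanges of letters. -/
theorem Valid.comm {l l' : List (ℕ × ℤ)} (h : Valid σ l) (h' : Valid σ l')
    (hm : ∀ b, b ∈ l ↔ b ∈ l') : Comm (l.map content) (l'.map content) := by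
  induction l generalizing l' with
  | nil =>
    obtain rfl : l' = [] := List.eq_nil_iff_forall_not_mem.2 fun b hb => by simpa using (hm b).2 hb
    exact .refl _
  | cons x l ih =>
    obtain ⟨A, B, rfl⟩ := List.append_of_mem ((hm x).1 List.mem_cons_self)
    have hmax : ∀ y ∈ A, ¬ x < y := fun y hy hlt => by
      rcases List.mem_cons.1 ((hm y).2 (by simp [hy])) with rfl | hyl
      · exact lt_irrefl _ hlt
      · exact h.2.2.1 (h.1.mem_of_lt hyl h.2.1 hlt)
    refine Comm.trans (Comm.cons _ (ih h.1 (h'.remove hmax) fun b => ?_)) (h'.comm_moveTop hmax).symm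
    have hn := h'.nodup
    rw [List.nodup_append, List.nodup_cons] at hn
    have hb := hm b
    simp only [List.mem_append, List.mem_cons] at hb ⊢
    by_cases hbx : b = x
    · subst hbx
      refine ⟨fun hh => absurd hh h.2.2.1, ?_⟩
      rintro (hh | hh)
      · exact absurd rfl (hn.2.2 b hh b List.mem_cons_self)
      · exact absurd hh hn.2.1.1
    · simpa [hbx] using hb

/-- A valid list is determined by its contents. -/
theorem Valid.ext {l l' : List (ℕ × ℤ)} (h : Valid σ l) (h' : Valid σ l')
    (hc : l.map content = l'.map content) : l = l' := by
  induction l generalizing l' with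
  | nil => exact (List.map_eq_nil_iff.1 hc.symm).symm
  | cons x l ih =>
    rcases l' with _ | ⟨y, l'⟩
    · simp at hc
    simp only [List.map_cons, List.cons.injEq] at hc
    obtain rfl := ih h.1 h'.1 hc.2
    congr 1
    -- Two boxes that can be added to the same list are incomparable, so equal contents force them
    -- to be equal.
    have h1 : ¬ x < y := fun hlt => h.2.2.1 (h'.2.2.2 x h.2.1 hlt)
    have h2 : ¬ y < x := fun hlt => h'.2.2.1 (h.2.2.2 y h'.2.1 hlt)
    by_contra hne
    have := two_le_natAbs_content h1 h2 hne
    omega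

theorem Valid.exists_comm_cons {l : List (ℕ × ℤ)} (h : Valid σ l) {b : ℕ × ℤ} (hb : b ∈ l)
    (hmax : ∀ y ∈ l, ¬ b < y) : ∃ v, Comm (l.map content) (content b :: v) := by
  obtain ⟨A, B, rfl⟩ := List.append_of_mem hb
  exact ⟨_, h.comm_moveTop fun y hy => hmax y (by simp [hy])⟩

theorem exists_valid (D : Finset (ℕ × ℤ)) (hD : D ⊆ σ) (hlow : ∀ b ∈ D, ∀ b' ∈ σ, b' < b → b' ∈ D) :
    ∃ l, Valid σ l ∧ ∀ b, b ∈ l ↔ b ∈ D := by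
  induction D using Finset.strongInduction with
  | H D ih =>
    rcases D.eq_empty_or_nonempty with rfl | hne
    · exact ⟨[], trivial, by simp⟩
    obtain ⟨x, hx⟩ := D.exists_maximal hne
    obtain ⟨l, hl, hmem⟩ := ih (D.erase x) (Finset.erase_ssubset hx.prop)
      ((Finset.erase_subset _ _).trans hD) fun b hb b' hb' hlt => by
        rw [Finset.mem_erase] at hb ⊢
        refine ⟨?_, hlow b hb.2 b' hb' hlt⟩
        rintro rfl
        exact hx.not_gt hb.2 hlt
    refine ⟨x :: l, ⟨hl, hD hx.prop, by simp [hmem], fun b' hb' hlt => ?_⟩, fun b => ?_⟩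
    · rw [hmem, Finset.mem_erase]
      exact ⟨hlt.ne, hlow x hx.prop b' hb' hlt⟩
    · rw [List.mem_cons, hmem, Finset.mem_erase]
      by_cases hbx : b = x
      · simp [hbx, hx.prop]
      · simp [hbx]

end ValidLists

/-! ### Families of tableaux as families of words -/

section Tableaux

variable {X : Type*} {σ : Finset (ℕ × ℤ)} {g : ℕ}

/-- The elements of `X` are numberings of the boxes of `σ` by `0, …, g - 1`, and `box` describes the
inverse maps. -/
structure IsTableauFamily (box : X → ℕ → ℕ × ℤ) (σ : Finset (ℕ × ℤ)) (g : ℕ) : Prop where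
  valid : ∀ x, Valid σ (prefixWord (box x) g)
  mem : ∀ x, ∀ b ∈ σ, b ∈ prefixWord (box x) g
  inj : ∀ x y, (∀ i < g, box x i = box y i) → x = y

/-- The contents of the boxes. -/
def letters (box : X → ℕ → ℕ × ℤ) (x : X) (i : ℕ) : ℤ := content (box x i)

theorem prefixWord_letters (box : X → ℕ → ℕ × ℤ) (x : X) (k : ℕ) :
    prefixWord (letters box x) k = (prefixWord (box x) k).map content := by
  induction k with
  | zero => rfl
  | succ k ih => simp [prefixWord, ih, letters]

theorem prefixWord_inj {α : Type*} {f f' : ℕ → α} {k : ℕ} (h : prefixWord f k = prefixWord f' k) :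
    ∀ i < k, f i = f' i := by
  induction k with
  | zero => simp
  | succ k ih =>
    intro i hi
    rw [prefixWord, prefixWord, List.cons.injEq] at h
    rcases Nat.lt_succ_iff_lt_or_eq.1 hi with hi | rfl
    · exact ih h.2 i hi
    · exact h.1

namespace IsTableauFamily

variable {box : X → ℕ → ℕ × ℤ} {G : Subgroup (Perm X)}

theorem valid_prefix (hB : IsTableauFamily box σ g) (x : X) {k : ℕ} (hk : k ≤ g) :
    Valid σ (prefixWord (box x) k) := by
  obtain ⟨j, rfl⟩ := Nat.exists_eq_add_of_le hk
  have h := hB.valid x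
  clear hB hk
  induction j with
  | zero => exact h
  | succ j ih => exact ih h.1

theorem exists_valid (hB : IsTableauFamily box σ g) {k : ℕ} (hk : k ≤ g) {m : List ℤ}
    (hm : IsPrefix (letters box) k m) : ∃ l, Valid σ l ∧ l.map content = m := by
  obtain ⟨x, rfl⟩ := hm
  exact ⟨_, hB.valid_prefix x hk, (prefixWord_letters _ _ _).symm⟩

/-- The letters that can follow the boxes of `l` belong to addable boxes. -/
theorem exists_addable (hB : IsTableauFamily box σ g) (hG : HasExchanges G (letters box) g)
    {l : List (ℕ × ℤ)} (hl : Valid σ l) (hlg : l.length + 1 ≤ g) {m : List ℤ}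
    (hm : Comm (l.map content) m) {d : ℤ}
    (hd : IsPrefix (letters box) (l.length + 1) (d :: m)) : ∃ b, Valid σ (b :: l) ∧ content b = d := by
  obtain ⟨l', h1, h2⟩ := hB.exists_valid hlg (hd.comm_tail hG hm.symm (by omega))
  rcases l' with _ | ⟨b, l'⟩
  · simp at h2
  rw [List.map_cons, List.cons.injEq] at h2
  obtain rfl := h1.1.ext hl h2.2
  exact ⟨b, h1, h2.1⟩

/-- At full length a tableau is determined by its word and all words form one class. A group element
that induces a three-cycle of words is therefore the corresponding three-cycle of tableaux. -/
theorem altOn_univ [DecidableEq X] (hB : IsTableauFamily box σ g) {l : List (ℕ × ℤ)} (hl : Valid σ l)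
    (hmem : ∀ b ∈ σ, b ∈ l)
    (halt : AltOn (prefixGroup G (letters box) g) {m | Comm (l.map content) m}) :
    AltOn G Set.univ := by
  have hinj : ∀ x y, prefixWord (letters box x) g = prefixWord (letters box y) g → x = y := by
    intro x y h
    rw [prefixWord_letters, prefixWord_letters] at h
    exact hB.inj x y (prefixWord_inj ((hB.valid x).ext (hB.valid y) h))
  have hcomm : ∀ x, Comm (l.map content) (prefixWord (letters box x) g) := by
    intro x
    rw [prefixWord_letters]
    exact hl.comm (hB.valid x) fun b =>
      ⟨fun h => hB.mem x b (hl.mem_shape h), fun h => hmem b ((hB.valid x).mem_shape h)⟩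
  rintro x - y - z - hxy hyz hxz
  have nxy := fun h => hxy (hinj x y h)
  have nyz := fun h => hyz (hinj y z h)
  have nxz := fun h => hxz (hinj x z h)
  obtain ⟨γ, hγ, h⟩ := halt _ (hcomm x) _ (hcomm y) _ (hcomm z) nxy nyz nxz
  convert hγ
  ext1 t
  apply hinj
  rw [(h t).1]
  by_cases htx : t = x
  · rw [htx, cyc_apply_fst hxy hxz, cyc_apply_fst nxy nxz]
  by_cases hty : t = y
  · rw [hty, cyc_apply_snd hxz hyz, cyc_apply_snd nxz nyz]
  by_cases htz : t = z
  · rw [htz, cyc_apply_thd, cyc_apply_thd]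
  rw [cyc_apply_of_ne htx hty htz, cyc_apply_of_ne (fun h => htx (hinj _ _ h))
    (fun h => hty (hinj _ _ h)) fun h => htz (hinj _ _ h)]

end IsTableauFamily

end Tableaux

/-! ### The shape, and the induction step for a box of row i ≥ 1 -/

section Shape

/-- Row `i` of the shape consists of the boxes in the columns from `lft i` to `rgt i - 1`, for
`0 ≤ i ≤ r`. -/
structure IsWideShape (lft rgt : ℕ → ℤ) (r : ℕ) : Prop where
  lft_anti : Antitone lft
  rgt_anti : Antitone rgt
  two_le : 2 ≤ r
  width : lft 0 + r + 2 ≤ rgt r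
  overlap : ∀ j < r, lft (j + 1) + r + (lft 0 - lft r) < rgt j

noncomputable def shapeBoxes (lft rgt : ℕ → ℤ) (r : ℕ) : Finset (ℕ × ℤ) :=
  (Finset.range (r + 1) ×ˢ Finset.Ico (lft r) (rgt 0)).filter
    fun b => lft b.1 ≤ b.2 ∧ b.2 < rgt b.1

variable {lft rgt : ℕ → ℤ} {r : ℕ}

namespace IsWideShape

theorem mem_iff (h : IsWideShape lft rgt r) {b : ℕ × ℤ} :
    b ∈ shapeBoxes lft rgt r ↔ b.1 ≤ r ∧ lft b.1 ≤ b.2 ∧ b.2 < rgt b.1 := by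
  simp only [shapeBoxes, Finset.mem_filter, Finset.mem_product, Finset.mem_range, Finset.mem_Ico]
  have h1 := h.rgt_anti (Nat.zero_le b.1)
  constructor
  · rintro ⟨⟨h2, -, -⟩, h3, h4⟩
    exact ⟨by omega, h3, h4⟩
  · rintro ⟨h2, h3, h4⟩
    have := h.lft_anti h2
    exact ⟨⟨by omega, by omega, by omega⟩, h3, h4⟩

theorem lft_le (h : IsWideShape lft rgt r) {i : ℕ} (hi : i ≤ r) : lft r ≤ lft i ∧ lft i ≤ lft 0 :=
  ⟨h.lft_anti hi, h.lft_anti (Nat.zero_le i)⟩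

theorem rgt_le (h : IsWideShape lft rgt r) {i : ℕ} (hi : i ≤ r) : rgt r ≤ rgt i ∧ rgt i ≤ rgt 0 :=
  ⟨h.rgt_anti hi, h.rgt_anti (Nat.zero_le i)⟩

theorem le_content (h : IsWideShape lft rgt r) {b : ℕ × ℤ} (hb : b ∈ shapeBoxes lft rgt r) :
    lft r - r ≤ content b := by
  rw [h.mem_iff] at hb
  have := h.lft_le hb.1
  simp only [content]
  omega

theorem mem_corner (h : IsWideShape lft rgt r) : (r, lft r) ∈ shapeBoxes lft rgt r := by
  rw [h.mem_iff]
  have := h.width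
  have := h.lft_le le_rfl
  exact ⟨le_rfl, le_rfl, by simp only; omega⟩

/-- Puts the last two boxes of row 0 on top of the remaining boxes of row 0 and of column lft r
above row r. A box of small content added next can be moved past both of them, which produces three
different words. -/
theorem exists_rest (h : IsWideShape lft rgt r) : ∃ R, Valid (shapeBoxes lft rgt r)
    ((0, rgt 0 - 1) :: (0, rgt 0 - 2) :: R) ∧ ∀ b, b ∈ R ↔ b ∈ shapeBoxes lft rgt r ∧
      (b.1 = 0 ∧ b.2 < rgt 0 - 2 ∨ b.2 = lft r ∧ b.1 < r) := by
  have hw := h.width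
  have h2 := h.two_le
  have hr := h.rgt_le le_rfl
  have hl := h.lft_le le_rfl
  obtain ⟨R, h1, hR⟩ := exists_valid (σ := shapeBoxes lft rgt r)
    ((shapeBoxes lft rgt r).filter fun b =>
      b.1 = 0 ∧ b.2 < rgt 0 - 2 ∨ b.2 = lft r ∧ b.1 < r) (Finset.filter_subset _ _) (by
    intro b hb b' hb' hlt
    rw [Finset.mem_filter] at hb ⊢
    have hb'' := hb'
    rw [h.mem_iff] at hb''
    have := h.lft_le hb''.1
    rw [Prod.lt_iff] at hlt
    exact ⟨hb', by omega⟩)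
  refine ⟨R, ⟨⟨h1, ?_, ?_, ?_⟩, ?_, ?_, ?_⟩, fun b => by rw [hR, Finset.mem_filter]⟩
  · rw [h.mem_iff]; simp only; omega
  · rw [hR, Finset.mem_filter]; simp only; omega
  · intro b hb hlt
    rw [hR, Finset.mem_filter]
    rw [Prod.lt_iff] at hlt
    simp only at hlt
    exact ⟨hb, by omega⟩
  · rw [h.mem_iff]; simp only; omega
  · rw [List.mem_cons, hR, Finset.mem_filter, Prod.mk.injEq]; simp only; omega
  · intro b hb hlt
    rw [List.mem_cons, hR, Finset.mem_filter, Prod.ext_iff]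
    rw [Prod.lt_iff] at hlt
    simp only at hlt ⊢
    by_cases h : b.2 = rgt 0 - 2
    · left; omega
    · right; exact ⟨hb, by omega⟩

end IsWideShape

theorem Comm.swap_append {w P R : List ℤ} {x y z : ℤ} (h : Comm w (P ++ x :: y :: z :: R))
    (hxy : 2 ≤ (x - y).natAbs) (hxz : 2 ≤ (x - z).natAbs) :
    Comm w (P ++ y :: x :: z :: R) ∧ Comm w (P ++ y :: z :: x :: R) := by
  have h1 := h.trans (Comm.append_left P (Step.swap y x (z :: R) (by omega)).comm)
  exact ⟨h1, h1.trans (Comm.append_left P (Step.cons y (Step.swap z x R (by omega))).comm)⟩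

theorem Comm.hasThree {w P R : List ℤ} {x y z : ℤ} (h : Comm w (P ++ x :: y :: z :: R))
    (hxy : 2 ≤ (x - y).natAbs) (hxz : 2 ≤ (x - z).natAbs) : HasThree {m | Comm w m} := by
  obtain ⟨h1, h2⟩ := h.swap_append hxy hxz
  refine ⟨_, h, _, h1, _, h2, fun e => ?_, fun e => ?_, fun e => ?_⟩ <;>
    simp only [List.append_cancel_left_eq, List.cons.injEq] at e <;> omega

theorem HasThree.snocClass {u : List ℤ} (h : HasThree {m | Comm u m}) (c : ℤ) :
    HasThree (snocClass c u) := by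
  obtain ⟨x, hx, y, hy, z, hz, h1, h2, h3⟩ := h
  exact ⟨_, ⟨x, hx, rfl⟩, _, ⟨y, hy, rfl⟩, _, ⟨z, hz, rfl⟩, by simpa, by simpa, by simpa⟩

theorem Valid.comm_union {σ : Finset (ℕ × ℤ)} {l l₀ : List (ℕ × ℤ)} (hl : Valid σ l)
    (h₀ : Valid σ l₀) (hsub : ∀ b ∈ l₀, b ∈ l) :
    Comm (l.map content) ((l.filter (· ∉ l₀)).map content ++ l₀.map content) := by
  rw [← List.map_append]
  refine hl.comm (hl.union h₀) fun b => ?_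
  by_cases hb : b ∈ l₀
  · simp [hb, hsub b hb]
  · simp [hb]

namespace IsWideShape

/-- The corner F commutes with the last two boxes of row 0 and can be placed before, between or
after them. -/
theorem hasThree (h : IsWideShape lft rgt r) {l : List (ℕ × ℤ)}
    (hl : Valid (shapeBoxes lft rgt r) l)
    (hmem : ∀ b ∈ shapeBoxes lft rgt r, b.1 = 0 ∨ b.2 = lft r → b ∈ l) :
    HasThree {m | Comm (l.map content) m} := by
  obtain ⟨R, h1, hR⟩ := h.exists_rest
  have hw := h.width
  have h2 := h.two_le
  have hr := h.rgt_le le_rfl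
  have hl' := h.lft_le le_rfl
  have hv : Valid (shapeBoxes lft rgt r)
      ((r, lft r) :: (0, rgt 0 - 1) :: (0, rgt 0 - 2) :: R) := by
    refine ⟨h1, h.mem_corner, ?_, fun b hb hlt => ?_⟩
    · simp only [List.mem_cons, hR, Prod.mk.injEq]
      omega
    · simp only [List.mem_cons, hR]
      refine Or.inr (Or.inr ⟨hb, ?_⟩)
      rw [h.mem_iff] at hb
      have := h.lft_le hb.1
      rw [Prod.lt_iff] at hlt
      simp only at hlt
      omega
  refine (hl.comm_union hv fun b hb => hmem b (hv.mem_shape hb) ?_).hasThree (P := _)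
    (x := content (r, lft r)) ?_ ?_
  · simp only [List.mem_cons, hR] at hb
    rcases hb with rfl | rfl | rfl | hb
    · simp
    · simp
    · simp
    · omega
  · simp only [content]; omega
  · simp only [content]; omega

/-- The first column in row `i` to the right of the column `lft r`. -/
def start (lft : ℕ → ℤ) (r i : ℕ) : ℤ := max (lft i) (lft r + 1)

variable {X : Type*} {G : Subgroup (Perm X)} {box : X → ℕ → ℕ × ℤ} {g : ℕ}

/-- Row `0`, column `lft r`, the rows above row `i`, and the part of row `i` to the left of column
`c`. -/
def Stage (lft : ℕ → ℤ) (r i : ℕ) (c : ℤ) (b : ℕ × ℤ) : Prop :=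
  b.1 = 0 ∨ b.2 = lft r ∨ b.1 < i ∨ b.1 = i ∧ b.2 < c

/-- F is removable, because below row i the stage contains only column lft r. Its content is the
smallest of all, so its distance from a possible next letter determines that letter and F separates.
The three words ending in F come from moving the box (1, start) past the end of row 0; `hstart` says
that this box is present. -/
theorem altOn_snocClass_of_lt (h : IsWideShape lft rgt r)
    (hB : IsTableauFamily box (shapeBoxes lft rgt r) g) (hG : HasExchanges G (letters box) g)
    {i : ℕ} {c : ℤ} (hi : 1 ≤ i) (hir : i < r) (hc : lft r < c)
    (hstart : 1 < i ∨ start lft r 1 < c) {l : List (ℕ × ℤ)} (hl : Valid (shapeBoxes lft rgt r) l)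
    (hmem : ∀ b, b ∈ l ↔ b ∈ shapeBoxes lft rgt r ∧ Stage lft r i c b) (hlg : l.length + 1 ≤ g)
    (halt : AltOn (prefixGroup G (letters box) l.length) {m | Comm (l.map content) m}) :
    AltOn (prefixGroup G (letters box) (l.length + 1)) (snocClass (content (i, c)) (l.map content)) := by
  obtain ⟨R, h1, hR⟩ := h.exists_rest
  have hw := h.width
  have h2 := h.two_le
  have hr := h.rgt_le (i := 1) (by omega)
  have hl' := h.lft_le (i := 1) (by omega)
  have hr' := h.rgt_le le_rfl
  have hs1 : lft 1 ≤ start lft r 1 := le_max_left _ _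
  have hs2 : lft r + 1 ≤ start lft r 1 := le_max_right _ _
  have hs3 : start lft r 1 = lft 1 ∨ start lft r 1 = lft r + 1 := max_choice _ _
  have hv : Valid (shapeBoxes lft rgt r)
      ((1, start lft r 1) :: (0, rgt 0 - 1) :: (0, rgt 0 - 2) :: R) := by
    refine ⟨h1, ?_, ?_, fun b hb hlt => ?_⟩
    · rw [h.mem_iff]; simp only; omega
    · simp only [List.mem_cons, hR, Prod.mk.injEq]
      omega
    · simp only [List.mem_cons, hR]
      refine Or.inr (Or.inr ⟨hb, ?_⟩)
      rw [h.mem_iff] at hb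
      rw [Prod.lt_iff] at hlt
      simp only at hlt
      rcases Nat.eq_zero_or_pos b.1 with h0 | h0
      · omega
      · have : b.1 = 1 := by omega
        rw [this] at hb
        omega
  have hcorner : (r, lft r) ∈ l := (hmem _).2 ⟨h.mem_corner, Or.inr (Or.inl rfl)⟩
  obtain ⟨A, B, rfl⟩ := List.append_of_mem hcorner
  have hmax : ∀ y ∈ A, ¬ (r, lft r) < y := by
    intro y hy hlt
    have hyl := (hmem y).1 (by simp [hy])
    rw [h.mem_iff, Stage] at hyl
    rw [Prod.lt_iff] at hlt
    simp only at hlt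
    omega
  have hAB := hl.remove hmax
  have hnd := hl.nodup
  have hABmem : ∀ b, b ∈ A ++ B ↔ b ∈ A ++ (r, lft r) :: B ∧ b ≠ (r, lft r) := by
    intro b
    rw [List.nodup_append, List.nodup_cons] at hnd
    simp only [List.mem_append, List.mem_cons]
    constructor
    · rintro (hb | hb)
      · exact ⟨Or.inl hb, hnd.2.2 b hb _ List.mem_cons_self⟩
      · exact ⟨Or.inr (Or.inr hb), fun e => hnd.2.1.1 (e ▸ hb)⟩
    · tauto
  have hcomm := (hl.comm_moveTop hmax).trans (Comm.cons _ (hAB.comm_union hv fun b hb => by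
    rw [hABmem, hmem]
    refine ⟨⟨hv.mem_shape hb, ?_⟩, ?_⟩
    · simp only [List.mem_cons, hR] at hb
      rw [Stage]
      rcases hb with rfl | rfl | rfl | hb <;> (try simp only) <;> omega
    · rintro rfl
      simp only [List.mem_cons, hR, Prod.mk.injEq] at hb
      omega))
  set P := ((A ++ B).filter (· ∉ (1, start lft r 1) :: (0, rgt 0 - 1) :: (0, rgt 0 - 2) :: R)).map
    content with hP
  have hPF : ∀ x ∈ P, lft r - r + 2 ≤ x := by
    intro x hx
    obtain ⟨b, hb, rfl⟩ := List.mem_map.1 hx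
    rw [List.mem_filter, hABmem, hmem] at hb
    obtain ⟨⟨⟨hb1, hb2⟩, hb3⟩, hb4⟩ := hb
    simp only [List.mem_cons, hR, decide_eq_true_eq, not_or, not_and, hb1, true_and,
      Prod.ext_iff] at hb3 hb4
    have hb3 : ¬ (b.1 = r ∧ b.2 = lft r) := fun e => hb3 (Prod.ext e.1 e.2)
    rw [h.mem_iff] at hb1
    have := h.lft_le hb1.1
    have := h.rgt_le hb1.1
    rw [Stage] at hb2
    rcases Nat.eq_zero_or_pos b.1 with h0 | h0
    · rw [h0] at hb1
      omega
    · simp only [content]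
      omega
  clear_value P
  have eF : content (r, lft r) = lft r - r := rfl
  have e1 : content (1, start lft r 1) = start lft r 1 - 1 := rfl
  have e2 : content (0, rgt 0 - 1) = rgt 0 - 1 := by simp [content]
  have e3 : content (0, rgt 0 - 2) = rgt 0 - 2 := by simp [content]
  simp only [List.map_cons, eF, e1, e2, e3] at hcomm
  set F := lft r - (r : ℤ) with hF
  set w := (A ++ (r, lft r) :: B).map content with hw'
  have hwl : (A ++ (r, lft r) :: B).length = w.length := by simp [hw']
  rw [hwl] at halt ⊢
  obtain ⟨hB1, hC1⟩ := Comm.swap_append (P := F :: P) hcomm (by omega) (by omega)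
  -- The two words that do not end in F arise by moving F down, below `P` and (1, start), and then
  -- below the last box of row 0.
  have hD1 : Comm w (P ++ (start lft r 1 - 1) :: F :: (rgt 0 - 1) :: (rgt 0 - 2) :: R.map content) := by
    have := EHMonodromy.comm_moveTop F (P ++ [start lft r 1 - 1])
      ((rgt 0 - 1) :: (rgt 0 - 2) :: R.map content) (by
        intro y hy
        rcases List.mem_append.1 hy with hy | hy
        · have := hPF y hy; omega
        · rw [List.mem_singleton] at hy; omega)
    simp only [List.append_assoc, List.cons_append, List.nil_append] at this
    exact hcomm.trans this.symm
  have hD2 := (Comm.swap_append (P := P ++ [start lft r 1 - 1]) (by simpa using hD1) (by omega)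
    (by omega)).1
  have hhead : ∀ Q m, P ++ (start lft r 1 - 1) :: Q ≠ F :: m := by
    intro Q m e
    rcases P with _ | ⟨x, P⟩
    · simp only [List.nil_append, List.cons.injEq] at e; omega
    · have := hPF x List.mem_cons_self
      simp only [List.cons_append, List.cons.injEq] at e; omega
  rw [List.append_assoc] at hD2
  refine separate hG (by omega) halt hcomm hB1 hC1 hD1 hD2 ?_ ?_ ?_ ?_ (fun m _ => hhead _ m)
    (fun m _ => hhead _ m) (by simp only [content]; omega) ?_
  · intro e; simp at e; omega
  · intro e; simp at e; omega
  · intro e; simp at e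
  · intro e
    simp only [List.append_cancel_left_eq, List.cons.injEq, List.cons_append, List.nil_append] at e
    omega
  · intro d m hm hp hd
    rw [← hwl] at hp
    obtain ⟨b, hb, rfl⟩ := hB.exists_addable hG hl hlg hm hp
    have := h.le_content hb.2.1
    simp only [content] at hd this ⊢
    omega

/-- When row r is being filled, all boxes outside the stage lie in row r, so only its next box can
be added. -/
theorem altOn_snocClass_last (h : IsWideShape lft rgt r)
    (hB : IsTableauFamily box (shapeBoxes lft rgt r) g) (hG : HasExchanges G (letters box) g)
    {c : ℤ} (hcr : (r, c) ∈ shapeBoxes lft rgt r) {l : List (ℕ × ℤ)}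
    (hl : Valid (shapeBoxes lft rgt r) l) (hc : (r, c) ∉ l)
    (hmem : ∀ b, b ∈ l ↔ b ∈ shapeBoxes lft rgt r ∧ Stage lft r r c b) (hlg : l.length + 1 ≤ g)
    (halt : AltOn (prefixGroup G (letters box) l.length) {m | Comm (l.map content) m}) :
    AltOn (prefixGroup G (letters box) (l.length + 1)) (snocClass (content (r, c)) (l.map content)) := by
  have hwl : l.length = (l.map content).length := by simp
  rw [hwl] at halt ⊢
  refine altOn_snocClass_of_unique halt fun d m hm hp => ?_
  rw [← hwl] at hp
  obtain ⟨b, hb, rfl⟩ := hB.exists_addable hG hl hlg hm hp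
  have h1 : ¬ (r, c) < b := fun hlt => hc (hb.2.2.2 _ hcr hlt)
  have h2 := hb.2.2.1
  have h3 := hb.2.1
  rw [hmem, not_and, Stage] at h2
  have h2 := h2 h3
  rw [h.mem_iff] at h3
  rw [Prod.lt_iff] at h1
  simp only at h1
  simp only [content]
  omega

/-- Supplies `expand` with a removable box whose content is not at the given distance a ≥ 2 from
that of the new box. -/
theorem altOn_expand (h : IsWideShape lft rgt r) (hG : HasExchanges G (letters box) g)
    {i : ℕ} {c : ℤ} (hi : 1 ≤ i) (hc : lft r < c)
    {l : List (ℕ × ℤ)} (hl : Valid (shapeBoxes lft rgt r) ((i, c) :: l))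
    (hmem : ∀ b, b ∈ l ↔ b ∈ shapeBoxes lft rgt r ∧ Stage lft r i c b) (hlg : l.length + 1 ≤ g)
    (halt : AltOn (prefixGroup G (letters box) (l.length + 1))
      (snocClass (content (i, c)) (l.map content))) :
    AltOn (prefixGroup G (letters box) (l.length + 1))
      {m | Comm (((i, c) :: l).map content) m} := by
  have hwl : l.length = (l.map content).length := by simp
  have h3 := h.hasThree hl.1 fun b hb hb' => (hmem b).2 ⟨hb, hb'.elim Or.inl fun h => Or.inr (Or.inl h)⟩
  rw [hwl] at halt hlg ⊢
  refine expand hG hlg halt (h3.snocClass _) fun a ha => ?_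
  have hic := hl.2.1
  rw [h.mem_iff] at hic
  simp only at hic
  have hw := h.width
  have h2 := h.two_le
  have hr := h.rgt_le hic.1
  have hl' := h.lft_le hic.1
  have hl'' := h.lft_le le_rfl
  have head : ∀ b ∈ shapeBoxes lft rgt r, Stage lft r i c b →
      (∀ y ∈ shapeBoxes lft rgt r, Stage lft r i c y → ¬ b < y) →
      ∃ v, Comm (l.map content) (content b :: v) := fun b hb hb' hmax =>
    hl.1.exists_comm_cons ((hmem b).2 ⟨hb, hb'⟩) fun y hy =>
      hmax y ((hmem y).1 hy).1 ((hmem y).1 hy).2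
  -- The left neighbour is at distance one. It is not removable if it lies in column lft r above row
  -- r, since that column continues below it.
  by_cases hfirst : lft i ≤ c - 1 ∧ (lft r < c - 1 ∨ i = r)
  · obtain ⟨v, hv⟩ := head (i, c - 1) (by rw [h.mem_iff]; simp only; omega)
      (Or.inr (Or.inr (Or.inr ⟨rfl, sub_one_lt c⟩))) (by
        intro y hy hy' hlt
        rw [h.mem_iff] at hy
        rw [Stage] at hy'
        rw [Prod.lt_iff] at hlt
        simp only at hlt
        omega)
    exact ⟨_, v, hv, by simp only [content]; omega⟩
  have hir : i < r := by
    rcases Nat.lt_or_ge i r with h' | h'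
    · exact h'
    · obtain rfl : i = r := by omega
      omega
  obtain ⟨j, rfl⟩ : ∃ j, i = j + 1 := ⟨i - 1, by omega⟩
  have hov := h.overlap j (by omega)
  have hj : rgt (j + 1) ≤ rgt j := h.rgt_anti (Nat.le_succ j)
  have hj' := h.lft_le (i := j) (by omega)
  obtain ⟨v, hv⟩ := head (j, rgt j - 1) (by rw [h.mem_iff]; simp only; omega)
      (by rw [Stage]; simp only; omega) (by
        intro y hy hy' hlt
        rw [h.mem_iff] at hy
        rw [Stage] at hy'
        rw [Prod.lt_iff] at hlt
        simp only at hlt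
        have hy1 : y.1 = j ∨ y.1 = j + 1 ∨ y.2 = lft r := by omega
        rcases hy1 with e | e | e
        · rw [e] at hy; omega
        · rw [e] at hy; omega
        · omega)
  obtain ⟨v', hv'⟩ := head (r, lft r) h.mem_corner (Or.inr (Or.inl rfl)) (by
        intro y hy hy' hlt
        rw [h.mem_iff] at hy
        rw [Stage] at hy'
        rw [Prod.lt_iff] at hlt
        simp only at hlt
        omega)
  -- Otherwise the new box is the first one of its row to the right of column lft r. By `overlap`
  -- and `width` the end of the row above is farther from it than F, so one of the two distances
  -- differs from `a`.
  by_cases hE : (content (j, rgt j - 1) - content (j + 1, c)).natAbs = a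
  · refine ⟨_, v', hv', ?_⟩
    simp only [content] at hE ⊢
    omega
  · exact ⟨_, v, hv, hE⟩

end IsWideShape

end Shape

/-! ### Row 0 and column lft r, the first box of row 1, and the induction over all boxes -/

section InitialBoxes

/-- The list `Q`, followed by `p` boxes of row `0` starting from column `s`. -/
def rowBoxes (Q : List (ℕ × ℤ)) (s : ℤ) : ℕ → List (ℕ × ℤ)
  | 0 => Q
  | p + 1 => (0, s + p) :: rowBoxes Q s p

/-- The list `Q`, followed by `k` boxes of column `c` starting from row `j`. -/
def columnBoxes (Q : List (ℕ × ℤ)) (j : ℕ) (c : ℤ) : ℕ → List (ℕ × ℤ)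
  | 0 => Q
  | k + 1 => (j + k, c) :: columnBoxes Q j c k

theorem map_content_rowBoxes (Q : List (ℕ × ℤ)) (s b : ℤ) (p : ℕ) :
    (rowBoxes Q s p).map content = shuffle (Q.map content) s b (List.replicate p false) := by
  induction p with
  | zero => rfl
  | succ p ih => simp [rowBoxes, List.replicate_succ, shuffle, ih, content]

theorem map_content_columnBoxes {Q : List (ℕ × ℤ)} {j : ℕ} {c a : ℤ} {q : List ℤ} {l : List Bool}
    (hl : l.count true = 0) (hQ : Q.map content = shuffle q a (c - j) l) (k : ℕ) :
    (columnBoxes Q j c k).map content =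
      shuffle q a (c - j) (List.replicate k true ++ l) := by
  induction k with
  | zero => exact hQ
  | succ k ih =>
    simp only [columnBoxes, List.map_cons, ih, List.replicate_succ, List.cons_append, shuffle,
      List.count_append, List.count_replicate_self, hl, content]
    congr 1
    push_cast
    ring

namespace IsWideShape

variable {lft rgt : ℕ → ℤ} {r : ℕ}

theorem valid_rowBoxes (h : IsWideShape lft rgt r) {Q : List (ℕ × ℤ)} {s : ℤ}
    (hQ : Valid (shapeBoxes lft rgt r) Q)
    (hmem : ∀ b, b ∈ Q ↔ b ∈ shapeBoxes lft rgt r ∧ b.1 = 0 ∧ b.2 < s) (hs : lft 0 ≤ s)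
    {p : ℕ} (hp : s + p ≤ rgt 0) : Valid (shapeBoxes lft rgt r) (rowBoxes Q s p) ∧
      ∀ b, b ∈ rowBoxes Q s p ↔ b ∈ shapeBoxes lft rgt r ∧ b.1 = 0 ∧ b.2 < s + p := by
  induction p with
  | zero => exact ⟨hQ, fun b => by rw [rowBoxes, hmem]; simp⟩
  | succ p ih =>
    obtain ⟨h1, h2⟩ := ih (by push_cast at hp; omega)
    have hb : (0, s + (p : ℤ)) ∈ shapeBoxes lft rgt r := by
      rw [h.mem_iff]; simp only; push_cast at hp; omega
    refine ⟨⟨h1, hb, by simp [h2], fun b hb' hlt => ?_⟩, fun b => ?_⟩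
    · rw [h2]
      rw [Prod.lt_iff] at hlt
      simp only at hlt
      exact ⟨hb', by omega⟩
    · rw [rowBoxes, List.mem_cons, h2]
      push_cast
      constructor
      · rintro (rfl | hh)
        · exact ⟨hb, rfl, by simp only; omega⟩
        · exact ⟨hh.1, hh.2.1, by omega⟩
      · rintro ⟨h3, h4, h5⟩
        by_cases h6 : b.2 = s + p
        · exact Or.inl (Prod.ext h4 h6)
        · exact Or.inr ⟨h3, h4, by omega⟩

theorem valid_columnBoxes (h : IsWideShape lft rgt r) {Q : List (ℕ × ℤ)} {j : ℕ}
    (hQ : Valid (shapeBoxes lft rgt r) Q)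
    (hmem : ∀ b, b ∈ Q ↔ b ∈ shapeBoxes lft rgt r ∧ (b.1 = 0 ∨ b.2 = lft r ∧ b.1 < j)) (hj : 1 ≤ j)
    (hjr : ∀ i ≤ r, j ≤ i → lft i = lft r) {k : ℕ} (hk : j + k ≤ r + 1) :
    Valid (shapeBoxes lft rgt r) (columnBoxes Q j (lft r) k) ∧
      ∀ b, b ∈ columnBoxes Q j (lft r) k ↔
        b ∈ shapeBoxes lft rgt r ∧ (b.1 = 0 ∨ b.2 = lft r ∧ b.1 < j + k) := by
  induction k with
  | zero => exact ⟨hQ, hmem⟩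
  | succ k ih =>
    obtain ⟨h1, h2⟩ := ih (by omega)
    have hjk := hjr (j + k) (by omega) (by omega)
    have hw := h.width
    have h3 := h.lft_le (i := j + k) (by omega)
    have h4 := h.rgt_le (i := j + k) (by omega)
    have hb : (j + k, lft r) ∈ shapeBoxes lft rgt r := by
      rw [h.mem_iff]; simp only; omega
    refine ⟨⟨h1, hb, ?_, fun b hb' hlt => ?_⟩, fun b => ?_⟩
    · rw [h2]; simp only; omega
    · rw [h2]
      have hb'' := hb'
      rw [h.mem_iff] at hb'
      have := h.lft_le hb'.1
      rw [Prod.lt_iff] at hlt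
      simp only at hlt
      exact ⟨hb'', by omega⟩
    · rw [columnBoxes, List.mem_cons, h2]
      constructor
      · rintro (rfl | hh)
        · exact ⟨hb, Or.inr ⟨rfl, by simp only; omega⟩⟩
        · exact ⟨hh.1, by omega⟩
      · rintro ⟨h3, h4⟩
        by_cases h6 : b.1 = j + k ∧ b.2 = lft r
        · exact Or.inl (Prod.ext h6.1 h6.2)
        · exact Or.inr ⟨h3, by omega⟩

/-- The boxes of row `0` and of column `lft r` in an order in which the letters form a shuffle. -/
theorem exists_initial (h : IsWideShape lft rgt r) :
    ∃ l q a b n k, ∃ w : List Bool, Valid (shapeBoxes lft rgt r) l ∧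
      (∀ x, x ∈ l ↔ x ∈ shapeBoxes lft rgt r ∧ (x.1 = 0 ∨ x.2 = lft r)) ∧
      l.map content = shuffle q a b w ∧ w.length = n + 1 ∧ w.count true = k ∧
      (q = [] ∨ q = [a - 1] ∧ b = a - 2) ∧ b + 2 ≤ a ∧ 1 ≤ k ∧ k + 1 ≤ n ∧ (k = 1 → 4 ≤ n) ∧
      b - k + 1 = lft r - r ∧ a + n - k = rgt 0 - 1 := by
  have hw := h.width
  have hr2 := h.two_le
  have hl := h.lft_le le_rfl
  have hr := h.rgt_le le_rfl
  -- If row 0 starts in column lft r, the corner shared by the row and the column comes first and is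
  -- kept apart as `Q`; the free part of the row then starts one column later.
  obtain ⟨Q, s, hQ, hQmem, hs, hs', hQc⟩ : ∃ (Q : List (ℕ × ℤ)) (s : ℤ),
      Valid (shapeBoxes lft rgt r) Q ∧
      (∀ b, b ∈ Q ↔ b ∈ shapeBoxes lft rgt r ∧ b.1 = 0 ∧ b.2 < s) ∧ lft 0 ≤ s ∧ s ≤ lft 0 + 1 ∧
      (lft r < lft 0 ∧ s = lft 0 ∧ Q.map content = [] ∨
        lft r = lft 0 ∧ s = lft 0 + 1 ∧ Q.map content = [s - 1]) := by
    rcases hl.2.lt_or_eq with h0 | h0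
    · refine ⟨[], lft 0, trivial, fun b => ?_, le_rfl, by omega, Or.inl ⟨h0, rfl, rfl⟩⟩
      simp only [List.not_mem_nil, false_iff, h.mem_iff]
      rintro ⟨hb, h1, h2⟩
      rw [h1] at hb
      omega
    · have hb : (0, lft 0) ∈ shapeBoxes lft rgt r := by
        rw [h.mem_iff]; simp only; omega
      refine ⟨[(0, lft 0)], lft 0 + 1, ⟨trivial, hb, by simp, fun b hb' hlt => ?_⟩, fun b => ?_,
        by omega, le_rfl, Or.inr ⟨h0, rfl, by simp [content]⟩⟩
      · exfalso
        rw [h.mem_iff] at hb'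
        rw [Prod.lt_iff] at hlt
        simp only at hlt
        have : b.1 = 0 := by omega
        rw [this] at hb'
        omega
      · rw [List.mem_singleton]
        constructor
        · rintro rfl
          exact ⟨hb, rfl, by simp⟩
        · rintro ⟨h1, h2, h3⟩
          rw [h.mem_iff, h2] at h1
          exact Prod.ext h2 (by simp only; omega)
  have hex : ∃ i, 1 ≤ i ∧ lft i = lft r := ⟨r, by omega, rfl⟩
  -- Apart from a possible corner in row 0, column lft r occupies the rows j, …, r.
  obtain ⟨j, hj1, hj2, hj3⟩ : ∃ j, 1 ≤ j ∧ lft j = lft r ∧ ∀ i, 1 ≤ i → lft i = lft r → j ≤ i := by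
    classical
    exact ⟨Nat.find hex, (Nat.find_spec hex).1, (Nat.find_spec hex).2,
      fun i h1 h2 => Nat.find_min' hex ⟨h1, h2⟩⟩
  have hjr := hj3 r (by omega) rfl
  obtain ⟨p, hp⟩ : ∃ p : ℕ, s + p = rgt 0 := ⟨(rgt 0 - s).toNat, by omega⟩
  obtain ⟨k, hk⟩ : ∃ k, j + k = r + 1 := ⟨r + 1 - j, by omega⟩
  obtain ⟨h1, h2⟩ := h.valid_rowBoxes hQ hQmem hs hp.le
  obtain ⟨h3, h4⟩ := h.valid_columnBoxes h1 (j := j) (fun b => by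
    rw [h2, hp]
    refine and_congr_right fun hb => ?_
    rw [h.mem_iff] at hb
    have := h.rgt_le hb.1
    have := h.lft_le hb.1
    have := hj3 b.1
    omega) hj1 (fun i hi hji => le_antisymm (hj2 ▸ h.lft_anti hji) (h.lft_anti hi)) hk.le
  -- There are p letters of the row and k of the column, so n + 1 = p + k.
  refine ⟨_, Q.map content, s, lft r - j, p + k - 1, k, _, h3, fun x => ?_,
    map_content_columnBoxes (l := List.replicate p false) (by simp [List.count_replicate])
      (map_content_rowBoxes _ _ _ _) k, ?_, ?_, ?_, ?_, ?_, ?_, ?_, ?_, ?_⟩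
  · rw [h4]
    refine and_congr_right fun hb => ?_
    rw [h.mem_iff] at hb
    omega
  · simp; omega
  · simp [List.count_replicate]
  · rcases hQc with ⟨-, -, e⟩ | ⟨h0, h5, e⟩
    · exact Or.inl e
    · refine Or.inr ⟨e, ?_⟩
      have h6 := h.lft_le (i := 1) (by omega)
      have := hj3 1 le_rfl (by omega)
      have : j = 1 := by omega
      rw [this]; push_cast; omega
  · rcases hQc with ⟨h0, h5, -⟩ | ⟨h0, h5, -⟩ <;> omega
  · omega
  · omega
  -- A single column letter means j = r ≥ 2, which excludes the corner; then n = p = rgt 0 - lft 0 ≥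
  -- r + 2 ≥ 4.
  · intro hk1
    rcases hQc with ⟨h0, h5, -⟩ | ⟨h0, h5, -⟩
    · omega
    · have h6 := h.lft_le (i := 1) (by omega)
      have := hj3 1 le_rfl (by omega)
      omega
  · omega
  · omega

variable {X : Type*} {G : Subgroup (Perm X)} {box : X → ℕ → ℕ × ℤ} {g : ℕ}

/-- A list in which two boxes with extreme contents come last. -/
theorem comm_of_topSwap_ne (h : IsWideShape lft rgt r) {l l' : List (ℕ × ℤ)}
    (hl : Valid (shapeBoxes lft rgt r) l)
    (hmem : ∀ x, x ∈ l ↔ x ∈ shapeBoxes lft rgt r ∧ (x.1 = 0 ∨ x.2 = lft r))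
    (hl' : Valid (shapeBoxes lft rgt r) l') (hlen : l'.length = l.length)
    (hne : topSwap (rgt 0 - 1 - (lft r - r)).natAbs (l'.map content) ≠ l'.map content) :
    Comm (l.map content) (l'.map content) := by
  rcases l' with _ | ⟨y, _ | ⟨x, l'⟩⟩
  · exact absurd rfl hne
  · exact absurd rfl hne
  have hxy : (content x - content y).natAbs = (rgt 0 - 1 - (lft r - r)).natAbs := by
    by_contra hcon
    exact hne (topSwap_of_ne _ hcon)
  have hw := h.width
  have hr := h.rgt_le le_rfl
  have hl0 := h.lft_le le_rfl
  -- The smallest and the largest content are each attained in one box only, so this exchange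
  -- distance identifies both boxes.
  have key : ∀ b ∈ shapeBoxes lft rgt r, lft r - r ≤ content b ∧ content b ≤ rgt 0 - 1 ∧
      (content b = lft r - r → b = (r, lft r)) ∧
      (content b = rgt 0 - 1 → b = (0, rgt 0 - 1)) := by
    intro b hb
    rw [h.mem_iff] at hb
    have h1 := h.lft_le hb.1
    have h2 := h.rgt_le hb.1
    simp only [content, Prod.ext_iff]
    omega
  obtain ⟨x1, x2, x3, x4⟩ := key x hl'.1.2.1
  obtain ⟨y1, y2, y3, y4⟩ := key y hl'.2.1
  have hboth : (r, lft r) ∈ y :: x :: l' ∧ (0, rgt 0 - 1) ∈ y :: x :: l' := by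
    by_cases hx : content x = lft r - r
    · exact ⟨by simp [x3 hx], by simp [y4 (by omega)]⟩
    · exact ⟨by simp [y3 (by omega)], by simp [x4 (by omega)]⟩
  -- With the two extreme boxes, everything before them is present: all of row 0 and all of column
  -- lft r. Equality of lengths excludes further boxes.
  have hsub : l ⊆ y :: x :: l' := by
    intro b hb
    obtain ⟨hb1, hb2⟩ := (hmem b).1 hb
    have hb3 := hb1
    rw [h.mem_iff] at hb3
    rcases hb2 with h0 | h0
    · by_cases hE : b = (0, rgt 0 - 1)
      · exact hE ▸ hboth.2
      · refine hl'.mem_of_lt hboth.2 hb1 (lt_of_le_of_ne ⟨by simp [h0], ?_⟩ hE)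
        rw [h0] at hb3
        simp only; omega
    · by_cases hF : b = (r, lft r)
      · exact hF ▸ hboth.1
      · exact hl'.mem_of_lt hboth.1 hb1 (lt_of_le_of_ne ⟨hb3.1, by simp [h0]⟩ hF)
  have hperm := (hl.nodup.subperm hsub).perm_of_length_le hlen.le
  exact hl.comm hl' fun b => hperm.mem_iff

/-- The position permutations on the initial boxes need not give all three-cycles there, so the
claim is made one letter later, where the new letter supplies the control. -/
theorem altOn_initial (h : IsWideShape lft rgt r)
    (hB : IsTableauFamily box (shapeBoxes lft rgt r) g) (hG : HasExchanges G (letters box) g)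
    {l : List (ℕ × ℤ)} (hl : Valid (shapeBoxes lft rgt r) l)
    (hmem : ∀ x, x ∈ l ↔ x ∈ shapeBoxes lft rgt r ∧ (x.1 = 0 ∨ x.2 = lft r))
    (hlg : l.length + 1 ≤ g) : AltOn (prefixGroup G (letters box) (l.length + 1))
      (snocClass (content (1, start lft r 1)) (l.map content)) := by
  obtain ⟨l₀, q, a, b, n, k, w, h1, h2, h3, hwn, hwk, hq, hab, hk, hkn, hk4, hF, hE⟩ :=
    h.exists_initial
  have hperm : l₀.Perm l := (List.perm_ext_iff_of_nodup h1.nodup hl.nodup).2 fun x => by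
    rw [h2, hmem]
  have hlen : l.length = n + 1 + q.length := by
    rw [← hperm.length_eq, ← List.length_map content, h3, length_shuffle, hwn]
  have hcomm : Comm (shuffle q a b w) (l.map content) :=
    h3 ▸ h1.comm hl fun x => hperm.mem_iff
  have hcomm' : snocClass (content (1, start lft r 1)) (l.map content) ⊆
      snocClass (content (1, start lft r 1)) (shuffle q a b w) := by
    rintro _ ⟨m, hm, rfl⟩
    exact ⟨m, hcomm.trans hm, rfl⟩
  refine AltOn.mono ?_ hcomm'
  have hw := h.width
  have hr2 := h.two_le
  have hov := h.overlap 0 (by omega)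
  rw [zero_add] at hov
  have hr := h.rgt_le le_rfl
  have hl0 := h.lft_le le_rfl
  have hl1 := h.lft_le (i := 1) (by omega)
  have hs1 : lft 1 ≤ start lft r 1 := le_max_left _ _
  have hs2 : lft r + 1 ≤ start lft r 1 := le_max_right _ _
  have hs3 : start lft r 1 = lft 1 ∨ start lft r 1 = lft r + 1 := max_choice _ _
  have hpure : ∀ m, IsPrefix (letters box) (n + 1 + q.length) m →
      topSwap (a - b + (n - 1 : ℕ)).natAbs m ≠ m →
      ∃ S : Finset (Fin (n + 1)), S.card = k ∧ m = shuffle q a b (boolList S) := by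
    intro m hm hne
    obtain ⟨l', hl', rfl⟩ := hB.exists_valid (by omega) hm
    have hm' := hm.length
    rw [List.length_map] at hm'
    refine exists_boolList_of_comm hq hwn hwk
      (hcomm.trans (h.comm_of_topSwap_ne hl hmem hl' (by omega) ?_))
    rwa [show rgt 0 - 1 - (lft r - r) = a - b + (n - 1 : ℕ) by omega]
  -- A box that can be added is not in row 0 and is either the first of its row or in column lft r +
  -- 1, which bounds its content by lft 1. With `overlap` in row 0 and `width`, the end of row 0 is
  -- farther from every such content than F is from the new letter.
  have hd : ∀ d, ∀ S : Finset (Fin (n + 1)), S.card = k →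
      IsPrefix (letters box) (n + 1 + q.length + 1) (d :: shuffle q a b (boolList S)) →
      lft r - r < d ∧ d ≤ lft 1 := by
    intro d S hS hp
    obtain ⟨x, hx, rfl⟩ := hB.exists_addable hG hl hlg
      (hcomm.symm.trans (comm_shuffle_boolList hab hwn (hwk.trans hS.symm))) (hlen ▸ hp)
    obtain ⟨-, hx1, hx2, hx3⟩ := hx
    rw [hmem] at hx2
    have hx4 := hx3 (x.1, x.2 - 1)
    rw [hmem] at hx4
    rw [h.mem_iff] at hx1 hx2 hx4
    simp only [Prod.lt_iff] at hx4
    have h5 := h.lft_le hx1.1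
    have h6 := h.lft_anti (a := 1) (b := x.1) (by omega)
    simp only [content]
    omega
  have hc : content (1, start lft r 1) = start lft r 1 - 1 := rfl
  rw [hc, hlen]
  rcases hk.lt_or_eq with hk2 | rfl
  · refine altOn_snocClass_shuffle hG hab hq hk2 hkn (by omega) hpure (by omega) ?_
      (fun d S hS hp hdc => ?_) hwn hwk
    · rw [hE, hF]; omega
    · have := hd d S hS hp
      rw [hE, hF]; omega
  · refine altOn_snocClass_shuffle_one hG hab hq (hk4 rfl) (by omega) hpure (by omega)
      (fun d S hS hp hdc => ?_) hwn hwk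
    have := hd d S hS hp
    omega

/-- The three-cycles of a stage. -/
def IsGood (G : Subgroup (Perm X)) (box : X → ℕ → ℕ × ℤ) (lft rgt : ℕ → ℤ) (r i : ℕ) (c : ℤ) : Prop :=
  ∃ l, Valid (shapeBoxes lft rgt r) l ∧
    (∀ b, b ∈ l ↔ b ∈ shapeBoxes lft rgt r ∧ Stage lft r i c b) ∧
    AltOn (prefixGroup G (letters box) l.length) {m | Comm (l.map content) m}

theorem length_le (hcard : (shapeBoxes lft rgt r).card = g) {l : List (ℕ × ℤ)}
    (hl : Valid (shapeBoxes lft rgt r) l) : l.length ≤ g := by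
  rw [← hcard, ← List.toFinset_card_of_nodup hl.nodup]
  exact Finset.card_le_card fun b hb => hl.mem_shape (List.mem_toFinset.1 hb)

theorem valid_cons {i : ℕ} {c : ℤ} (hic : (i, c) ∈ shapeBoxes lft rgt r)
    (hi : 1 ≤ i) (hc : lft r < c) {l : List (ℕ × ℤ)} (hl : Valid (shapeBoxes lft rgt r) l)
    (hmem : ∀ b, b ∈ l ↔ b ∈ shapeBoxes lft rgt r ∧ Stage lft r i c b) :
    Valid (shapeBoxes lft rgt r) ((i, c) :: l) ∧
      ∀ b, b ∈ (i, c) :: l ↔ b ∈ shapeBoxes lft rgt r ∧ Stage lft r i (c + 1) b := by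
  refine ⟨⟨hl, hic, ?_, fun b hb hlt => ?_⟩, fun b => ?_⟩
  · rw [hmem, Stage]; simp only; omega
  · rw [hmem, Stage]
    rw [Prod.lt_iff] at hlt
    simp only at hlt
    exact ⟨hb, by omega⟩
  · rw [List.mem_cons, hmem, Stage, Stage]
    constructor
    · rintro (rfl | hh)
      · exact ⟨hic, Or.inr (Or.inr (Or.inr ⟨rfl, by simp⟩))⟩
      · exact ⟨hh.1, by omega⟩
    · rintro ⟨h1, h2⟩
      by_cases h3 : b.1 = i ∧ b.2 = c
      · exact Or.inl (Prod.ext h3.1 h3.2)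
      · exact Or.inr ⟨h1, by omega⟩

theorem isGood_congr {i j : ℕ} {c d : ℤ} (h : IsGood G box lft rgt r i c)
    (hcd : ∀ b ∈ shapeBoxes lft rgt r, Stage lft r i c b ↔ Stage lft r j d b) :
    IsGood G box lft rgt r j d := by
  obtain ⟨l, h1, h2, h3⟩ := h
  exact ⟨l, h1, fun b => (h2 b).trans (and_congr_right fun hb => hcd b hb), h3⟩

theorem isGood_start (h : IsWideShape lft rgt r) (hcard : (shapeBoxes lft rgt r).card = g)
    (hB : IsTableauFamily box (shapeBoxes lft rgt r) g) (hG : HasExchanges G (letters box) g) :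
    IsGood G box lft rgt r 1 (start lft r 1 + 1) := by
  have hw := h.width
  have hr2 := h.two_le
  have hl0 := h.lft_le le_rfl
  have hl1 := h.lft_le (i := 1) (by omega)
  have hr1 := h.rgt_le (i := 1) (by omega)
  have hs1 : lft 1 ≤ start lft r 1 := le_max_left _ _
  have hs2 : lft r + 1 ≤ start lft r 1 := le_max_right _ _
  have hs3 : start lft r 1 = lft 1 ∨ start lft r 1 = lft r + 1 := max_choice _ _
  obtain ⟨l, -, -, -, -, -, -, hl, hmem, -⟩ := h.exists_initial
  have hmem' : ∀ b, b ∈ l ↔ b ∈ shapeBoxes lft rgt r ∧ Stage lft r 1 (start lft r 1) b := by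
    intro b
    rw [hmem]
    refine and_congr_right fun hb => ?_
    rw [Stage]
    refine ⟨fun hh => by tauto, ?_⟩
    rintro (hh | hh | hh | ⟨hh, hh'⟩)
    · exact Or.inl hh
    · exact Or.inr hh
    · exact Or.inl (by omega)
    · rw [h.mem_iff, hh] at hb
      exact Or.inr (by omega)
  have hic : (1, start lft r 1) ∈ shapeBoxes lft rgt r := by
    rw [h.mem_iff]; simp only; omega
  obtain ⟨hv, hvm⟩ := valid_cons hic le_rfl (by omega) hl hmem'
  have hlg : l.length + 1 ≤ g := length_le hcard hv
  exact ⟨_, hv, hvm, h.altOn_expand hG le_rfl (by omega) hv hmem' hlg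
    (h.altOn_initial hB hG hl hmem hlg)⟩

theorem isGood_succ (h : IsWideShape lft rgt r) (hcard : (shapeBoxes lft rgt r).card = g)
    (hB : IsTableauFamily box (shapeBoxes lft rgt r) g) (hG : HasExchanges G (letters box) g)
    {i : ℕ} {c : ℤ} (hi : 1 ≤ i) (hir : i ≤ r) (hstart : 1 < i ∨ start lft r 1 < c)
    (hgood : IsGood G box lft rgt r i c) : IsGood G box lft rgt r i (c + 1) := by
  have hl0 := h.lft_le hir
  by_cases hic : (i, c) ∈ shapeBoxes lft rgt r ∧ lft r < c
  · obtain ⟨hic, hc⟩ := hic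
    obtain ⟨l, hl, hmem, halt⟩ := hgood
    obtain ⟨hv, hvm⟩ := valid_cons hic hi hc hl hmem
    have hlg : l.length + 1 ≤ g := length_le hcard hv
    refine ⟨_, hv, hvm, h.altOn_expand hG hi hc hv hmem hlg ?_⟩
    rcases hir.lt_or_eq with hir | rfl
    · exact h.altOn_snocClass_of_lt hB hG hi hir hc hstart hl hmem hlg halt
    · exact h.altOn_snocClass_last hB hG hic hl hv.2.2.1 hmem hlg halt
  -- Either there is no box at this place or it belongs to column lft r already, so the stage does
  -- not change.
  · refine isGood_congr hgood fun b hb => ?_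
    rw [h.mem_iff] at hb hic
    have := h.lft_le hb.1
    have hbi : b.1 = i → b.2 = c → b.2 = lft r := by
      rintro rfl rfl
      simp only at hic
      omega
    rw [Stage, Stage]
    omega

theorem isGood_row (h : IsWideShape lft rgt r) (hcard : (shapeBoxes lft rgt r).card = g)
    (hB : IsTableauFamily box (shapeBoxes lft rgt r) g) (hG : HasExchanges G (letters box) g)
    {i : ℕ} (hi : 1 ≤ i) (hir : i ≤ r) {c d : ℤ} (hcd : c ≤ d)
    (hstart : 1 < i ∨ start lft r 1 < c) (hgood : IsGood G box lft rgt r i c) :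
    IsGood G box lft rgt r i d := by
  induction d, hcd using Int.leInduction with
  | base => exact hgood
  | succ d hcd ih => exact h.isGood_succ hcard hB hG hi hir (by omega) ih

theorem isGood_rgt (h : IsWideShape lft rgt r) (hcard : (shapeBoxes lft rgt r).card = g)
    (hB : IsTableauFamily box (shapeBoxes lft rgt r) g) (hG : HasExchanges G (letters box) g)
    {i : ℕ} (hi : 1 ≤ i) (hir : i ≤ r) : IsGood G box lft rgt r i (rgt i) := by
  have hw := h.width
  induction i, hi using Nat.le_induction with
  | base =>
    have hl1 := h.lft_le hir
    have hr1 := h.rgt_le hir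
    have hr2 := h.two_le
    have hs3 : start lft r 1 = lft 1 ∨ start lft r 1 = lft r + 1 := max_choice _ _
    exact h.isGood_row hcard hB hG le_rfl hir (by omega) (Or.inr (by omega))
      (h.isGood_start hcard hB hG)
  | succ i hi ih =>
    have hl1 := h.lft_le hir
    have hr1 := h.rgt_le hir
    -- The end of row i and the left end of row i + 1 describe the same stage.
    refine h.isGood_row hcard hB hG (by omega) hir (c := lft (i + 1)) (by omega) (Or.inl (by omega))
      (isGood_congr (ih (by omega)) fun b hb => ?_)
    rw [h.mem_iff] at hb
    have h1 : b.1 = i → b.2 < rgt i := by rintro rfl; exact hb.2.2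
    have h2 : b.1 = i + 1 → lft (i + 1) ≤ b.2 := fun e => e ▸ hb.2.1
    rw [Stage, Stage]
    omega

theorem altOn_univ [DecidableEq X] (h : IsWideShape lft rgt r)
    (hcard : (shapeBoxes lft rgt r).card = g)
    (hB : IsTableauFamily box (shapeBoxes lft rgt r) g) (hG : HasExchanges G (letters box) g) :
    AltOn G Set.univ := by
  have hr2 := h.two_le
  obtain ⟨l, hl, hmem, halt⟩ := h.isGood_rgt hcard hB hG (i := r) (by omega) le_rfl
  have hall : ∀ b ∈ shapeBoxes lft rgt r, b ∈ l := by
    intro b hb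
    rw [hmem, Stage]
    refine ⟨hb, ?_⟩
    rw [h.mem_iff] at hb
    rcases hb.1.lt_or_eq with h1 | h1
    · exact Or.inr (Or.inr (Or.inl h1))
    · exact Or.inr (Or.inr (Or.inr ⟨h1, h1 ▸ hb.2.2⟩))
  have hlg : l.length = g := by
    rw [← hcard, ← List.toFinset_card_of_nodup hl.nodup]
    congr 1
    ext b
    rw [List.mem_toFinset]
    exact ⟨hl.mem_shape, hall b⟩
  exact hB.altOn_univ hl hall (hlg ▸ halt)

end IsWideShape

end InitialBoxes

/-! ### Standard tableaux of a skew shape as a family of words -/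

section StandardTableaux

variable {n g : ℕ} {s : Finset (Fin n × ℤ)}

/-- Order-convex sets of boxes. -/
def IsSkew (s : Finset (Fin n × ℤ)) : Prop := ∀ x ∈ s, ∀ y ∈ s, ∀ z, x ≤ z → z ≤ y → z ∈ s

/-- Convexity provides the box in the row of `x` and the column of `y`, through which the entries
increase first along the row and then down the column. -/
theorem IsSkew.lt (hs : IsSkew s) (T : StandardTableau s g) {x y : {b // b ∈ s}} (h : x.1 < y.1) :
    (T.1 x).1 < (T.1 y).1 := by
  have hle : ∀ x y : {b // b ∈ s}, x.1 = y.1 ∨ x.1.1 = y.1.1 ∧ x.1.2 < y.1.2 ∨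
      x.1.2 = y.1.2 ∧ x.1.1 < y.1.1 → (T.1 x).1 ≤ (T.1 y).1 := by
    rintro x y (h | h)
    · rw [Subtype.ext h]
    · exact (T.2 x y h).le
  obtain ⟨⟨x1, x2⟩, hx⟩ := x
  obtain ⟨⟨y1, y2⟩, hy⟩ := y
  have h' := h.le
  simp only [Prod.mk_le_mk] at h'
  have hz : (x1, y2) ∈ s := hs _ hx _ hy _ ⟨le_rfl, h'.2⟩ ⟨h'.1, le_rfl⟩
  rcases h'.2.lt_or_eq with h2 | rfl
  · refine lt_of_lt_of_le (T.2 ⟨_, hx⟩ ⟨_, hz⟩ (Or.inl ⟨rfl, h2⟩)) (hle _ _ ?_)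
    rcases h'.1.lt_or_eq with h1 | rfl
    · exact Or.inr (Or.inr ⟨rfl, h1⟩)
    · exact Or.inl rfl
  · refine T.2 _ _ (Or.inr ⟨rfl, lt_of_le_of_ne h'.1 ?_⟩)
    rintro rfl
    exact lt_irrefl _ h

/-- The box of the entry `i + 1`. -/
def boxAt (T : StandardTableau s g) (i : ℕ) : ℕ × ℤ :=
  if h : i < g then
    Prod.map Fin.val id (T.1.symm (entry (i + 1) (by omega) h)).1
  else (0, 0)

theorem boxAt_of_lt (T : StandardTableau s g) {i : ℕ} (h : i < g) :
    boxAt T i = Prod.map Fin.val id (T.1.symm (entry (i + 1) (by omega) h)).1 := dif_pos h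

theorem prodMap_val_lt {x y : Fin n × ℤ} :
    (Prod.map Fin.val id x : ℕ × ℤ) < Prod.map Fin.val id y ↔ x < y := by
  simp only [Prod.lt_iff, Prod.map_fst, Prod.map_snd, id, Fin.lt_def, Fin.le_def]

theorem prodMap_val_injective : Function.Injective (Prod.map Fin.val id : Fin n × ℤ → ℕ × ℤ) :=
  Fin.val_injective.prodMap Function.injective_id

theorem mem_prefixWord {α : Type*} {f : ℕ → α} {k : ℕ} {b : α} :
    b ∈ prefixWord f k ↔ ∃ i < k, f i = b := by
  induction k with
  | zero => simp [prefixWord]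
  | succ k ih =>
    rw [prefixWord, List.mem_cons, ih]
    constructor
    · rintro (rfl | ⟨i, hi, rfl⟩)
      · exact ⟨k, by omega, rfl⟩
      · exact ⟨i, by omega, rfl⟩
    · rintro ⟨i, hi, rfl⟩
      rcases Nat.lt_succ_iff_lt_or_eq.1 hi with h | rfl
      · exact Or.inr ⟨i, h, rfl⟩
      · exact Or.inl rfl

theorem exists_boxAt (T : StandardTableau s g) (x : {b // b ∈ s}) :
    ∃ i < g, (T.1 x).1 = i + 1 ∧ boxAt T i = Prod.map Fin.val id x.1 := by
  have h := Finset.mem_Icc.1 (T.1 x).2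
  refine ⟨(T.1 x).1 - 1, by omega, by omega, ?_⟩
  rw [boxAt_of_lt T (by omega)]
  congr 2
  rw [symm_apply_eq]
  apply Subtype.ext
  simp only [entry]
  omega

theorem IsSkew.isTableauFamily (hs : IsSkew s) {σ : Finset (ℕ × ℤ)}
    (hσ : ∀ b, b ∈ σ ↔ ∃ x ∈ s, Prod.map Fin.val id x = b) :
    IsTableauFamily (boxAt : StandardTableau s g → ℕ → ℕ × ℤ) σ g := by
  refine ⟨fun T => ?_, fun T b hb => ?_, fun T T' h => ?_⟩
  · have key : ∀ k ≤ g, Valid σ (prefixWord (boxAt T) k) := by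
      intro k hk
      induction k with
      | zero => trivial
      | succ k ih =>
        set y := T.1.symm (entry (k + 1) (by omega) hk) with hy
        have hby : boxAt T k = Prod.map Fin.val id y.1 := boxAt_of_lt T hk
        have hTy : (T.1 y).1 = k + 1 := by rw [hy, apply_symm_apply]; rfl
        refine ⟨ih (by omega), (hσ _).2 ⟨_, y.2, hby.symm⟩, fun hmem => ?_, fun b hb hlt => ?_⟩
        · obtain ⟨i, hi, he⟩ := mem_prefixWord.1 hmem
          rw [hby, boxAt_of_lt T (by omega)] at he
          have := congrArg Subtype.val (T.1.symm.injective (Subtype.ext (prodMap_val_injective he)))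
          simp only [entry] at this
          omega
        · obtain ⟨x, hx, rfl⟩ := (hσ b).1 hb
          rw [hby, prodMap_val_lt] at hlt
          have := hs.lt T (x := ⟨x, hx⟩) hlt
          obtain ⟨i, hi, h1, h2⟩ := exists_boxAt T ⟨x, hx⟩
          exact mem_prefixWord.2 ⟨i, by omega, h2⟩
    exact key g le_rfl
  · obtain ⟨x, hx, rfl⟩ := (hσ b).1 hb
    obtain ⟨i, hi, -, h2⟩ := exists_boxAt T ⟨x, hx⟩
    exact mem_prefixWord.2 ⟨i, hi, h2⟩
  · apply Subtype.ext
    rw [← symm_symm T.1, ← symm_symm T'.1]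
    congr 1
    ext1 ⟨k, hk⟩
    have hk' := Finset.mem_Icc.1 hk
    have := h (k - 1) (by omega)
    rw [boxAt_of_lt T (by omega), boxAt_of_lt T' (by omega)] at this
    have he : entry (g := g) (k - 1 + 1) (by omega) (by omega) = ⟨k, hk⟩ :=
      Subtype.ext (by simp only [entry]; omega)
    rw [he] at this
    exact Subtype.ext (prodMap_val_injective this)

/-- No box lies strictly between those of consecutive entries. So they are either adjacent, with
contents differing by one, or incomparable, in which case horizontal and vertical distance add up to
the difference of contents. -/
theorem IsSkew.canExchange_iff (hs : IsSkew s) (T : StandardTableau s g) {k a : ℕ} (hk : k + 2 ≤ g)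
    (ha : 2 ≤ a) : CanExchange (k + 1) a (by omega) hk T.1 ↔
      (content (boxAt T k) - content (boxAt T (k + 1))).natAbs = a := by
  rw [boxAt_of_lt T (by omega), boxAt_of_lt T (by omega), CanExchange, Exchangeable, boxDist]
  set x := T.1.symm (entry (k + 1) (by omega) (by omega)) with hx
  set y := T.1.symm (entry (k + 1 + 1) (by omega) hk) with hy
  have hTx : (T.1 x).1 = k + 1 := by rw [hx, apply_symm_apply]; rfl
  have hTy : (T.1 y).1 = k + 1 + 1 := by rw [hy, apply_symm_apply]; rfl
  have hne : x.1 ≠ y.1 := fun h => by rw [Subtype.ext h] at hTx; omega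
  have hyx : ¬ y.1 < x.1 := fun h => by have := hs.lt T h; omega
  have hbetween : ∀ z, x.1 < z → ¬ z < y.1 := by
    intro z hxz hzy
    have hz : z ∈ s := hs _ x.2 _ y.2 _ hxz.le hzy.le
    have h1 := hs.lt T (x := x) (y := ⟨z, hz⟩) hxz
    have h2 := hs.lt T (x := ⟨z, hz⟩) (y := y) hzy
    omega
  have h1 := hbetween (x.1.1, y.1.2)
  have h2 := hbetween (x.1.1, x.1.2 + 1)
  have hne' : ¬ (x.1.1 = y.1.1 ∧ x.1.2 = y.1.2) := fun h => hne (Prod.ext h.1 h.2)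
  have h3 : x.1.2 = y.1.2 → x.1.1 < y.1.1 → (y.1.1 : ℕ) = x.1.1 + 1 := by
    intro h4 h5
    by_contra h6
    have hlt : (x.1.1 : ℕ) + 1 < n := by have := y.1.1.2; rw [Fin.lt_def] at h5; omega
    refine hbetween (⟨x.1.1 + 1, hlt⟩, x.1.2) ?_ ?_
    · rw [Prod.lt_iff]; left; simp [Fin.lt_def]
    · rw [Prod.lt_iff]; left; simp only [Fin.lt_def, h4, le_refl, and_true] at h5 ⊢; omega
  simp only [Prod.lt_iff, Fin.lt_def, Fin.le_def, Fin.ext_iff, lt_irrefl, le_refl, true_and,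
    false_and, and_true, false_or, content, Prod.map_fst, Prod.map_snd, id, ne_eq] at *
  omega

theorem IsSkew.hasExchanges (hs : IsSkew s) (G : Subgroup (Perm (StandardTableau s g)))
    (hG : ∀ (t a : ℕ) (h1 : 1 ≤ t) (h2 : t < g), 0 < a → piPerm s t a h1 h2 ∈ G) :
    HasExchanges G (letters (boxAt : StandardTableau s g → ℕ → ℕ × ℤ)) g := by
  intro k hk a ha
  refine ⟨_, hG (k + 1) a (by omega) hk (by omega), fun T => ?_⟩
  have hcan : _ ↔ (letters boxAt T k - letters boxAt T (k + 1)).natAbs = a :=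
    hs.canExchange_iff T hk ha
  change letters boxAt (piMap s (k + 1) a _ _ T) = _
  rw [piMap]
  by_cases h : CanExchange (k + 1) a (by omega) hk T.1
  · rw [dif_pos h, if_pos (hcan.1 h)]
    funext i
    simp only [letters, Function.comp]
    congr 1
    by_cases hi : i < g
    · have hi' : swap k (k + 1) i < g := by
        rw [swap_apply_def]; split_ifs <;> omega
      rw [boxAt_of_lt _ hi, boxAt_of_lt _ hi']
      simp only [exchange, symm_trans_apply, symm_swap]
      congr 3
      by_cases h1 : i = k
      · subst h1
        rw [swap_apply_left]
        apply Subtype.ext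
        simp [entry]
      by_cases h2 : i = k + 1
      · subst h2
        rw [swap_apply_right]
        apply Subtype.ext
        simp [entry]
      rw [swap_apply_of_ne_of_ne]
      · apply Subtype.ext
        simp [entry, swap_apply_of_ne_of_ne h1 h2]
      · simpa [entry] using h1
      · simpa [entry] using h2
    -- Beyond position g both sides are the default box.
    · rw [swap_apply_of_ne_of_ne (by omega) (by omega), boxAt, boxAt, dif_neg hi, dif_neg hi]
  · rw [dif_neg h, if_neg fun e => h (hcan.2 e)]

end StandardTableaux

/-! ### The shape given by the ramification sequences -/

section BrillNoether

/-- The first column of row `i`. -/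
def leftEnd {r : ℕ} (α : Fin (r + 1) → ℕ) (i : ℕ) : ℤ := -(α ⟨r - i, by omega⟩ : ℤ)

/-- The first column to the right of row `i`. -/
def rightEnd {r : ℕ} (g d : ℕ) (β : Fin (r + 1) → ℕ) (i : ℕ) : ℤ :=
  (g : ℤ) - d + r + β ⟨min i r, by omega⟩

variable {g r d : ℕ} {α β : Fin (r + 1) → ℕ}

theorem mem_skewShape_iff {b : Fin (r + 1) × ℤ} : b ∈ skewShape g r d α β ↔
    leftEnd α b.1 ≤ b.2 ∧ b.2 < rightEnd g d β b.1 := by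
  rw [mem_skewShape, leftEnd, rightEnd]
  have h1 : b.1.rev = ⟨r - b.1, by omega⟩ := Fin.ext (by simp [Fin.val_rev])
  have h2 : b.1 = ⟨min b.1 r, by omega⟩ := Fin.ext (by simp only; omega)
  rw [h1, ← h2]

/-- The width of the shape is the inequality on α_r + β_r + g - d + r. The overlap of consecutive
rows is condition 1, with lft 0 - lft r = α_0 - α_r. -/
theorem isWideShape (hα : Antitone α) (hβ : Antitone β) (hr : 2 ≤ r)
    (hwidth : (α (Fin.last r) : ℤ) + β (Fin.last r) + ((g : ℤ) - d + r) > (r : ℤ) + 1)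
    (hcond : RamificationConditions g r d α β) : IsWideShape (leftEnd α) (rightEnd g d β) r := by
  have e1 : leftEnd α 0 = -(α (Fin.last r) : ℤ) := rfl
  have e2 : leftEnd α r = -(α 0 : ℤ) := by
    rw [leftEnd]
    congr 3
    exact Fin.ext (by simp)
  have e3 : rightEnd g d β r = (g : ℤ) - d + r + β (Fin.last r) := by
    rw [rightEnd]
    congr 3
    exact Fin.ext (by simp)
  refine ⟨fun i j hij => ?_, fun i j hij => ?_, hr, by omega, fun j hj => ?_⟩
  · have := hα (a := ⟨r - j, by omega⟩) (b := ⟨r - i, by omega⟩) (by simp only [Fin.mk_le_mk]; omega)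
    simp only [leftEnd]
    omega
  · have := hβ (a := ⟨min i r, by omega⟩) (b := ⟨min j r, by omega⟩)
      (by simp only [Fin.mk_le_mk]; omega)
    simp only [rightEnd]
    omega
  · have h1 := lt_of_le_of_lt (le_max_left _ _) (hcond.cond1 j hj)
    have h2 : (⟨min j r, by omega⟩ : Fin (r + 1)) = ⟨j, by omega⟩ := Fin.ext (by simp only; omega)
    have h3 : leftEnd α (j + 1) = -(α ⟨r - j - 1, by omega⟩ : ℤ) := rfl
    have h4 : rightEnd g d β j = (g : ℤ) - d + r + β ⟨j, by omega⟩ := by rw [rightEnd, h2]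
    omega

theorem mem_shapeBoxes_iff (h : IsWideShape (leftEnd α) (rightEnd g d β) r) (b : ℕ × ℤ) :
    b ∈ shapeBoxes (leftEnd α) (rightEnd g d β) r ↔
      ∃ x ∈ skewShape g r d α β, Prod.map Fin.val id x = b := by
  rw [h.mem_iff]
  constructor
  · rintro ⟨h1, h2⟩
    exact ⟨(⟨b.1, by omega⟩, b.2), mem_skewShape_iff.2 h2, rfl⟩
  · rintro ⟨x, hx, rfl⟩
    exact ⟨Nat.lt_succ_iff.1 x.1.2, mem_skewShape_iff.1 hx⟩

theorem isSkew_skewShape (h : IsWideShape (leftEnd α) (rightEnd g d β) r) :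
    IsSkew (skewShape g r d α β) := by
  intro x hx y hy z hxz hzy
  rw [mem_skewShape_iff] at hx hy ⊢
  exact ⟨(h.lft_anti hxz.1).trans (hx.1.trans hxz.2), (hzy.2.trans_lt hy.2).trans_le (h.rgt_anti hzy.1)⟩

end BrillNoether

end EHMonodromy

theorem mainTheorem7 (g r d : ℕ) (hgrd : d ≤ g + r) (α β : Fin (r + 1) → ℕ)
    (hα : Antitone α) (hβ : Antitone β)
    (hρ : adjustedBrillNoether g r d α β = 0)
    (hr : 2 ≤ r)
    (hwidth : (α (Fin.last r) : ℤ) + β (Fin.last r) + ((g : ℤ) - d + r) > (r : ℤ) + 1)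
    (hcond : RamificationConditions g r d α β) :
    EHGroup g r d α β
        = alternatingGroup (StandardTableau (skewShape g r d α β) g) ∨
      EHGroup g r d α β = ⊤ := by
  have h := EHMonodromy.isWideShape hα hβ hr hwidth hcond
  have hs := EHMonodromy.isSkew_skewShape h
  have hσ := EHMonodromy.mem_shapeBoxes_iff h
  rcases isEmpty_or_nonempty (StandardTableau (skewShape g r d α β) g) with hX | ⟨⟨T⟩⟩
  -- Without tableaux the permutation group is trivial.
  · exact Or.inr (Subsingleton.elim _ _)
  have hcard : (EHMonodromy.shapeBoxes (EHMonodromy.leftEnd α) (EHMonodromy.rightEnd g d β) r).card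
      = g := by
    have h1 : EHMonodromy.shapeBoxes (EHMonodromy.leftEnd α) (EHMonodromy.rightEnd g d β) r =
        (skewShape g r d α β).image (Prod.map Fin.val id) := by
      ext b
      rw [hσ, Finset.mem_image]
    rw [h1, Finset.card_image_of_injective _ EHMonodromy.prodMap_val_injective]
    -- A tableau is a bijection from the boxes to 1, …, g, so its existence gives their number.
    have := Finset.card_eq_of_equiv T.1
    simpa using this
  refine EHMonodromy.eq_alternatingGroup_or_eq_top (h.altOn_univ hcard (hs.isTableauFamily hσ)
    (hs.hasExchanges _ fun t a h1 h2 ha => Subgroup.subset_closure ⟨t, a, h1, h2, ha, rfl⟩))
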